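/- **Setting.** Let $\Omega\subset\mathbb R^2$ be a polygonal domain composed of a Brinkman region $\Omega_B$ and a Darcy region $\Omega_D$, separated by an interface $\Gamma$; put $\Gamma_i=\partial\Omega_i\setminus\Gamma$ ($i=B,D$), and let $\mathbf n$ be the outward unit normal on $\partial\Omega$. Let $\Omega$ be partitioned conformingly into triangles and quadrilaterals, aligned with $\Gamma$; each element is cut into triangles by joining an interior point to its vertices. Let $\mathcal T_h$ be the resulting triangulation, $\mathcal F_{pr}$ the set of edges of the initial partition, $\mathcal F_{pr}^0\subset\mathcal F_{pr}$ those not on $\partial\Omega$ (interface edges included), and $\mathcal F_{dl}$ the set of new edges. Write $(\cdot,\cdot)_S$ and $\|\cdot\|_{0,S}$ for the $L^2$ product and norm ($S=\Omega$ if omitted). Across an edge whose fixed unit normal $\mathbf n$ points from $\tau_1$ to $\tau_2$, let $[v]=v|_{\tau_1}-v|_{\tau_2}$ and $\{v\}=\tfrac12(v|_{\tau_1}+v|_{\tau_2})$; on $\partial\Omega$ let $[v]=v$ with $\mathbf n$ outward. A subscript $B$ or $D$ on $\mathcal T_h$, $\mathcal F_{pr}$, $\mathcal F_{dl}$ restricts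 to the triangles or edges of that region; $\mathcal F_{pr,B},\mathcal F_{pr,D}$ exclude the interface edges $\mathcal F_\Gamma$, and a superscript $0$ also excludes the edges on $\partial\Omega$. Let $\mathbf n_i$ be the outward unit normal of $\Omega_i$, $\mathbf t$ a unit tangent, $\nabla_h,\operatorname{div}_h$ the elementwise operators, and $k\ge1$. **Flow.** Let $f$ vanish on $\Omega_B$ and be piecewise polynomial of degree $\le k-1$ on $\mathcal T_{h,D}$, and put $f^\pm=\max\{\pm f,0\}$. Let $g\in L^2(\partial\Omega)$ be the prescribed normal velocity. Let the exact velocity $\mathbf u\in L^2(\Omega)^2$ satisfy $\nabla\cdot\mathbf u=f$ in $\Omega$ (so its normal component is continuous across $\Gamma$) and $\mathbf u\cdot\mathbf n=g$ on $\partial\Omega$. Put $\Gamma_{in}=\{x\in\partial\Omega:\mathbf u\cdot\mathbf n<0\}$ and $\Gamma_{out}=\{x\in\partial\Omega:\mathbf u\cdot\mathbf n\ge0\}$. Let $\epsilon>0$, let $\alpha$ be a constant symmetric positive definite tensor, $K_D$ a measurable symmetric tensor field on $\Omega_D$ with eigenvalues between positive constants, and $\mathbf f_i\in L^2(\Omega_i)^2$.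 Define the spaces - $W_h^B$: matrix fields $\mathbf G$ on $\Omega_B$, piecewise $P^k$, with $[\mathbf G\mathbf n]=0$ on $\mathcal F_{pr,B}^0$, $[(\mathbf G\mathbf n)\cdot\mathbf t]=0$ on $\mathcal F_{dl,B}$ and $\mathbf G\mathbf n=0$ on $\partial\Omega_B$; - $H_h^B$: vector fields $\mathbf v$ on $\Omega_B$, piecewise $P^k$, with $[\mathbf v\cdot\mathbf n]=0$ on $\mathcal F_{dl,B}$; - $Q_h^0$: functions on $\Omega_B$, piecewise $P^k$, with zero jump on $\mathcal F_{pr,B}^0$ and mean zero over $\Omega_B$; - $H_{h,g}^D$: $H(\mathrm{div};\Omega_D)$ vector fields, piecewise $P^k$, whose normal component on each edge of $\Gamma_D$ is the $L^2$-projection of $g$ onto $P^k$ of that edge; $H^D_{h,0}$ is the case $g=0$; - $Q_h^D$: functions on $\Omega_D$, piecewise $P^{k-1}$; and the forms $$B_h^*(\mathbf v,\mathbf G)=\sum_{e\in\mathcal F_{dl,B}}([\mathbf G\mathbf n],(\mathbf v\cdot\mathbf n)\mathbf n)_e-(\operatorname{div}_h\mathbf G,\mathbf v)_{\Omega_B},$$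 $$B_h(\mathbf G,\mathbf v)=-\sum_{e\in\mathcal F_{pr,B}^0}(\mathbf G\mathbf n,[\mathbf v])_e-\sum_{e\in\mathcal F_{dl,B}}((\mathbf G\mathbf n)\cdot\mathbf t,[\mathbf v\cdot\mathbf t])_e+(\mathbf G,\nabla_h\mathbf v)_{\Omega_B},$$ $$b_h^*(q,\mathbf v)=\sum_{e\in\mathcal F_{pr,B}}([\mathbf v\cdot\mathbf n],q)_e+\sum_{e\in\mathcal F_\Gamma}(\mathbf v\cdot\mathbf n_B,q)_e-(q,\operatorname{div}_h\mathbf v)_{\Omega_B},$$ $$b_h(\mathbf v,q)=-\sum_{e\in\mathcal F_{dl,B}}(\mathbf v\cdot\mathbf n,[q])_e+(\mathbf v,\nabla_hq)_{\Omega_B},\quad A_h(\mathbf v,q)=(q,\nabla\cdot\mathbf v)_{\Omega_D},\quad I_h(q,\mathbf v)=\sum_{e\in\mathcal F_\Gamma}(\mathbf v\cdot\mathbf n_D,q)_e.$$ Let $(\mathbf L_h,\mathbf u_{B,h},p_{B,h})\in W_h^B\times H_h^B\times Q_h^0$ and $(\mathbf u_{D,h},p_{D,h})\in H_{h,g}^D\times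 Q_h^D$ solve $$(\epsilon^{-1}\mathbf L_h,\mathbf G)_{\Omega_B}-B_h^*(\mathbf u_{B,h},\mathbf G)+(K_D^{-1}\mathbf u_{D,h},\mathbf v_D)_{\Omega_D}+I_h(p_{B,h},\mathbf v_D)-A_h(\mathbf v_D,p_{D,h})=(\mathbf f_D,\mathbf v_D)_{\Omega_D},$$ $$B_h(\mathbf L_h,\mathbf v_B)+(\alpha\mathbf u_{B,h},\mathbf v_B)_{\Omega_B}+b_h^*(p_{B,h},\mathbf v_B)+A_h(\mathbf u_{D,h},q_D)=(\mathbf f_B,\mathbf v_B)_{\Omega_B}+(f,q_D)_{\Omega_D},$$ $$-I_h(q_B,\mathbf u_{D,h})-b_h(\mathbf u_{B,h},q_B)=-(g,q_B)_{\Gamma_B}$$ for all $(\mathbf G,\mathbf v_B,q_B)\in W_h^B\times H_h^B\times Q_h^0$ and $(\mathbf v_D,q_D)\in H_{h,0}^D\times Q_h^D$. Let $\mathbf u_h=\mathbf u_{i,h}$ on $\Omega_i$, $i=B,D$. **Transport.** Let $T>0$. Let the porosity $\phi$ be measurable with $0<\phi_*\le\phi\le\phi^*$ on the whole of $\Omega$.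 Let $K(x,t)$ be a measurable symmetric tensor with eigenvalues in $[K_{\min},K_{\max}]$, $K_{\min}>0$. Let $c^0\in L^2(\Omega)$, $s\in L^1(0,T;L^2(\Omega))$, and let $c_{in},\hat c$ be measurable with $|\mathbf u\cdot\mathbf n|\,c_{in}^2\in L^1(\Gamma_{in}\times(0,T))$ and $\hat c^2f^+\in L^1(\Omega_D\times(0,T))$. Let $U_h$ be the piecewise $P^k$ functions on $\mathcal T_h$ with zero jump on $\mathcal F_{pr}^0$, and $W_h$ the piecewise $P^k$ vector fields with zero normal jump on $\mathcal F_{dl}$. Put $$T_h^*(c,\boldsymbol\psi)=\sum_{\tau\in\mathcal T_h}(c,\nabla\cdot\boldsymbol\psi)_\tau-\sum_{e\in\mathcal F_{pr}}(c,[\boldsymbol\psi]\cdot\mathbf n)_e,\qquad T_h(\mathbf z,q)=-\sum_{\tau\in\mathcal T_h}(\mathbf z,\nabla q)_\tau+\sum_{e\in\mathcal F_{dl}}(\mathbf z\cdot\mathbf n,[q])_e,$$ $$S_h(c,q)=\sum_{e\in\mathcal F_{dl}}\int_e\{c\}[q]\,\mathbf u_h\cdot\mathbf n\,ds+\tfrac12\sum_{e\in\mathcal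 F_{dl}}\int_e[c][q]\,|\mathbf u_h\cdot\mathbf n|\,ds.$$ Let $\mathbf z_h(t)\in W_h$, $c_h(t)\in U_h$, with $c_h$ absolutely continuous on $[0,T]$, be a semi-discrete solution: $c_h(0)$ is the $L^2(\Omega)$-projection of $c^0$ onto $U_h$, and for almost every $t\in(0,T)$ and all $(\boldsymbol\psi,q)\in W_h\times U_h$, $$(K^{-1}\mathbf z_h,\boldsymbol\psi)-T_h^*(c_h,\boldsymbol\psi)=0,$$ $$\begin{aligned}&(\phi\,\partial_tc_h,q)+(c_hf^-,q)+T_h(\mathbf z_h,q)-(\mathbf u_hc_h,\nabla_hq)+S_h(c_h,q)+(\mathbf u_h\cdot\mathbf n\,c_h,q)_{\Gamma_{out}}\\&\quad+\tfrac12((\mathbf u-\mathbf u_h)\cdot\mathbf n\,c_h,q)_{\Gamma_{out}}-\tfrac12((\mathbf u-\mathbf u_h)\cdot\mathbf n\,c_h,q)_{\Gamma_{in}}=(\phi s,q)-(c_{in}\mathbf u\cdot\mathbf n,q)_{\Gamma_{in}}+(\hat cf^+,q).\end{aligned}$$ **Theorem (stability).** The function $t\mapsto\|K^{-1/2}\mathbf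 z_h(t)\|_0^2$ is integrable on $(0,T)$, and $$\Big(\|\phi^{1/2}c_h(T)\|_0^2+2\int_0^T\|K^{-1/2}\mathbf z_h\|_0^2\,dt\Big)^{1/2}\le\Big(\phi^*\|c^0\|_0^2+\int_0^T\big((|\mathbf u\cdot\mathbf n|,c_{in}^2)_{\Gamma_{in}}+(\hat c^2,f^+)_{\Omega_D}\big)dt\Big)^{1/2}+\int_0^T\|\phi^{1/2}s\|_0\,dt.$$ -/

import Mathlib

open MeasureTheory Set

namespace BDT

noncomputable section

/-! ### Elementary geometry of the plane and polynomials in two variables -/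

/-- Points (and vectors) of the plane. -/
abbrev Pt := Fin 2 → ℝ

/-- Real polynomials in two variables. -/
abbrev Poly := MvPolynomial (Fin 2) ℝ

/-- The Euclidean length of the segment from `p` to `q`. -/
def len (p q : Pt) : ℝ := Real.sqrt ((q 0 - p 0) ^ 2 + (q 1 - p 1) ^ 2)

/-- The unit tangent of the segment directed from `p` to `q`. -/
def tangent (p q : Pt) : Pt := ![(q 0 - p 0) / len p q, (q 1 - p 1) / len p q]

/-- The unit normal on the right-hand side of the segment directed from `p` to `q`; it is the
outward normal when the segment is run through as part of a counterclockwise boundary. -/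
def normal (p q : Pt) : Pt := ![(q 1 - p 1) / len p q, -((q 0 - p 0) / len p q)]

/-- The arc length integral of `F` over the straight segment with end points `p`, `q`. -/
def edgeInt (p q : Pt) (F : Pt → ℝ) : ℝ :=
  len p q * ∫ r in (0 : ℝ)..1, F (AffineMap.lineMap p q r)

/-- Value of a polynomial. -/
def ev (P : Poly) (x : Pt) : ℝ := MvPolynomial.eval x P

/-- Value of a vector of polynomials. -/
def evV (v : Fin 2 → Poly) (x : Pt) : Pt := fun i => ev (v i) x

/-- Value of a matrix of polynomials. -/
def evM (G : Fin 2 → Fin 2 → Poly) (x : Pt) : Matrix (Fin 2) (Fin 2) ℝ :=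
  Matrix.of fun i j => ev (G i j) x

/-- Gradient of a polynomial. -/
def grad (P : Poly) (x : Pt) : Pt := fun i => ev (MvPolynomial.pderiv i P) x

/-- Divergence of a polynomial vector field. -/
def dv (v : Fin 2 → Poly) (x : Pt) : ℝ := ∑ i, ev (MvPolynomial.pderiv i (v i)) x

/-- Gradient of a polynomial vector field, `(∇ v)_{ij} = ∂_j v_i`. -/
def gradV (v : Fin 2 → Poly) (x : Pt) : Matrix (Fin 2) (Fin 2) ℝ :=
  Matrix.of fun i j => ev (MvPolynomial.pderiv j (v i)) x

/-- Row-wise divergence of a polynomial matrix field. -/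
def divM (G : Fin 2 → Fin 2 → Poly) (x : Pt) : Pt :=
  fun i => ∑ j, ev (MvPolynomial.pderiv j (G i j)) x

/-- The Frobenius product of two matrices. -/
def frob (A B : Matrix (Fin 2) (Fin 2) ℝ) : ℝ := ∑ i, ∑ j, A i j * B i j

/-- `K` is symmetric with all eigenvalues in `[m, m']`, at every point of `S`. -/
def SPDOn (K : Pt → Matrix (Fin 2) (Fin 2) ℝ) (S : Set Pt) (m m' : ℝ) : Prop :=
  ∀ x ∈ S, (K x).IsSymm ∧
    ∀ ξ : Pt, m * (ξ ⬝ᵥ ξ) ≤ ξ ⬝ᵥ (K x).mulVec ξ ∧ ξ ⬝ᵥ (K x).mulVec ξ ≤ m' * (ξ ⬝ᵥ ξ)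

/-- The `L²(S)` norm of a function. -/
def l2norm (S : Set Pt) (w : Pt → ℝ) : ℝ := Real.sqrt (∫ x in S, w x ^ 2)

/-- The vertices of a triangle. -/
def vertexSet (p q r : Pt) : Set Pt := {p, q, r}

/-! ### The mesh

The initial partition consists of triangles and quadrilaterals.  A point `ν` inside each element is
joined to its vertices.  This cuts the element into three or four subtriangles, the cells.  The cell
`τ` is the counterclockwise triangle with vertices `ν = apex τ`, `fst τ`, `snd τ`.  Its only primal
edge (an edge of the initial partition) is the base from `fst τ` to `snd τ`.  Its neighbour
`next τ` in the same element lies across the dual edge with end points `snd τ` and `apex τ`.  Thus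
the dual edges are in bijection with the cells.  -/

/-- A staggered mesh: a conforming partition of a polygonal domain into triangles and
quadrilaterals, each of which is subdivided from an interior point, with every element lying in
the Brinkman region or in the Darcy region. -/
structure StaggeredMesh where
  /-- the number of cells (subtriangles) -/
  N : ℕ
  /-- the interior point of the element that contains the cell -/
  apex : Fin N → Pt
  /-- first end point of the primal edge of a cell -/
  fst : Fin N → Pt
  /-- second end point of the primal edge of a cell -/
  snd : Fin N → Pt
  /-- the next cell of the same element, counterclockwise -/
  next : Equiv.Perm (Fin N)
  /-- the cell on the other side of the primal edge; the cell itself for an edge on `∂Ω` -/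
  opp : Fin N → Fin N
  /-- one cell for each primal edge, namely the one from which the fixed normal `n_e` points away -/
  lead : Finset (Fin N)
  /-- `true` on the cells of the Brinkman region, `false` on those of the Darcy region -/
  brinkman : Fin N → Bool
  /-- cells are nondegenerate and counterclockwise -/
  orient : ∀ τ, 0 < (fst τ 0 - apex τ 0) * (snd τ 1 - apex τ 1)
    - (fst τ 1 - apex τ 1) * (snd τ 0 - apex τ 0)
  apex_next : ∀ τ, apex (next τ) = apex τ
  fst_next : ∀ τ, fst (next τ) = snd τ
  /-- every element is a triangle or a quadrilateral -/
  shape : ∀ τ, (next ^ 3) τ = τ ∨ (next ^ 4) τ = τ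
  brinkman_next : ∀ τ, brinkman (next τ) = brinkman τ
  /-- different cells do not overlap -/
  nonoverlap : ∀ τ σ, τ ≠ σ →
    Disjoint (interior (convexHull ℝ (vertexSet (apex τ) (fst τ) (snd τ))))
      (interior (convexHull ℝ (vertexSet (apex σ) (fst σ) (snd σ))))
  /-- different cells meet in a common vertex, in a common edge or not at all -/
  conforming : ∀ τ σ, τ ≠ σ →
    convexHull ℝ (vertexSet (apex τ) (fst τ) (snd τ)) ∩
        convexHull ℝ (vertexSet (apex σ) (fst σ) (snd σ)) =
      convexHull ℝ (vertexSet (apex τ) (fst τ) (snd τ) ∩ vertexSet (apex σ) (fst σ) (snd σ))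
  opp_opp : ∀ τ, opp (opp τ) = τ
  fst_opp : ∀ τ, opp τ ≠ τ → fst (opp τ) = snd τ
  snd_opp : ∀ τ, opp τ ≠ τ → snd (opp τ) = fst τ
  /-- two different cells with the same primal edge are opposite to each other -/
  opp_eq : ∀ τ σ, σ ≠ τ → fst σ = snd τ → snd σ = fst τ → opp τ = σ
  lead_bdry : ∀ τ, opp τ = τ → τ ∈ lead
  lead_inner : ∀ τ, opp τ ≠ τ → (τ ∈ lead ↔ opp τ ∉ lead)

namespace StaggeredMesh

variable (M : StaggeredMesh)

/-- The cell `τ` as a closed triangle. -/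
def cell (τ : Fin M.N) : Set Pt := convexHull ℝ (vertexSet (M.apex τ) (M.fst τ) (M.snd τ))

/-- The cells of the Brinkman region. -/
def cellsB : Finset (Fin M.N) := Finset.univ.filter fun τ => M.brinkman τ = true

/-- The cells of the Darcy region. -/
def cellsD : Finset (Fin M.N) := Finset.univ.filter fun τ => M.brinkman τ = false

/-- The whole (open) domain `Ω`. -/
def Ω : Set Pt := interior (⋃ τ, M.cell τ)

/-- The Brinkman domain `Ω_B`. -/
def ΩB : Set Pt := interior (⋃ τ ∈ M.cellsB, M.cell τ)

/-- The Darcy domain `Ω_D`. -/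
def ΩD : Set Pt := interior (⋃ τ ∈ M.cellsD, M.cell τ)

/-- The edges on `∂Ω`. -/
def bdry : Finset (Fin M.N) := Finset.univ.filter fun τ => M.opp τ = τ

/-- The edges on `Γ_B`. -/
def edgesΓB : Finset (Fin M.N) :=
  Finset.univ.filter fun τ => M.opp τ = τ ∧ M.brinkman τ = true

/-- The edges on `Γ_D`. -/
def edgesΓD : Finset (Fin M.N) :=
  Finset.univ.filter fun τ => M.opp τ = τ ∧ M.brinkman τ = false

/-- The interface edges, each represented by its cell in the Brinkman region. -/
def edgesΓ : Finset (Fin M.N) :=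
  Finset.univ.filter fun τ => M.brinkman τ = true ∧ M.brinkman (M.opp τ) = false

/-- The primal edges of the Brinkman region, without the interface. -/
def prB : Finset (Fin M.N) :=
  M.lead.filter fun τ => M.brinkman τ = true ∧ M.brinkman (M.opp τ) = true

/-- The primal edges interior to the Brinkman region. -/
def prB0 : Finset (Fin M.N) := M.prB.filter fun τ => M.opp τ ≠ τ

/-- The primal edges interior to the Darcy region. -/
def prD0 : Finset (Fin M.N) :=
  M.lead.filter fun τ => M.brinkman τ = false ∧ M.brinkman (M.opp τ) = false ∧ M.opp τ ≠ τ

/-- All primal edges that do not lie on `∂Ω` (interface edges included). -/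
def pr0 : Finset (Fin M.N) := M.lead.filter fun τ => M.opp τ ≠ τ

/-- The unit normal of the primal edge of `τ`, outward from `τ`. -/
def nPr (τ : Fin M.N) : Pt := normal (M.fst τ) (M.snd τ)

/-- The unit normal of the dual edge between `τ` and `next τ`, from `τ` to `next τ`. -/
def nDl (τ : Fin M.N) : Pt := normal (M.snd τ) (M.apex τ)

/-- The unit tangent of the dual edge between `τ` and `next τ`. -/
def tDl (τ : Fin M.N) : Pt := tangent (M.snd τ) (M.apex τ)

/-- The primal edge of `τ` as a set. -/
def segPr (τ : Fin M.N) : Set Pt := segment ℝ (M.fst τ) (M.snd τ)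

/-- The dual edge between `τ` and `next τ` as a set. -/
def segDl (τ : Fin M.N) : Set Pt := segment ℝ (M.snd τ) (M.apex τ)

/-- Sum over the cells in `S` of the integral over the cell. -/
def intCells (S : Finset (Fin M.N)) (F : Fin M.N → Pt → ℝ) : ℝ :=
  ∑ τ ∈ S, ∫ x in M.cell τ, F τ x

/-- Sum over the primal edges in `S` of the integral over the edge. -/
def intPr (S : Finset (Fin M.N)) (F : Fin M.N → Pt → ℝ) : ℝ :=
  ∑ τ ∈ S, edgeInt (M.fst τ) (M.snd τ) (F τ)

/-- Sum over the dual edges in `S` of the integral over the edge. -/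
def intDl (S : Finset (Fin M.N)) (F : Fin M.N → Pt → ℝ) : ℝ :=
  ∑ τ ∈ S, edgeInt (M.snd τ) (M.apex τ) (F τ)

variable {M}

/-- The jump across a primal edge, `w₁ - w₂` with `n_e` pointing from the first to the second
cell, and `w₁` on `∂Ω`. -/
def jumpPr {V : Type} [AddGroup V] (w : Fin M.N → V) (τ : Fin M.N) : V :=
  if M.opp τ = τ then w τ else w τ - w (M.opp τ)

/-- The jump across a dual edge. -/
def jumpDl {V : Type} [AddGroup V] (w : Fin M.N → V) (τ : Fin M.N) : V := w τ - w (M.next τ)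

/-- The average on a dual edge. -/
def avgDl (w : Fin M.N → ℝ) (τ : Fin M.N) : ℝ := (w τ + w (M.next τ)) / 2

variable (M)

/-! ### Piecewise polynomial spaces

A piecewise polynomial function is given by one polynomial for each cell. For the spaces on `Ω_B`
and `Ω_D` only the polynomials of the cells in that region matter. -/

/-- The velocity space `H_h^B`. -/
def HB (k : ℕ) : Set (Fin M.N → Fin 2 → Poly) :=
  {v | (∀ τ ∈ M.cellsB, ∀ i, (v τ i).totalDegree ≤ k) ∧
    ∀ τ ∈ M.cellsB, ∀ x ∈ M.segDl τ, jumpDl (fun σ => evV (v σ) x ⬝ᵥ M.nDl τ) τ = 0}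

/-- The space `W_h^B` for the velocity gradient. -/
def WB (k : ℕ) : Set (Fin M.N → Fin 2 → Fin 2 → Poly) :=
  {G | (∀ τ ∈ M.cellsB, ∀ i j, (G τ i j).totalDegree ≤ k) ∧
    (∀ τ ∈ M.prB0, ∀ x ∈ M.segPr τ, jumpPr (fun σ => (evM (G σ) x).mulVec (M.nPr τ)) τ = 0) ∧
    (∀ τ ∈ M.cellsB, ∀ x ∈ M.segDl τ,
      jumpDl (fun σ => (evM (G σ) x).mulVec (M.nDl τ) ⬝ᵥ M.tDl τ) τ = 0) ∧
    ∀ τ ∈ M.edgesΓB ∪ M.edgesΓ, ∀ x ∈ M.segPr τ, (evM (G τ) x).mulVec (M.nPr τ) = 0}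

/-- The space `Q_h^B`. -/
def QB (k : ℕ) : Set (Fin M.N → Poly) :=
  {q | (∀ τ ∈ M.cellsB, (q τ).totalDegree ≤ k) ∧
    ∀ τ ∈ M.prB0, ∀ x ∈ M.segPr τ, jumpPr (fun σ => ev (q σ) x) τ = 0}

/-- The pressure space `Q_h^0`: the functions of `Q_h^B` with mean zero. -/
def QB0 (k : ℕ) : Set (Fin M.N → Poly) :=
  {q | q ∈ M.QB k ∧ M.intCells M.cellsB (fun τ x => ev (q τ) x) = 0}

/-- The space `H_{h,g}^D`: `H(div; Ω_D)`-conforming piecewise polynomial fields (the normal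
component is continuous across all edges inside `Ω_D`) whose normal component on every edge of
`Γ_D` is the `L²`-projection of `g` onto the polynomials of degree at most `k`. -/
def HD (k : ℕ) (g : Pt → ℝ) : Set (Fin M.N → Fin 2 → Poly) :=
  {v | (∀ τ ∈ M.cellsD, ∀ i, (v τ i).totalDegree ≤ k) ∧
    (∀ τ ∈ M.cellsD, ∀ x ∈ M.segDl τ, jumpDl (fun σ => evV (v σ) x ⬝ᵥ M.nDl τ) τ = 0) ∧
    (∀ τ ∈ M.prD0, ∀ x ∈ M.segPr τ, jumpPr (fun σ => evV (v σ) x ⬝ᵥ M.nPr τ) τ = 0) ∧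
    ∀ τ ∈ M.edgesΓD, ∀ χ : Poly, χ.totalDegree ≤ k →
      edgeInt (M.fst τ) (M.snd τ) (fun x => (g x - evV (v τ) x ⬝ᵥ M.nPr τ) * ev χ x) = 0}

/-- The space `Q_h^D`. -/
def QD (k : ℕ) : Set (Fin M.N → Poly) :=
  {q | ∀ τ ∈ M.cellsD, (q τ).totalDegree ≤ k - 1}

/-- The concentration space `U_h`. -/
def U (k : ℕ) : Set (Fin M.N → Poly) :=
  {q | (∀ τ, (q τ).totalDegree ≤ k) ∧
    ∀ τ ∈ M.pr0, ∀ x ∈ M.segPr τ, jumpPr (fun σ => ev (q σ) x) τ = 0}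

/-- The space `W_h` for the diffusive flux. -/
def W (k : ℕ) : Set (Fin M.N → Fin 2 → Poly) :=
  {ψ | (∀ τ i, (ψ τ i).totalDegree ≤ k) ∧
    ∀ τ, ∀ x ∈ M.segDl τ, jumpDl (fun σ => evV (ψ σ) x ⬝ᵥ M.nDl τ) τ = 0}

/-! ### The bilinear forms of the flow scheme -/

/-- `B_h^*(u, G)` -/
def formBstar (u : Fin M.N → Fin 2 → Poly) (G : Fin M.N → Fin 2 → Fin 2 → Poly) : ℝ :=
  M.intDl M.cellsB (fun τ x => jumpDl (fun σ => (evM (G σ) x).mulVec (M.nDl τ)) τ ⬝ᵥ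
      ((evV (u τ) x ⬝ᵥ M.nDl τ) • M.nDl τ))
    - M.intCells M.cellsB (fun τ x => divM (G τ) x ⬝ᵥ evV (u τ) x)

/-- `B_h(L, v)` -/
def formB (L : Fin M.N → Fin 2 → Fin 2 → Poly) (v : Fin M.N → Fin 2 → Poly) : ℝ :=
  - M.intPr M.prB0 (fun τ x => (evM (L τ) x).mulVec (M.nPr τ) ⬝ᵥ jumpPr (fun σ => evV (v σ) x) τ)
    - M.intDl M.cellsB (fun τ x => ((evM (L τ) x).mulVec (M.nDl τ) ⬝ᵥ M.tDl τ) *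
        jumpDl (fun σ => evV (v σ) x ⬝ᵥ M.tDl τ) τ)
    + M.intCells M.cellsB (fun τ x => frob (evM (L τ) x) (gradV (v τ) x))

/-- `b_h^*(p, v)` -/
def formbstar (p : Fin M.N → Poly) (v : Fin M.N → Fin 2 → Poly) : ℝ :=
  M.intPr M.prB (fun τ x => jumpPr (fun σ => evV (v σ) x ⬝ᵥ M.nPr τ) τ * ev (p τ) x)
    + M.intPr M.edgesΓ (fun τ x => (evV (v τ) x ⬝ᵥ M.nPr τ) * ev (p τ) x)
    - M.intCells M.cellsB (fun τ x => ev (p τ) x * dv (v τ) x)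

/-- `b_h(u, q)` -/
def formb (u : Fin M.N → Fin 2 → Poly) (q : Fin M.N → Poly) : ℝ :=
  - M.intDl M.cellsB (fun τ x => (evV (u τ) x ⬝ᵥ M.nDl τ) * jumpDl (fun σ => ev (q σ) x) τ)
    + M.intCells M.cellsB (fun τ x => evV (u τ) x ⬝ᵥ grad (q τ) x)

/-- `A_h(v, p)` -/
def formA (v : Fin M.N → Fin 2 → Poly) (p : Fin M.N → Poly) : ℝ :=
  M.intCells M.cellsD (fun τ x => ev (p τ) x * dv (v τ) x)

/-- `I_h(p, v)`, with `v` taken from the Darcy side and the normal outward from `Ω_D` -/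
def formI (p : Fin M.N → Poly) (v : Fin M.N → Fin 2 → Poly) : ℝ :=
  M.intPr M.edgesΓ (fun τ x => (evV (v (M.opp τ)) x ⬝ᵥ M.nPr (M.opp τ)) * ev (p τ) x)

/-! ### The bilinear forms of the transport scheme -/

/-- `T_h^*(c, ψ)` -/
def formTstar (c : Fin M.N → Poly) (ψ : Fin M.N → Fin 2 → Poly) : ℝ :=
  M.intCells Finset.univ (fun τ x => ev (c τ) x * dv (ψ τ) x)
    - M.intPr M.lead (fun τ x => ev (c τ) x * (jumpPr (fun σ => evV (ψ σ) x) τ ⬝ᵥ M.nPr τ))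

/-- `T_h(z, q)` -/
def formT (z : Fin M.N → Fin 2 → Poly) (q : Fin M.N → Poly) : ℝ :=
  - M.intCells Finset.univ (fun τ x => evV (z τ) x ⬝ᵥ grad (q τ) x)
    + M.intDl Finset.univ (fun τ x => (evV (z τ) x ⬝ᵥ M.nDl τ) * jumpDl (fun σ => ev (q σ) x) τ)

/-- `S_h(c, q)`, the upwind form for the discrete velocity `u` -/
def formS (u : Fin M.N → Fin 2 → Poly) (c q : Fin M.N → Poly) : ℝ :=
  M.intDl Finset.univ (fun τ x => avgDl (fun σ => ev (c σ) x) τ * jumpDl (fun σ => ev (q σ) x) τ *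
      (evV (u τ) x ⬝ᵥ M.nDl τ))
    + (1 / 2) * M.intDl Finset.univ (fun τ x => jumpDl (fun σ => ev (c σ) x) τ *
        jumpDl (fun σ => ev (q σ) x) τ * |evV (u τ) x ⬝ᵥ M.nDl τ|)

end StaggeredMesh

open StaggeredMesh

/-! ### The flow problem and its discretization -/

/-- The data of the Brinkman–Darcy flow problem. -/
structure FlowData (M : StaggeredMesh) (k : ℕ) where
  /-- effective viscosity -/
  ε : ℝ
  ε_pos : 0 < ε
  /-- viscosity divided by the (constant) permeability tensor of the Brinkman region -/
  α : Matrix (Fin 2) (Fin 2) ℝ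
  α_posDef : α.PosDef
  /-- hydraulic conductivity of the Darcy region -/
  KD : Pt → Matrix (Fin 2) (Fin 2) ℝ
  KD_meas : ∀ i j, Measurable fun x => KD x i j
  KD_spd : ∃ m m' : ℝ, 0 < m ∧ SPDOn KD M.ΩD m m'
  fB : Pt → Pt
  fB_memLp : MemLp fB 2 (volume.restrict M.ΩB)
  fD : Pt → Pt
  fD_memLp : MemLp fD 2 (volume.restrict M.ΩD)
  /-- the mass source, a piecewise polynomial of degree at most `k - 1` in `Ω_D`, zero in `Ω_B` -/
  f : Fin M.N → Poly
  f_mem : f ∈ M.QD k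
  f_brinkman : ∀ τ ∈ M.cellsB, f τ = 0
  /-- the prescribed normal velocity on `∂Ω`: `g₁` on `Γ_B` and `g₂` on `Γ_D` -/
  g : Pt → ℝ
  g_meas : Measurable g
  g_memLp : ∀ τ ∈ M.bdry, MemLp (fun r : ℝ => g (AffineMap.lineMap (M.fst τ) (M.snd τ) r)) 2
    (volume.restrict (Ioc 0 1))

namespace FlowData

variable {M : StaggeredMesh} {k : ℕ} (F : FlowData M k)

/-- `u ∈ L²(Ω)²` satisfies `∇ · u = 0` in `Ω_B`, `∇ · u = f` in `Ω_D`, has a continuous normal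
component across the interface and the normal component `u · n = g` on `∂Ω`, all expressed by Green's
formula.  The exact velocity of the Brinkman–Darcy problem is such a field. -/
def SatisfiesMassBalance (u : Pt → Pt) : Prop :=
  MemLp u 2 (volume.restrict M.Ω) ∧
  ∀ v : Pt → ℝ, ContDiff ℝ ((⊤ : ℕ∞) : WithTop ℕ∞) v →
    (∫ x in M.Ω, fderiv ℝ v x (u x)) + M.intCells M.cellsD (fun τ x => ev (F.f τ) x * v x) =
      M.intPr M.bdry (fun _ x => F.g x * v x)

/-- `(L, u, pB, pD)` solves the discrete Brinkman–Darcy problem; the restrictions of `u` to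
`Ω_B` and `Ω_D` are the two discrete velocities. -/
def IsDiscreteFlow (L : Fin M.N → Fin 2 → Fin 2 → Poly) (u : Fin M.N → Fin 2 → Poly)
    (pB pD : Fin M.N → Poly) : Prop :=
  L ∈ M.WB k ∧ u ∈ M.HB k ∧ pB ∈ M.QB0 k ∧ u ∈ M.HD k F.g ∧ pD ∈ M.QD k ∧
  (∀ G ∈ M.WB k, ∀ vD ∈ M.HD k 0,
    M.intCells M.cellsB (fun τ x => F.ε⁻¹ * frob (evM (L τ) x) (evM (G τ) x))
      - M.formBstar u G
      + M.intCells M.cellsD (fun τ x => (F.KD x)⁻¹.mulVec (evV (u τ) x) ⬝ᵥ evV (vD τ) x)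
      + M.formI pB vD - M.formA vD pD
      = M.intCells M.cellsD (fun τ x => F.fD x ⬝ᵥ evV (vD τ) x)) ∧
  (∀ vB ∈ M.HB k, ∀ qD ∈ M.QD k,
    M.formB L vB + M.intCells M.cellsB (fun τ x => F.α.mulVec (evV (u τ) x) ⬝ᵥ evV (vB τ) x)
      + M.formbstar pB vB + M.formA u qD
      = M.intCells M.cellsB (fun τ x => F.fB x ⬝ᵥ evV (vB τ) x)
        + M.intCells M.cellsD (fun τ x => ev (F.f τ) x * ev (qD τ) x)) ∧
  (∀ qB ∈ M.QB0 k,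
    - M.formI qB u - M.formb u qB = - M.intPr M.edgesΓB (fun τ x => F.g x * ev (qB τ) x))

/-- `f⁺` on the cell `τ` -/
def fplus (τ : Fin M.N) (x : Pt) : ℝ := max (ev (F.f τ) x) 0

/-- `f⁻` on the cell `τ` -/
def fminus (τ : Fin M.N) (x : Pt) : ℝ := max (-ev (F.f τ) x) 0

/-- The integral of `w` over `Γ_in = {x ∈ ∂Ω : u · n < 0}`; `u · n = g` on `∂Ω`. -/
def intIn (w : Fin M.N → Pt → ℝ) : ℝ :=
  M.intPr M.bdry (fun τ x => ({y | F.g y < 0}.indicator (w τ)) x)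

/-- The integral of `w` over `Γ_out = {x ∈ ∂Ω : u · n ≥ 0}`; `u · n = g` on `∂Ω`. -/
def intOut (w : Fin M.N → Pt → ℝ) : ℝ :=
  M.intPr M.bdry (fun τ x => ({y | 0 ≤ F.g y}.indicator (w τ)) x)

end FlowData

/-! ### The transport problem and its semi-discretization -/

/-- The data of the transport problem on `Ω × (0, T)`; functions of time and space take the time
first. -/
structure TransportData {M : StaggeredMesh} {k : ℕ} (F : FlowData M k) (T : ℝ) where
  /-- porosity -/
  φ : Pt → ℝ
  /-- lower bound of the porosity on `Ω` -/
  φlo : ℝ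
  /-- upper bound of the porosity on `Ω` -/
  φhi : ℝ
  φ_meas : Measurable φ
  φlo_pos : 0 < φlo
  φ_bounds : ∀ x ∈ M.Ω, φlo ≤ φ x ∧ φ x ≤ φhi
  /-- diffusion-dispersion tensor -/
  K : ℝ → Pt → Matrix (Fin 2) (Fin 2) ℝ
  /-- lower bound of the eigenvalues of `K` -/
  Kmin : ℝ
  /-- upper bound of the eigenvalues of `K` -/
  Kmax : ℝ
  K_meas : ∀ i j, Measurable fun y : ℝ × Pt => K y.1 y.2 i j
  Kmin_pos : 0 < Kmin
  K_spd : ∀ t ∈ Ioo 0 T, SPDOn (K t) M.Ω Kmin Kmax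
  /-- source term -/
  s : ℝ → Pt → ℝ
  s_meas : Measurable fun y : ℝ × Pt => s y.1 y.2
  s_sq : ∀ᵐ t ∂(volume.restrict (Ioc 0 T)), IntegrableOn (fun x => s t x ^ 2) M.Ω
  s_int : IntervalIntegrable (fun t => l2norm M.Ω fun x => Real.sqrt (φ x) * s t x) volume 0 T
  /-- inflow concentration -/
  cin : ℝ → Pt → ℝ
  cin_meas : Measurable fun y : ℝ × Pt => cin y.1 y.2
  cin_sq : ∀ᵐ t ∂(volume.restrict (Ioc 0 T)), ∀ τ ∈ M.bdry, IntervalIntegrable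
    (fun r : ℝ => ({y | F.g y < 0}.indicator fun y => |F.g y| * cin t y ^ 2)
      (AffineMap.lineMap (M.fst τ) (M.snd τ) r)) volume 0 1
  cin_int : IntervalIntegrable (fun t => F.intIn fun _ x => |F.g x| * cin t x ^ 2) volume 0 T
  /-- injected concentration -/
  chat : ℝ → Pt → ℝ
  chat_meas : Measurable fun y : ℝ × Pt => chat y.1 y.2
  chat_sq : ∀ᵐ t ∂(volume.restrict (Ioc 0 T)), ∀ τ ∈ M.cellsD,
    IntegrableOn (fun x => chat t x ^ 2 * F.fplus τ x) (M.cell τ)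
  chat_int : IntervalIntegrable
    (fun t => M.intCells M.cellsD fun τ x => chat t x ^ 2 * F.fplus τ x) volume 0 T
  /-- initial concentration -/
  c0 : Pt → ℝ
  c0_memLp : MemLp c0 2 (volume.restrict M.Ω)

namespace TransportData

variable {M : StaggeredMesh} {k : ℕ} {F : FlowData M k} {T : ℝ} (D : TransportData F T)

/-- The first equation of the semi-discrete scheme, at time `t`. -/
def FluxEquation (t : ℝ) (z : Fin M.N → Fin 2 → Poly) (c : Fin M.N → Poly) : Prop :=
  ∀ ψ ∈ M.W k,
    M.intCells Finset.univ (fun τ x => (D.K t x)⁻¹.mulVec (evV (z τ) x) ⬝ᵥ evV (ψ τ) x)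
      - M.formTstar c ψ = 0

/-- The second equation of the semi-discrete scheme, at time `t`, for the discrete velocity `u`;
`c'` is the value of the time derivative of the concentration. -/
def BalanceEquation (u : Fin M.N → Fin 2 → Poly) (t : ℝ) (z : Fin M.N → Fin 2 → Poly)
    (c c' : Fin M.N → Poly) : Prop :=
  ∀ q ∈ M.U k,
    M.intCells Finset.univ (fun τ x => D.φ x * ev (c' τ) x * ev (q τ) x)
      + M.intCells Finset.univ (fun τ x => ev (c τ) x * F.fminus τ x * ev (q τ) x)
      + M.formT z q
      - M.intCells Finset.univ (fun τ x => ev (c τ) x * (evV (u τ) x ⬝ᵥ grad (q τ) x))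
      + M.formS u c q
      + F.intOut (fun τ x => (evV (u τ) x ⬝ᵥ M.nPr τ) * ev (c τ) x * ev (q τ) x)
      + (1 / 2) * F.intOut
          (fun τ x => (F.g x - evV (u τ) x ⬝ᵥ M.nPr τ) * ev (c τ) x * ev (q τ) x)
      - (1 / 2) * F.intIn
          (fun τ x => (F.g x - evV (u τ) x ⬝ᵥ M.nPr τ) * ev (c τ) x * ev (q τ) x)
      = M.intCells Finset.univ (fun τ x => D.φ x * D.s t x * ev (q τ) x)
        - F.intIn (fun τ x => D.cin t x * F.g x * ev (q τ) x)
        + M.intCells Finset.univ (fun τ x => D.chat t x * F.fplus τ x * ev (q τ) x)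

/-- `(z, c)` solves the semi-discrete transport problem on `[0, T]` for the discrete velocity `u`:
`c` is absolutely continuous in time with values in `U_h` (coefficient by coefficient, with
derivative `c'`), both equations hold for almost every time, and `c(0)` is the
`L²(Ω)`-projection of `c⁰`. -/
def IsDiscreteTransport (u : Fin M.N → Fin 2 → Poly) (z : ℝ → Fin M.N → Fin 2 → Poly)
    (c : ℝ → Fin M.N → Poly) : Prop :=
  (∀ t ∈ Icc 0 T, c t ∈ M.U k) ∧
  (∀ q ∈ M.U k, M.intCells Finset.univ (fun τ x => (ev (c 0 τ) x - D.c0 x) * ev (q τ) x) = 0) ∧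
  ∃ c' : ℝ → Fin M.N → Poly,
    (∀ τ m, IntervalIntegrable (fun t => (c' t τ).coeff m) volume 0 T ∧
      ∀ t ∈ Icc 0 T, (c t τ).coeff m = (c 0 τ).coeff m + ∫ r in (0 : ℝ)..t, (c' r τ).coeff m) ∧
    ∀ᵐ t ∂(volume.restrict (Ioc 0 T)), c' t ∈ M.U k ∧ z t ∈ M.W k ∧
      D.FluxEquation t (z t) (c t) ∧ D.BalanceEquation u t (z t) (c t) (c' t)

/-- `‖K^{-1/2} z‖₀²` at time `t`. -/
def fluxNormSq (t : ℝ) (z : Fin M.N → Fin 2 → Poly) : ℝ :=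
  M.intCells Finset.univ (fun τ x => (D.K t x)⁻¹.mulVec (evV (z τ) x) ⬝ᵥ evV (z τ) x)

/-- The norm `‖(c, z)‖_c`. -/
def normC (c : ℝ → Fin M.N → Poly) (z : ℝ → Fin M.N → Fin 2 → Poly) : ℝ :=
  Real.sqrt (M.intCells Finset.univ (fun τ x => (Real.sqrt (D.φ x) * ev (c T τ) x) ^ 2)
    + 2 * ∫ t in (0 : ℝ)..T, D.fluxNormSq t (z t))

end TransportData

end

end BDT

namespace BDT

/-! ### Calculus for polynomials on triangles -/

/-! The discrete velocity inherits exact conservation: on every cell its divergence is `f`, and its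
normal component is continuous across every interior edge. Testing the transport scheme with the
solution then gives an exact energy balance whose extra terms are all nonnegative.

Conservation. In a Darcy cell `div u_h - f` has degree at most `k - 1`, so it is an admissible
pressure test function and must vanish (`IsDiscreteFlow.dv_eq_darcy`). In the Brinkman region the
third flow equation says that a residual functional vanishes on mean-zero pressures. The exact
velocity supplies the compatibility `∫ f = ∫ g`, which makes the residual vanish on constants too,
hence on all of `M.QB k` (`residual_eq_zero`). Testing with a barycentric coordinate times `div u_h`
on one cell removes the divergence; testing with the normal jump on the two cells at an edge removes
the jump.

Energy. The forms `T_h` and `T_h^*` are adjoint, so diffusion leaves exactly `‖K^{-1/2} z‖²`.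
Convection leaves `½ f c²`, half the upwind jumps and a boundary flux. Together with `f⁻ c²` and the
boundary corrections this is half the sum of `|f| c²`, `[c]² |u_h·n|` and `|g| c²`. Young's
inequality pays for inflow and injection with precisely these terms
(`TransportData.energy_inequality`).

Time. Let `N = ‖φ^{1/2} c‖²`, `Φ = ‖K^{-1/2} z‖²`, `σ = ‖φ^{1/2} s‖`, and let `a` collect the
initial and boundary data. Integration gives `N + 2∫Φ ≤ G := a + 2∫ σ√N`. Since `N ≤ G`, formally
`(√G)' ≤ σ`, so `√G(T) ≤ √a + ∫σ` (`sqrt_gronwall`). No regularity in time is assumed of `z`: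
measurability of `Φ` is read off the energy identity, and integrability follows from the bound. -/

@[simp] lemma ev_add (P Q : Poly) (x : Pt) : ev (P + Q) x = ev P x + ev Q x := by simp [ev]
@[simp] lemma ev_sub (P Q : Poly) (x : Pt) : ev (P - Q) x = ev P x - ev Q x := by simp [ev]
@[simp] lemma ev_mul (P Q : Poly) (x : Pt) : ev (P * Q) x = ev P x * ev Q x := by simp [ev]
@[simp] lemma ev_pow (P : Poly) (n : ℕ) (x : Pt) : ev (P ^ n) x = ev P x ^ n := by simp [ev]
@[simp] lemma ev_C (a : ℝ) (x : Pt) : ev (MvPolynomial.C a) x = a := by simp [ev]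
@[simp] lemma ev_X (i : Fin 2) (x : Pt) : ev (MvPolynomial.X i) x = x i := by simp [ev]
@[simp] lemma ev_zero (x : Pt) : ev 0 x = 0 := by simp [ev]
@[simp] lemma ev_one (x : Pt) : ev 1 x = 1 := by simp [ev]

@[fun_prop]
lemma continuous_ev (P : Poly) : Continuous (ev P) := MvPolynomial.continuous_eval P

@[fun_prop]
lemma continuous_evV (v : Fin 2 → Poly) : Continuous (evV v) :=
  continuous_pi fun i => continuous_ev (v i)

@[fun_prop]
lemma continuous_grad (P : Poly) : Continuous (grad P) := continuous_pi fun _ => continuous_ev _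

@[fun_prop]
lemma continuous_dv (v : Fin 2 → Poly) : Continuous (dv v) := by
  unfold dv; fun_prop

lemma hasDerivAt_ev_line (P : Poly) (x w : Pt) (t : ℝ) :
    HasDerivAt (fun t : ℝ => ev P (x + t • w)) (grad P (x + t • w) ⬝ᵥ w) t := by
  induction P using MvPolynomial.induction_on with
  | C a => simpa [grad, dotProduct] using hasDerivAt_const t a
  | add p q hp hq =>
    convert! hp.add hq using 1
    · funext s; simp
    · simp [grad, dotProduct, add_mul]; ring
  | mul_X p i hp =>
    have h2 : HasDerivAt (fun t : ℝ => x i + t * w i) (w i) t := by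
      simpa using ((hasDerivAt_id t).mul_const (w i)).const_add (x i)
    convert! hp.mul h2 using 1
    · funext s; simp
    · fin_cases i <;> simp [grad, dotProduct, Fin.sum_univ_two, MvPolynomial.pderiv_X, Pi.single_apply] <;> ring

/-- Twice the signed area of the triangle with vertices `p`, `q`, `r`. -/
noncomputable def area2 (p q r : Pt) : ℝ :=
  (q 0 - p 0) * (r 1 - p 1) - (q 1 - p 1) * (r 0 - p 0)

/-- The reference triangle. -/
def refTriangle : Set (ℝ × ℝ) := {z | 0 ≤ z.1 ∧ 0 ≤ z.2 ∧ z.1 + z.2 ≤ 1}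

/-- The affine parametrization of a triangle over the reference triangle. -/
def triMap (p q r : Pt) (z : ℝ × ℝ) : Pt := p + z.1 • (q - p) + z.2 • (r - p)

@[fun_prop]
lemma continuous_triMap (p q r : Pt) : Continuous (triMap p q r) := by
  unfold triMap; fun_prop

lemma convexHull_triangle (p q r : Pt) :
    convexHull ℝ (vertexSet p q r) = triMap p q r '' refTriangle := by
  unfold vertexSet
  ext x
  rw [convexHull_insert (by simp), convexHull_pair, mem_convexJoin]
  simp only [mem_singleton_iff, exists_eq_left, mem_image]
  constructor
  · rintro ⟨y, ⟨a, b, ha, hb, hab, rfl⟩, ⟨c, d, hc, hd, hcd, rfl⟩⟩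
    refine ⟨(d * a, d * b), ⟨by positivity, by positivity, ?_⟩, ?_⟩
    · simp only [← mul_add, hab]; linarith
    · simp only [triMap]
      ext i; simp
      have h1 : c = 1 - d := by linarith
      have h2 : a = 1 - b := by linarith
      subst h1 h2; ring
  · rintro ⟨⟨a, b⟩, ⟨ha, hb, hab⟩, rfl⟩
    simp only at ha hb hab
    -- At `a + b = 0` the point is the vertex `p`, and there is no point of the opposite side to be
    -- found by normalizing.
    by_cases h : a + b = 0
    · have ha' : a = 0 := by linarith
      have hb' : b = 0 := by linarith
      subst ha' hb'
      exact ⟨q, left_mem_segment _ _ _, by simpa [triMap] using left_mem_segment _ _ _⟩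
    · have h' : 0 < a + b := lt_of_le_of_ne (by positivity) (Ne.symm h)
      refine ⟨(a / (a + b)) • q + (b / (a + b)) • r,
        ⟨_, _, by positivity, by positivity, by field_simp, rfl⟩,
        1 - (a + b), a + b, by linarith, h'.le, by ring, ?_⟩
      ext i; simp [triMap]; field_simp; ring

lemma isCompact_refTriangle : IsCompact refTriangle := by
  refine IsCompact.of_isClosed_subset (isCompact_Icc (a := ((0 : ℝ), (0 : ℝ))) (b := (1, 1))) ?_ ?_
  · unfold refTriangle
    exact (isClosed_le continuous_const continuous_fst).inter
      ((isClosed_le continuous_const continuous_snd).inter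
        (isClosed_le (continuous_fst.add continuous_snd) continuous_const))
  · rintro ⟨a, b⟩ ⟨h1, h2, h3⟩
    simp only at h1 h2 h3
    exact ⟨⟨h1, h2⟩, ⟨by simp; linarith, by simp; linarith⟩⟩

lemma isCompact_convexHull_triangle (p q r : Pt) : IsCompact (convexHull ℝ (vertexSet p q r)) := by
  rw [convexHull_triangle]; exact isCompact_refTriangle.image (by fun_prop)

/-- Affine change of variables: the linear part has the edge vectors from `p` as columns, and its
determinant is `area2 p q r`. Injectivity suffices, so `F` is arbitrary. -/
lemma integral_triangle {p q r : Pt} (hD : 0 < area2 p q r) (F : Pt → ℝ) :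
    ∫ x in convexHull ℝ (vertexSet p q r), F x =
      area2 p q r * ∫ z in refTriangle, F (triMap p q r z) := by
  set e := MeasurableEquiv.finTwoArrow (α := ℝ) with he
  set A : Matrix (Fin 2) (Fin 2) ℝ := !![q 0 - p 0, r 0 - p 0; q 1 - p 1, r 1 - p 1] with hA
  set Lc : Pt →L[ℝ] Pt := LinearMap.toContinuousLinearMap (Matrix.toLin' A) with hL
  have hdet : Lc.det = area2 p q r := by
    simp only [hL, ContinuousLinearMap.det, LinearMap.coe_toContinuousLinearMap,
      LinearMap.det_toLin', hA, Matrix.det_fin_two_of, area2]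
    ring
  have hf : ∀ x : Pt, triMap p q r (e x) = p + Lc x := by
    intro x
    ext i
    fin_cases i <;>
      simp [triMap, hL, hA, he, Matrix.toLin'_apply, dotProduct,
        MeasurableEquiv.finTwoArrow, Fin.sum_univ_two] <;> ring
  have himg : convexHull ℝ (vertexSet p q r) = (fun x => p + Lc x) '' (e ⁻¹' refTriangle) := by
    rw [convexHull_triangle]
    ext x
    constructor
    · rintro ⟨z, hz, rfl⟩
      exact ⟨e.symm z, by simpa using hz, by simp [← hf]⟩
    · rintro ⟨y, hy, rfl⟩
      exact ⟨e y, hy, hf y⟩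
  have hinj : Function.Injective fun x => p + Lc x := by
    intro x y hxy
    have h1 : Lc x = Lc y := by simpa using hxy
    have h2 : Function.Injective (Matrix.toLin' A) := by
      rw [Matrix.toLin'_apply']
      apply Matrix.mulVec_injective_of_isUnit
      rw [Matrix.isUnit_iff_isUnit_det, isUnit_iff_ne_zero]
      have : A.det = area2 p q r := by
        simp only [hA, Matrix.det_fin_two_of, area2]; ring
      rw [this]; exact hD.ne'
    exact h2 h1
  have hm : MeasurableSet (e ⁻¹' refTriangle) :=
    e.measurable isCompact_refTriangle.isClosed.measurableSet
  rw [himg, integral_image_eq_integral_abs_det_fderiv_smul volume hm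
    (f' := fun _ => Lc) (fun x _ => (Lc.hasFDerivAt.const_add p).hasFDerivWithinAt) hinj.injOn F]
  simp only [hdet, abs_of_pos hD, smul_eq_mul, ← hf]
  rw [integral_const_mul]
  congr 1
  exact (volume_preserving_finTwoArrow ℝ).setIntegral_preimage_emb e.measurableEmbedding
    (fun z => F (triMap p q r z)) refTriangle

lemma integral_refTriangle {G : ℝ × ℝ → ℝ} (hG : Continuous G) :
    ∫ z in refTriangle, G z = ∫ y in (0 : ℝ)..1, ∫ x in (0 : ℝ)..(1 - y), G (x, y) := by
  have hm : MeasurableSet refTriangle := isCompact_refTriangle.isClosed.measurableSet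
  have hint : Integrable (refTriangle.indicator G) (volume.prod volume) := by
    rw [integrable_indicator_iff hm]
    exact hG.continuousOn.integrableOn_compact isCompact_refTriangle
  rw [← integral_indicator hm, Measure.volume_eq_prod, integral_prod_symm _ hint,
    intervalIntegral.integral_of_le zero_le_one, ← integral_Icc_eq_integral_Ioc,
    ← integral_indicator measurableSet_Icc]
  congr 1
  funext y
  by_cases hy : y ∈ Icc (0 : ℝ) 1
  · rw [indicator_of_mem hy, intervalIntegral.integral_of_le (by linarith [hy.2]),
      ← integral_Icc_eq_integral_Ioc, ← integral_indicator measurableSet_Icc]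
    congr 1
    funext x
    simp only [indicator, refTriangle, mem_ofPred_eq, mem_Icc]
    have := hy.1
    congr 1
    simp only [eq_iff_iff]
    constructor
    · rintro ⟨h1, h2, h3⟩; exact ⟨h1, by linarith⟩
    · rintro ⟨h1, h2⟩; exact ⟨h1, this, by linarith⟩
  · rw [indicator_of_notMem hy]
    refine integral_eq_zero_of_ae (Filter.Eventually.of_forall fun x => ?_)
    refine indicator_of_notMem (fun h => hy ?_) _
    obtain ⟨h1, h2, h3⟩ := h
    simp only at h1 h2 h3
    exact ⟨h2, by linarith⟩

lemma integral_refTriangle_swap (G : ℝ × ℝ → ℝ) :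
    ∫ z in refTriangle, G z = ∫ z in refTriangle, G z.swap := by
  have h := (Measure.measurePreserving_swap (μ := (volume : Measure ℝ)) (ν := (volume : Measure ℝ))).setIntegral_preimage_emb
    MeasurableEquiv.prodComm.measurableEmbedding G refTriangle
  have hs : (Prod.swap ⁻¹' refTriangle : Set (ℝ × ℝ)) = refTriangle := by
    ext ⟨a, b⟩; simp [refTriangle, add_comm]; tauto
  rw [hs] at h
  exact h.symm

/-- Fubini and the fundamental theorem of calculus on horizontal lines; the reflected version below
covers vertical lines. -/
lemma integral_refTriangle_deriv {G G' : ℝ × ℝ → ℝ} (hG' : Continuous G')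
    (h : ∀ x y, HasDerivAt (fun x => G (x, y)) (G' (x, y)) x) :
    ∫ z in refTriangle, G' z = ∫ y in (0 : ℝ)..1, (G (1 - y, y) - G (0, y)) := by
  rw [integral_refTriangle hG']
  congr 1
  funext y
  exact intervalIntegral.integral_eq_sub_of_hasDerivAt (fun x _ => h x y)
    (Continuous.intervalIntegrable (by fun_prop) _ _)

lemma integral_refTriangle_deriv' {G G' : ℝ × ℝ → ℝ} (hG' : Continuous G')
    (h : ∀ x y, HasDerivAt (fun y => G (x, y)) (G' (x, y)) y) :
    ∫ z in refTriangle, G' z = ∫ x in (0 : ℝ)..1, (G (x, 1 - x) - G (x, 0)) := by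
  rw [integral_refTriangle_swap]
  exact integral_refTriangle_deriv (G := fun z => G z.swap) (G' := fun z => G' z.swap)
    (by fun_prop) (fun x y => h y x)

lemma len_pos {p q : Pt} (h : p ≠ q) : 0 < len p q := by
  unfold len
  apply Real.sqrt_pos.2
  by_contra hcon
  apply h
  have h0 : (q 0 - p 0) ^ 2 = 0 := by nlinarith [sq_nonneg (q 0 - p 0), sq_nonneg (q 1 - p 1)]
  have h1 : (q 1 - p 1) ^ 2 = 0 := by nlinarith [sq_nonneg (q 0 - p 0), sq_nonneg (q 1 - p 1)]
  ext i
  fin_cases i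
  · exact (sub_eq_zero.1 (pow_eq_zero_iff two_ne_zero |>.1 h0)).symm
  · exact (sub_eq_zero.1 (pow_eq_zero_iff two_ne_zero |>.1 h1)).symm

/-- The arc length factor cancels the normalization of the normal, so the flux is free of square
roots. -/
lemma edgeInt_normal {p q : Pt} (h : p ≠ q) (V : Pt → Pt) :
    edgeInt p q (fun x => V x ⬝ᵥ normal p q) =
      ∫ t in (0 : ℝ)..1, (V (AffineMap.lineMap p q t) 0 * (q 1 - p 1)
        - V (AffineMap.lineMap p q t) 1 * (q 0 - p 0)) := by
  unfold edgeInt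
  rw [← intervalIntegral.integral_const_mul]
  congr 1
  funext t
  have := (len_pos h).ne'
  simp [normal, dotProduct, Fin.sum_univ_two]
  field_simp
  ring

/-- Green's formula for a polynomial vector field on a triangle. -/
lemma integral_dv_triangle {p q r : Pt} (hD : 0 < area2 p q r) (v : Fin 2 → Poly) :
    ∫ x in convexHull ℝ (vertexSet p q r), dv v x =
      edgeInt p q (fun x => evV v x ⬝ᵥ normal p q) + edgeInt q r (fun x => evV v x ⬝ᵥ normal q r)
        + edgeInt r p (fun x => evV v x ⬝ᵥ normal r p) := by
  have hpq : p ≠ q := by rintro rfl; simp [area2] at hD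
  have hqr : q ≠ r := by
    rintro rfl; unfold area2 at hD; nlinarith
  have hrp : r ≠ p := by rintro rfl; simp [area2] at hD
  rw [edgeInt_normal hpq, edgeInt_normal hqr, edgeInt_normal hrp, integral_triangle hD,
    ← integral_const_mul]
  -- `Gx` and `Gy` are the components of the Piola pullback of `v`: the sum of their partial
  -- derivatives on the reference triangle is `area2 p q r` times the divergence of `v`.
  set Gx : ℝ × ℝ → ℝ := fun z => (r 1 - p 1) * ev (v 0) (triMap p q r z)
    - (r 0 - p 0) * ev (v 1) (triMap p q r z) with hGx
  set Gy : ℝ × ℝ → ℝ := fun z => (q 0 - p 0) * ev (v 1) (triMap p q r z)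
    - (q 1 - p 1) * ev (v 0) (triMap p q r z) with hGy
  set Gx' : ℝ × ℝ → ℝ := fun z => (r 1 - p 1) * (grad (v 0) (triMap p q r z) ⬝ᵥ (q - p))
    - (r 0 - p 0) * (grad (v 1) (triMap p q r z) ⬝ᵥ (q - p)) with hGx'
  set Gy' : ℝ × ℝ → ℝ := fun z => (q 0 - p 0) * (grad (v 1) (triMap p q r z) ⬝ᵥ (r - p))
    - (q 1 - p 1) * (grad (v 0) (triMap p q r z) ⬝ᵥ (r - p)) with hGy'
  have cx : Continuous Gx' := by
    simp only [hGx', dotProduct]; fun_prop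
  have cy : Continuous Gy' := by
    simp only [hGy', dotProduct]; fun_prop
  have dx (P : Poly) (x y : ℝ) : HasDerivAt (fun x => ev P (triMap p q r (x, y)))
      (grad P (triMap p q r (x, y)) ⬝ᵥ (q - p)) x := by
    have := hasDerivAt_ev_line P (p + y • (r - p)) (q - p) x
    simpa only [triMap, add_right_comm] using this
  have dy (P : Poly) (x y : ℝ) : HasDerivAt (fun y => ev P (triMap p q r (x, y)))
      (grad P (triMap p q r (x, y)) ⬝ᵥ (r - p)) y :=
    hasDerivAt_ev_line P (p + x • (q - p)) (r - p) y
  have hx := integral_refTriangle_deriv (G := Gx) cx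
    (fun x y => ((dx (v 0) x y).const_mul _).sub ((dx (v 1) x y).const_mul _))
  have hy := integral_refTriangle_deriv' (G := Gy) cy
    (fun x y => ((dy (v 1) x y).const_mul _).sub ((dy (v 0) x y).const_mul _))
  have hsum : ∫ z in refTriangle, area2 p q r * dv v (triMap p q r z) =
      (∫ z in refTriangle, Gx' z) + ∫ z in refTriangle, Gy' z := by
    rw [← integral_add (cx.continuousOn.integrableOn_compact isCompact_refTriangle)
      (cy.continuousOn.integrableOn_compact isCompact_refTriangle)]
    congr 1
    funext z
    simp [hGx', hGy', dv, grad, dotProduct, Fin.sum_univ_two, area2]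
    ring
  -- The hypotenuse is the side `q r` and is reached by both one-dimensional integrations; some
  -- sides come out reversed, which `hr` below corrects.
  have e1 : ∀ t : ℝ, triMap p q r (1 - t, t) = AffineMap.lineMap q r t := by
    intro t; ext i; simp [triMap, AffineMap.lineMap_apply]; ring
  have e2 : ∀ t : ℝ, triMap p q r (0, t) = AffineMap.lineMap r p (1 - t) := by
    intro t; ext i; simp [triMap, AffineMap.lineMap_apply]; ring
  have e3 : ∀ t : ℝ, triMap p q r (t, 0) = AffineMap.lineMap p q t := by
    intro t; ext i; simp [triMap, AffineMap.lineMap_apply]; ring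
  have e4 : ∀ t : ℝ, triMap p q r (t, 1 - t) = AffineMap.lineMap q r (1 - t) := by
    intro t; ext i; simp [triMap, AffineMap.lineMap_apply]; ring
  rw [hsum, hx, hy]
  simp only [hGx, hGy, e1, e2, e3, e4]
  have hc (P : Poly) (a b : Pt) : Continuous fun t : ℝ => ev P (AffineMap.lineMap a b t) :=
    (continuous_ev P).comp AffineMap.lineMap_continuous
  have hc' (P : Poly) (a b : Pt) : Continuous fun t : ℝ => ev P (AffineMap.lineMap a b (1 - t)) :=
    (hc P a b).comp (by fun_prop)
  have hi (P : Poly) (a b : Pt) : IntervalIntegrable (fun t : ℝ => ev P (AffineMap.lineMap a b t))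
    volume 0 1 := (hc P a b).intervalIntegrable _ _
  have hi' (P : Poly) (a b : Pt) :
      IntervalIntegrable (fun t : ℝ => ev P (AffineMap.lineMap a b (1 - t))) volume 0 1 :=
    (hc' P a b).intervalIntegrable _ _
  have hr (P : Poly) (a b : Pt) : ∫ t in (0 : ℝ)..1, ev P (AffineMap.lineMap a b (1 - t)) =
      ∫ t in (0 : ℝ)..1, ev P (AffineMap.lineMap a b t) := by
    simpa using intervalIntegral.integral_comp_sub_left
      (fun t : ℝ => ev P (AffineMap.lineMap a b t)) (a := 0) (b := 1) 1
  have hev (i : Fin 2) (x : Pt) : evV v x i = ev (v i) x := rfl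
  simp only [hev]
  rw [intervalIntegral.integral_sub (((hi _ _ _).const_mul _).sub ((hi _ _ _).const_mul _))
      (((hi' _ _ _).const_mul _).sub ((hi' _ _ _).const_mul _)),
    intervalIntegral.integral_sub (((hi' _ _ _).const_mul _).sub ((hi' _ _ _).const_mul _))
      (((hi _ _ _).const_mul _).sub ((hi _ _ _).const_mul _)),
    intervalIntegral.integral_sub ((hi _ _ _).const_mul _) ((hi _ _ _).const_mul _),
    intervalIntegral.integral_sub ((hi' _ _ _).const_mul _) ((hi' _ _ _).const_mul _),
    intervalIntegral.integral_sub ((hi' _ _ _).const_mul _) ((hi' _ _ _).const_mul _),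
    intervalIntegral.integral_sub ((hi _ _ _).const_mul _) ((hi _ _ _).const_mul _),
    intervalIntegral.integral_sub ((hi _ _ _).mul_const _) ((hi _ _ _).mul_const _),
    intervalIntegral.integral_sub ((hi _ _ _).mul_const _) ((hi _ _ _).mul_const _),
    intervalIntegral.integral_sub ((hi _ _ _).mul_const _) ((hi _ _ _).mul_const _)]
  simp only [intervalIntegral.integral_const_mul, intervalIntegral.integral_mul_const, hr]
  ring


/-! ### Edge and cell integrals -/

/-- The loss of one degree is what puts the divergence of a `P^k` field into the Darcy pressure
space and leaves room for a linear factor in the Brinkman one. -/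
lemma totalDegree_pderiv_le (i : Fin 2) (P : Poly) :
    (MvPolynomial.pderiv i P).totalDegree ≤ P.totalDegree - 1 := by
  conv_lhs => rw [P.as_sum, map_sum]
  refine MvPolynomial.totalDegree_finsetSum_le fun m hm => ?_
  rw [MvPolynomial.pderiv_monomial]
  by_cases h0 : m i = 0
  · simp [h0]
  · refine (MvPolynomial.totalDegree_monomial_le _ _).trans ?_
    have h1 := MvPolynomial.le_totalDegree hm
    have h2 : m = (m - Finsupp.single i 1) + Finsupp.single i 1 := by
      ext j
      by_cases hj : j = i
      · subst hj; simp; omega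
      · simp [Ne.symm hj]
    have h3 : (m.sum fun _ e => e) = ((m - Finsupp.single i 1).sum fun _ e => e) + 1 := by
      conv_lhs => rw [h2]
      rw [Finsupp.sum_add_index' (by simp) (by simp)]
      simp
    change ((m - Finsupp.single i 1).sum fun _ e => e) ≤ _
    omega

/-- The divergence of a polynomial vector field, as a polynomial. -/
noncomputable def dvPoly (v : Fin 2 → Poly) : Poly := ∑ i, MvPolynomial.pderiv i (v i)

lemma ev_dvPoly (v : Fin 2 → Poly) (x : Pt) : ev (dvPoly v) x = dv v x := by
  simp [dvPoly, dv, Fin.sum_univ_two]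

lemma totalDegree_dvPoly_le {v : Fin 2 → Poly} {k : ℕ} (h : ∀ i, (v i).totalDegree ≤ k) :
    (dvPoly v).totalDegree ≤ k - 1 :=
  MvPolynomial.totalDegree_finsetSum_le fun i _ =>
    (totalDegree_pderiv_le i _).trans (Nat.sub_le_sub_right (h i) 1)

lemma dv_mul (q : Poly) (v : Fin 2 → Poly) (x : Pt) :
    dv (fun i => q * v i) x = ev q x * dv v x + evV v x ⬝ᵥ grad q x := by
  simp [dv, evV, grad, dotProduct, Fin.sum_univ_two, Derivation.leibniz]
  ring

lemma evV_mul_dotProduct (q : Poly) (v : Fin 2 → Poly) (x n : Pt) :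
    evV (fun i => q * v i) x ⬝ᵥ n = ev q x * (evV v x ⬝ᵥ n) := by
  simp [evV, dotProduct, Fin.sum_univ_two]; ring

lemma grad_sq (c : Poly) (x : Pt) (w : Pt) :
    w ⬝ᵥ grad (c ^ 2) x = 2 * (ev c x * (w ⬝ᵥ grad c x)) := by
  simp [grad, dotProduct, Fin.sum_univ_two, sq, Derivation.leibniz]
  ring

lemma len_symm (p q : Pt) : len p q = len q p := by
  unfold len; congr 1; ring

lemma len_nonneg (p q : Pt) : 0 ≤ len p q := Real.sqrt_nonneg _

lemma normal_symm (p q : Pt) : normal q p = -normal p q := by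
  ext i; fin_cases i <;> simp [normal, len_symm p q] <;> ring

lemma edgeInt_symm (p q : Pt) (F : Pt → ℝ) : edgeInt p q F = edgeInt q p F := by
  unfold edgeInt
  rw [len_symm]
  congr 1
  have := intervalIntegral.integral_comp_sub_left
      (fun t : ℝ => F (AffineMap.lineMap p q t)) (a := 0) (b := 1) 1
  simp only [sub_self, sub_zero, AffineMap.lineMap_apply_one_sub] at this
  exact this.symm

lemma lineMap_mem_segment (p q : Pt) {r : ℝ} (hr : r ∈ Icc (0 : ℝ) 1) :
    AffineMap.lineMap p q r ∈ segment ℝ p q := by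
  rw [segment_eq_image_lineMap]; exact mem_image_of_mem _ hr

lemma edgeInt_congr {p q : Pt} {F G : Pt → ℝ} (h : ∀ x ∈ segment ℝ p q, F x = G x) :
    edgeInt p q F = edgeInt p q G := by
  unfold edgeInt
  congr 1
  refine intervalIntegral.integral_congr fun r hr => ?_
  rw [uIcc_of_le zero_le_one] at hr
  exact h _ (lineMap_mem_segment p q hr)

/-- Integrability of `F` over the segment with end points `p`, `q`. -/
def EdgeIntegrable (p q : Pt) (F : Pt → ℝ) : Prop :=
  IntervalIntegrable (fun r : ℝ => F (AffineMap.lineMap p q r)) volume 0 1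

lemma continuous_lineMap (p q : Pt) : Continuous fun r : ℝ => (AffineMap.lineMap p q r : Pt) :=
  AffineMap.lineMap_continuous

lemma edgeIntegrable_of_continuous {F : Pt → ℝ} (hF : Continuous F) (p q : Pt) :
    EdgeIntegrable p q F := (hF.comp (continuous_lineMap p q)).intervalIntegrable _ _

lemma edgeInt_add {p q : Pt} {F G : Pt → ℝ} (hF : EdgeIntegrable p q F)
    (hG : EdgeIntegrable p q G) :
    edgeInt p q (fun x => F x + G x) = edgeInt p q F + edgeInt p q G := by
  unfold edgeInt; rw [← mul_add, ← intervalIntegral.integral_add hF hG]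

lemma edgeInt_sub {p q : Pt} {F G : Pt → ℝ} (hF : EdgeIntegrable p q F)
    (hG : EdgeIntegrable p q G) :
    edgeInt p q (fun x => F x - G x) = edgeInt p q F - edgeInt p q G := by
  unfold edgeInt; rw [← mul_sub, ← intervalIntegral.integral_sub hF hG]

lemma edgeInt_const_mul (p q : Pt) (a : ℝ) (F : Pt → ℝ) :
    edgeInt p q (fun x => a * F x) = a * edgeInt p q F := by
  unfold edgeInt; rw [intervalIntegral.integral_const_mul]; ring

lemma edgeInt_neg (p q : Pt) (F : Pt → ℝ) : edgeInt p q (fun x => - F x) = - edgeInt p q F := by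
  unfold edgeInt; rw [intervalIntegral.integral_neg]; ring

lemma edgeInt_zero (p q : Pt) : edgeInt p q (fun _ => 0) = 0 := by simp [edgeInt]

lemma edgeInt_nonneg {p q : Pt} {F : Pt → ℝ} (h : ∀ x, 0 ≤ F x) : 0 ≤ edgeInt p q F :=
  mul_nonneg (len_nonneg p q) (intervalIntegral.integral_nonneg zero_le_one fun _ _ => h _)

lemma edgeInt_mono {p q : Pt} {F G : Pt → ℝ} (hF : EdgeIntegrable p q F)
    (hG : EdgeIntegrable p q G) (h : ∀ x, F x ≤ G x) : edgeInt p q F ≤ edgeInt p q G :=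
  mul_le_mul_of_nonneg_left
    (intervalIntegral.integral_mono_on zero_le_one hF hG fun _ _ => h _) (len_nonneg p q)

lemma eq_zero_of_edgeInt_sq_eq_zero {p q : Pt} (hpq : p ≠ q) {F : Pt → ℝ} (hF : Continuous F)
    (h : edgeInt p q (fun x => F x ^ 2) = 0) : ∀ x ∈ segment ℝ p q, F x = 0 := by
  intro x hx
  rw [segment_eq_image_lineMap] at hx
  obtain ⟨r, hr, rfl⟩ := hx
  by_contra hne
  have hc : Continuous fun r : ℝ => F (AffineMap.lineMap p q r) ^ 2 :=
    (hF.comp (continuous_lineMap p q)).pow 2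
  have : 0 < ∫ r in (0 : ℝ)..1, F (AffineMap.lineMap p q r) ^ 2 :=
    intervalIntegral.integral_pos zero_lt_one hc.continuousOn (fun _ _ => by positivity)
      ⟨r, hr, by positivity⟩
  exact (mul_pos (len_pos hpq) this).ne' h

lemma integrableOn_triangle {F : Pt → ℝ} (hF : Continuous F) (p q r : Pt) :
    IntegrableOn F (convexHull ℝ (vertexSet p q r)) :=
  hF.continuousOn.integrableOn_compact (isCompact_convexHull_triangle p q r)

/-- A closed set with empty interior is its own frontier, and the frontier of a convex set is null;
but the triangle has area `area2 p q r / 2 > 0`. -/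
lemma interior_triangle_nonempty {p q r : Pt} (hD : 0 < area2 p q r) :
    (interior (convexHull ℝ (vertexSet p q r))).Nonempty := by
  by_contra hcon
  rw [not_nonempty_iff_eq_empty] at hcon
  have hc := isCompact_convexHull_triangle p q r
  have h0 : volume (convexHull ℝ (vertexSet p q r)) = 0 := by
    refine measure_mono_null ?_
      ((convex_convexHull ℝ (vertexSet p q r)).addHaar_frontier (volume : Measure Pt))
    rw [hc.isClosed.frontier_eq, hcon, sdiff_empty]
  have h1 := integral_triangle hD (fun _ => 1)
  rw [Measure.restrict_eq_zero.2 h0, integral_zero_measure,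
    integral_refTriangle continuous_const] at h1
  have h2 : ∫ y in (0 : ℝ)..1, ∫ _ in (0 : ℝ)..(1 - y), (1 : ℝ) = 1 / 2 := by
    simp only [intervalIntegral.integral_const, sub_zero, smul_eq_mul, mul_one]
    rw [intervalIntegral.integral_sub (by simp) (by simp), integral_id]
    norm_num
  rw [h2] at h1
  linarith

/-- A vanishing integral gives zero almost everywhere, continuity gives zero on the interior, and
the interior is dense in a convex set with nonempty interior. -/
lemma eq_zero_of_integral_triangle_eq_zero {p q r : Pt} (hD : 0 < area2 p q r) {F : Pt → ℝ}
    (hF : Continuous F) (hnn : ∀ x ∈ convexHull ℝ (vertexSet p q r), 0 ≤ F x)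
    (h : ∫ x in convexHull ℝ (vertexSet p q r), F x = 0) :
    ∀ x ∈ convexHull ℝ (vertexSet p q r), F x = 0 := by
  set S := convexHull ℝ (vertexSet p q r) with hS
  have hcomp : IsCompact S := isCompact_convexHull_triangle p q r
  have hae : F =ᵐ[volume.restrict S] 0 := by
    rw [setIntegral_eq_zero_iff_of_nonneg_ae] at h
    · exact h
    · exact ae_restrict_of_forall_mem hcomp.isClosed.measurableSet hnn
    · exact integrableOn_triangle hF p q r
  have hae' : F =ᵐ[volume.restrict (interior S)] 0 :=
    ae_restrict_of_ae_restrict_of_subset interior_subset hae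
  have hint : EqOn F 0 (interior S) :=
    Measure.eqOn_open_of_ae_eq hae' isOpen_interior hF.continuousOn continuousOn_const
  have hcl : closure (interior S) = S := by
    rw [(convex_convexHull ℝ (vertexSet p q r)).closure_interior_eq_closure_of_nonempty_interior
      (interior_triangle_nonempty hD), hcomp.isClosed.closure_eq]
  have hcl' := hint.closure hF continuous_const
  rw [hcl] at hcl'
  exact hcl'

/-- Up to the factor `area2 p q r`, the function `area2 q r` is the barycentric coordinate of the
vertex `p`. -/
lemma area2_nonneg_of_mem {p q r x : Pt} (hD : 0 < area2 p q r)
    (hx : x ∈ convexHull ℝ (vertexSet p q r)) : 0 ≤ area2 q r x := by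
  rw [convexHull_triangle] at hx
  obtain ⟨⟨s, t⟩, ⟨h1, h2, h3⟩, rfl⟩ := hx
  simp only at h1 h2 h3
  have : area2 q r (triMap p q r (s, t)) = (1 - s - t) * area2 p q r := by
    simp [area2, triMap]; ring
  rw [this]
  exact mul_nonneg (by linarith) hD.le

/-- A continuous function whose square, weighted by the barycentric coordinate of a vertex, has
integral zero vanishes on the triangle. -/
lemma eq_zero_of_integral_area2_mul_sq {p q r : Pt} (hD : 0 < area2 p q r) {F : Pt → ℝ}
    (hF : Continuous F)
    (h : ∫ x in convexHull ℝ (vertexSet p q r), area2 q r x * F x ^ 2 = 0) :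
    ∀ x ∈ convexHull ℝ (vertexSet p q r), F x = 0 := by
  have hc : Continuous fun x => area2 q r x * F x ^ 2 := by unfold area2; fun_prop
  have h0 := eq_zero_of_integral_triangle_eq_zero hD hc
    (fun x hx => mul_nonneg (area2_nonneg_of_mem hD hx) (sq_nonneg _)) h
  intro x hx
  have hp : p ∈ convexHull ℝ (vertexSet p q r) := subset_convexHull ℝ _ (by simp [vertexSet])
  have hcl : IsClosed {θ : ℝ | F (AffineMap.lineMap p x θ) = 0} :=
    isClosed_eq (hF.comp (continuous_lineMap p x)) continuous_const
  -- The weight vanishes on the side `q r`, so such points are approached along the segment from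
  -- `p`, where the weight is positive for `θ < 1`.
  have hsub : Ico (0 : ℝ) 1 ⊆ {θ : ℝ | F (AffineMap.lineMap p x θ) = 0} := by
    intro θ hθ
    have hm : AffineMap.lineMap p x θ ∈ convexHull ℝ (vertexSet p q r) :=
      (convex_convexHull ℝ _).segment_subset hp hx (lineMap_mem_segment p x ⟨hθ.1, hθ.2.le⟩)
    have hpos : 0 < area2 q r (AffineMap.lineMap p x θ) := by
      have e : area2 q r (AffineMap.lineMap p x θ) =
          (1 - θ) * area2 p q r + θ * area2 q r x := by
        simp [area2, AffineMap.lineMap_apply]; ring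
      rw [e]
      exact add_pos_of_pos_of_nonneg (mul_pos (by linarith [hθ.2]) hD)
        (mul_nonneg hθ.1 (area2_nonneg_of_mem hD hx))
    have := h0 _ hm
    rcases mul_eq_zero.1 this with h' | h'
    · exact absurd h' hpos.ne'
    · exact pow_eq_zero_iff two_ne_zero |>.1 h'
  have h1 : (1 : ℝ) ∈ closure (Ico (0 : ℝ) 1) := by
    rw [closure_Ico zero_ne_one]; simp
  have := hcl.closure_subset_iff.2 hsub h1
  simpa using this

/-- The polynomial `area2 p q ·`. -/
noncomputable def area2Poly (p q : Pt) : Poly :=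
  MvPolynomial.C (q 0 - p 0) * (MvPolynomial.X 1 - MvPolynomial.C (p 1))
    - MvPolynomial.C (q 1 - p 1) * (MvPolynomial.X 0 - MvPolynomial.C (p 0))

lemma ev_area2Poly (p q x : Pt) : ev (area2Poly p q) x = area2 p q x := by
  simp [area2Poly, area2]

lemma totalDegree_area2Poly_le (p q : Pt) : (area2Poly p q).totalDegree ≤ 1 := by
  have h (a b : ℝ) (i : Fin 2) : (MvPolynomial.C a * (MvPolynomial.X i - MvPolynomial.C b) :
      Poly).totalDegree ≤ 1 := by
    refine (MvPolynomial.totalDegree_mul _ _).trans ?_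
    rw [MvPolynomial.totalDegree_C, zero_add]
    refine (MvPolynomial.totalDegree_sub _ _).trans ?_
    simp [MvPolynomial.totalDegree_X]
  exact (MvPolynomial.totalDegree_sub _ _).trans (max_le (h _ _ _) (h _ _ _))

lemma area2_eq_zero_of_mem_segment {p q x : Pt} (hx : x ∈ segment ℝ p q) : area2 p q x = 0 := by
  rw [segment_eq_image_lineMap] at hx
  obtain ⟨r, -, rfl⟩ := hx
  simp [area2, AffineMap.lineMap_apply]; ring

/-! ### Integration by parts on the mesh -/

namespace StaggeredMesh

variable (M : StaggeredMesh)

lemma area2_pos (τ : Fin M.N) : 0 < area2 (M.apex τ) (M.fst τ) (M.snd τ) := M.orient τ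

lemma fst_ne_snd (τ : Fin M.N) : M.fst τ ≠ M.snd τ := by
  intro h
  have := M.area2_pos τ
  rw [h] at this
  unfold area2 at this
  nlinarith

lemma isCompact_cell (τ : Fin M.N) : IsCompact (M.cell τ) := isCompact_convexHull_triangle _ _ _

lemma measurableSet_cell (τ : Fin M.N) : MeasurableSet (M.cell τ) :=
  (M.isCompact_cell τ).isClosed.measurableSet

lemma integrableOn_cell {F : Pt → ℝ} (hF : Continuous F) (τ : Fin M.N) :
    IntegrableOn F (M.cell τ) := integrableOn_triangle hF _ _ _

lemma mem_cellsB {τ : Fin M.N} : τ ∈ M.cellsB ↔ M.brinkman τ = true := by simp [cellsB]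

lemma mem_cellsD {τ : Fin M.N} : τ ∈ M.cellsD ↔ M.brinkman τ = false := by simp [cellsD]

lemma segPr_opp {τ : Fin M.N} (h : M.opp τ ≠ τ) : M.segPr (M.opp τ) = M.segPr τ := by
  unfold segPr; rw [M.fst_opp τ h, M.snd_opp τ h, segment_symm]

lemma nPr_opp {τ : Fin M.N} (h : M.opp τ ≠ τ) : M.nPr (M.opp τ) = -M.nPr τ := by
  unfold nPr; rw [M.fst_opp τ h, M.snd_opp τ h, normal_symm]

lemma opp_opp_ne {τ : Fin M.N} (h : M.opp τ ≠ τ) : M.opp (M.opp τ) ≠ M.opp τ := by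
  rw [M.opp_opp]; exact h.symm

lemma edgeInt_opp {τ : Fin M.N} (h : M.opp τ ≠ τ) (G : Pt → ℝ) :
    edgeInt (M.fst (M.opp τ)) (M.snd (M.opp τ)) G = edgeInt (M.fst τ) (M.snd τ) G := by
  rw [M.fst_opp τ h, M.snd_opp τ h, edgeInt_symm]

lemma sum_next {S : Finset (Fin M.N)} (hS : ∀ τ, M.next τ ∈ S ↔ τ ∈ S) (G : Fin M.N → ℝ) :
    ∑ τ ∈ S, G (M.next τ) = ∑ τ ∈ S, G τ :=
  Finset.sum_equiv M.next (fun τ => (hS τ).symm) (fun _ _ => rfl)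

lemma next_mem_cellsB (τ : Fin M.N) : M.next τ ∈ M.cellsB ↔ τ ∈ M.cellsB := by
  simp [mem_cellsB, M.brinkman_next]

lemma next_mem_cellsD (τ : Fin M.N) : M.next τ ∈ M.cellsD ↔ τ ∈ M.cellsD := by
  simp [mem_cellsD, M.brinkman_next]

variable {M}

/-- The divergence theorem for piecewise polynomial fields on a union of elements. -/
lemma intCells_dv {S : Finset (Fin M.N)} (hS : ∀ τ, M.next τ ∈ S ↔ τ ∈ S)
    (v : Fin M.N → Fin 2 → Poly) :
    M.intCells S (fun τ x => dv (v τ) x) =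
      M.intPr S (fun τ x => evV (v τ) x ⬝ᵥ M.nPr τ)
        + M.intDl S (fun τ x => jumpDl (fun σ => evV (v σ) x ⬝ᵥ M.nDl τ) τ) := by
  have h1 : ∀ τ, ∫ x in M.cell τ, dv (v τ) x =
      edgeInt (M.fst τ) (M.snd τ) (fun x => evV (v τ) x ⬝ᵥ M.nPr τ)
      + edgeInt (M.snd τ) (M.apex τ) (fun x => evV (v τ) x ⬝ᵥ M.nDl τ)
      + edgeInt (M.apex τ) (M.fst τ)
          (fun x => evV (v τ) x ⬝ᵥ normal (M.apex τ) (M.fst τ)) := by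
    intro τ
    rw [cell, integral_dv_triangle (M.area2_pos τ), nPr, nDl]
    ring
  unfold intCells intPr intDl
  simp only [h1]
  -- The third side of `next τ` is the dual edge of `τ` run backwards. Reindexing these sides by the
  -- permutation `next` pairs the two fluxes through each dual edge into a jump.
  rw [Finset.sum_add_distrib, Finset.sum_add_distrib, add_assoc,
    ← M.sum_next hS (fun τ => edgeInt (M.apex τ) (M.fst τ) _), ← Finset.sum_add_distrib]
  congr 1
  refine Finset.sum_congr rfl fun τ _ => ?_
  rw [M.apex_next, M.fst_next, edgeInt_symm (M.apex τ), normal_symm, ← nDl]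
  rw [← edgeInt_add (edgeIntegrable_of_continuous (by fun_prop) _ _)
    (edgeIntegrable_of_continuous (by fun_prop) _ _)]
  refine edgeInt_congr fun x _ => ?_
  simp [jumpDl, sub_eq_add_neg]

lemma intCells_add {S : Finset (Fin M.N)} {F G : Fin M.N → Pt → ℝ}
    (hF : ∀ τ ∈ S, IntegrableOn (F τ) (M.cell τ)) (hG : ∀ τ ∈ S, IntegrableOn (G τ) (M.cell τ)) :
    M.intCells S (fun τ x => F τ x + G τ x) = M.intCells S F + M.intCells S G := by
  unfold intCells
  rw [← Finset.sum_add_distrib]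
  exact Finset.sum_congr rfl fun τ h => integral_add (hF τ h) (hG τ h)

lemma intCells_sub {S : Finset (Fin M.N)} {F G : Fin M.N → Pt → ℝ}
    (hF : ∀ τ ∈ S, IntegrableOn (F τ) (M.cell τ)) (hG : ∀ τ ∈ S, IntegrableOn (G τ) (M.cell τ)) :
    M.intCells S (fun τ x => F τ x - G τ x) = M.intCells S F - M.intCells S G := by
  unfold intCells
  rw [← Finset.sum_sub_distrib]
  exact Finset.sum_congr rfl fun τ h => integral_sub (hF τ h) (hG τ h)

lemma intCells_const_mul (S : Finset (Fin M.N)) (a : ℝ) (F : Fin M.N → Pt → ℝ) :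
    M.intCells S (fun τ x => a * F τ x) = a * M.intCells S F := by
  unfold intCells
  rw [Finset.mul_sum]
  exact Finset.sum_congr rfl fun τ _ => integral_const_mul _ _

lemma intCells_congr {S : Finset (Fin M.N)} {F G : Fin M.N → Pt → ℝ}
    (h : ∀ τ ∈ S, ∀ x ∈ M.cell τ, F τ x = G τ x) : M.intCells S F = M.intCells S G :=
  Finset.sum_congr rfl fun τ hτ => setIntegral_congr_fun (M.measurableSet_cell τ) (h τ hτ)

lemma intPr_congr {S : Finset (Fin M.N)} {F G : Fin M.N → Pt → ℝ}
    (h : ∀ τ ∈ S, ∀ x ∈ M.segPr τ, F τ x = G τ x) : M.intPr S F = M.intPr S G :=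
  Finset.sum_congr rfl fun τ hτ => edgeInt_congr (h τ hτ)

lemma intDl_congr {S : Finset (Fin M.N)} {F G : Fin M.N → Pt → ℝ}
    (h : ∀ τ ∈ S, ∀ x ∈ M.segDl τ, F τ x = G τ x) : M.intDl S F = M.intDl S G :=
  Finset.sum_congr rfl fun τ hτ => edgeInt_congr (h τ hτ)

/-- Integration by parts against a field with continuous normal component on the dual edges. -/
lemma intCells_mul_dv {S : Finset (Fin M.N)} (hS : ∀ τ, M.next τ ∈ S ↔ τ ∈ S)
    {v : Fin M.N → Fin 2 → Poly}
    (hv : ∀ τ ∈ S, ∀ x ∈ M.segDl τ, jumpDl (fun σ => evV (v σ) x ⬝ᵥ M.nDl τ) τ = 0)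
    (q : Fin M.N → Poly) :
    M.intCells S (fun τ x => ev (q τ) x * dv (v τ) x)
        + M.intCells S (fun τ x => evV (v τ) x ⬝ᵥ grad (q τ) x) =
      M.intPr S (fun τ x => ev (q τ) x * (evV (v τ) x ⬝ᵥ M.nPr τ))
        + M.intDl S (fun τ x => (evV (v τ) x ⬝ᵥ M.nDl τ) * jumpDl (fun σ => ev (q σ) x) τ) := by
  rw [← intCells_add (fun τ _ => M.integrableOn_cell (by fun_prop) τ)
    (fun τ _ => M.integrableOn_cell (by simp only [dotProduct]; fun_prop) τ)]
  have h := intCells_dv hS (fun τ i => q τ * v τ i)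
  simp only [dv_mul, evV_mul_dotProduct] at h
  rw [h]
  congr 1
  refine intDl_congr fun τ hτ x hx => ?_
  have := hv τ hτ x hx
  simp only [jumpDl] at this ⊢
  -- Since `v·n` is continuous, `[q v·n] = (v·n)[q]`; the discrepancy is the neighbouring value of
  -- `q` times the vanishing normal jump.
  linear_combination ev (q (M.next τ)) x * this

/-- Regrouping a sum over all cells as a sum over the primal edges. -/
lemma sum_univ_eq_sum_lead (h : Fin M.N → ℝ) :
    ∑ τ, h τ = ∑ τ ∈ M.lead, if M.opp τ = τ then h τ else h τ + h (M.opp τ) := by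
  classical
  have h1 : ∑ τ ∈ M.lead, (if M.opp τ = τ then h τ else h τ + h (M.opp τ)) =
      ∑ τ ∈ M.lead, h τ + ∑ τ ∈ M.lead.filter (fun τ => M.opp τ ≠ τ), h (M.opp τ) := by
    rw [Finset.sum_filter, ← Finset.sum_add_distrib]
    refine Finset.sum_congr rfl fun τ _ => ?_
    by_cases ho : M.opp τ = τ <;> simp [ho]
  rw [h1, ← Finset.sum_add_sum_compl M.lead]
  congr 1
  -- The cells outside `lead` are exactly the opposites of the cells in `lead` at interior edges.
  refine Finset.sum_nbij' M.opp M.opp ?_ ?_ (fun _ _ => M.opp_opp _) (fun _ _ => M.opp_opp _) ?_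
  · intro τ hτ
    rw [Finset.mem_compl] at hτ
    have hne : M.opp τ ≠ τ := fun hcon => hτ (M.lead_bdry τ hcon)
    simp only [Finset.mem_filter]
    refine ⟨?_, M.opp_opp_ne hne⟩
    by_contra hcon
    exact hτ ((M.lead_inner τ hne).2 hcon)
  · intro τ hτ
    rw [Finset.mem_filter] at hτ
    rw [Finset.mem_compl]
    exact (M.lead_inner τ hτ.2).1 hτ.1
  · intro τ _; rw [M.opp_opp]

/-- A quantity that is antisymmetric across the interior edges sums to its boundary part. -/
lemma sum_eq_sum_bdry {h : Fin M.N → ℝ} (hh : ∀ τ, M.opp τ ≠ τ → h τ + h (M.opp τ) = 0) :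
    ∑ τ, h τ = ∑ τ ∈ M.bdry, h τ := by
  rw [bdry, ← Finset.sum_filter_add_sum_filter_not Finset.univ (fun τ => M.opp τ = τ),
    add_eq_left]
  refine Finset.sum_involution (fun τ _ => M.opp τ) ?_ ?_ ?_ ?_
  · intro τ hτ; exact hh τ (by simpa using hτ)
  · intro τ hτ _; simpa using hτ
  · intro τ hτ
    simp only [Finset.mem_filter, Finset.mem_univ, true_and] at hτ ⊢
    exact M.opp_opp_ne hτ
  · intro τ _; exact M.opp_opp τ

end StaggeredMesh

lemma evV_zero (x : Pt) : evV (fun _ => 0) x = 0 := by ext i; simp [evV]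

namespace StaggeredMesh

variable {M : StaggeredMesh}

/-! ### Local mass conservation of the discrete flow -/

@[fun_prop]
lemma continuous_evV_dotProduct (v : Fin 2 → Poly) (n : Pt) :
    Continuous fun x => evV v x ⬝ᵥ n := by simp only [dotProduct]; fun_prop

lemma jumpDl_eq_zero_of_mem_HB {k : ℕ} {u : Fin M.N → Fin 2 → Poly} (hu : u ∈ M.HB k) :
    ∀ τ ∈ M.cellsB, ∀ x ∈ M.segDl τ, jumpDl (fun σ => evV (u σ) x ⬝ᵥ M.nDl τ) τ = 0 := hu.2

lemma jumpDl_eq_zero_of_mem_HD {k : ℕ} {g : Pt → ℝ} {u : Fin M.N → Fin 2 → Poly}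
    (hu : u ∈ M.HD k g) :
    ∀ τ ∈ M.cellsD, ∀ x ∈ M.segDl τ, jumpDl (fun σ => evV (u σ) x ⬝ᵥ M.nDl τ) τ = 0 := hu.2.1

/-- The normal components from the two sides of a primal edge, both taken outward, add up to
zero inside the Darcy region. -/
lemma normal_add_normal_of_mem_HD {k : ℕ} {g : Pt → ℝ} {u : Fin M.N → Fin 2 → Poly}
    (hu : u ∈ M.HD k g) {τ : Fin M.N} (h1 : M.brinkman τ = false)
    (h2 : M.brinkman (M.opp τ) = false) (hne : M.opp τ ≠ τ) {x : Pt} (hx : x ∈ M.segPr τ) :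
    evV (u τ) x ⬝ᵥ M.nPr τ + evV (u (M.opp τ)) x ⬝ᵥ M.nPr (M.opp τ) = 0 := by
  have key : ∀ σ, M.brinkman σ = false → M.brinkman (M.opp σ) = false → M.opp σ ≠ σ →
      σ ∈ M.lead → ∀ x ∈ M.segPr σ,
      evV (u σ) x ⬝ᵥ M.nPr σ + evV (u (M.opp σ)) x ⬝ᵥ M.nPr (M.opp σ) = 0 := by
    intro σ h1 h2 hne hl x hx
    have := hu.2.2.1 σ (by simp [prD0, hl, h1, h2, hne]) x hx
    rw [jumpPr, if_neg hne] at this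
    rw [M.nPr_opp hne, dotProduct_neg, ← sub_eq_add_neg, this]
  -- The space imposes continuity once per edge, from its leading cell; seen from the other cell it
  -- is the same relation.
  by_cases hl : τ ∈ M.lead
  · exact key τ h1 h2 hne hl x hx
  · have hl' : M.opp τ ∈ M.lead := by
      by_contra hcon; exact hl ((M.lead_inner τ hne).2 hcon)
    have := key (M.opp τ) h2 (by rwa [M.opp_opp]) (M.opp_opp_ne hne) hl' x
      (by rwa [M.segPr_opp hne])
    rw [M.opp_opp] at this
    rw [add_comm]; exact this

end StaggeredMesh

namespace FlowData

open StaggeredMesh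

variable {M : StaggeredMesh} {k : ℕ} {F : FlowData M k}

lemma edgeIntegrable_g_mul {τ : Fin M.N} (hτ : τ ∈ M.bdry) {G : Pt → ℝ} (hG : Continuous G) :
    EdgeIntegrable (M.fst τ) (M.snd τ) (fun x => F.g x * G x) := by
  have h := (F.g_memLp τ hτ).integrable one_le_two
  have h' : IntervalIntegrable (fun r : ℝ => F.g (AffineMap.lineMap (M.fst τ) (M.snd τ) r))
      volume 0 1 := (intervalIntegrable_iff_integrableOn_Ioc_of_le zero_le_one).2 h
  exact h'.mul_continuousOn (hG.comp (continuous_lineMap _ _)).continuousOn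

lemma edgeIntegrable_g {τ : Fin M.N} (hτ : τ ∈ M.bdry) :
    EdgeIntegrable (M.fst τ) (M.snd τ) F.g := by
  simpa using edgeIntegrable_g_mul (F := F) hτ (continuous_const (y := (1 : ℝ)))

/-- The discrete velocity has divergence `f` in the Darcy region. -/
lemma IsDiscreteFlow.dv_eq_darcy {L : Fin M.N → Fin 2 → Fin 2 → Poly}
    {u : Fin M.N → Fin 2 → Poly} {pB pD : Fin M.N → Poly} (h : F.IsDiscreteFlow L u pB pD)
    {τ : Fin M.N} (hτ : τ ∈ M.cellsD) {x : Pt} (hx : x ∈ M.cell τ) :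
    dv (u τ) x = ev (F.f τ) x := by
  obtain ⟨-, -, -, huD, -, -, h2, -⟩ := h
  -- Both terms have degree at most `k - 1` on Darcy cells. With Brinkman test function zero, the
  -- second flow equation becomes a sum of integrals of squares equal to zero.
  set q : Fin M.N → Poly := fun σ => dvPoly (u σ) - F.f σ with hq
  have hqD : q ∈ M.QD k := fun σ hσ =>
    (MvPolynomial.totalDegree_sub _ _).trans
      (max_le (totalDegree_dvPoly_le (huD.1 σ hσ)) (F.f_mem σ hσ))
  have h0 : (fun _ _ => 0 : Fin M.N → Fin 2 → Poly) ∈ M.HB k := by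
    refine ⟨fun _ _ _ => by simp, fun _ _ _ _ => ?_⟩
    simp [jumpDl, evV, dotProduct]
  have h3 := h2 _ h0 q hqD
  have e1 : M.formB L (fun _ _ => 0) = 0 := by
    simp [formB, intPr, intDl, intCells, jumpPr, jumpDl, evV_zero, dotProduct, gradV, frob, edgeInt_zero]
  have e2 : M.formbstar pB (fun _ _ => 0) = 0 := by
    simp [formbstar, intPr, intCells, jumpPr, evV, dotProduct, dv, edgeInt_zero]
  have e3 (A : Fin M.N → Pt → Pt) :
      M.intCells M.cellsB (fun τ x => A τ x ⬝ᵥ evV (fun _ => (0 : Poly)) x) = 0 := by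
    simp [intCells, evV, dotProduct]
  rw [e1, e2, e3, e3 (fun τ x => F.fB x), formA] at h3
  simp only [zero_add] at h3
  rw [← sub_eq_zero, ← intCells_sub (fun σ _ => M.integrableOn_cell (by fun_prop) σ)
    (fun σ _ => M.integrableOn_cell (by fun_prop) σ)] at h3
  have h4 : ∑ σ ∈ M.cellsD, ∫ x in M.cell σ, (dv (u σ) x - ev (F.f σ) x) ^ 2 = 0 := by
    rw [← h3]
    refine intCells_congr fun σ _ x _ => ?_
    simp only [hq, ev_sub, ev_dvPoly]; ring
  rw [Finset.sum_eq_zero_iff_of_nonneg fun σ _ => integral_nonneg fun _ => sq_nonneg _] at h4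
  have h5 := eq_zero_of_integral_triangle_eq_zero (M.area2_pos τ)
    (F := fun x => (dv (u τ) x - ev (F.f τ) x) ^ 2) (by fun_prop) (fun _ _ => sq_nonneg _)
    (h4 τ hτ) x hx
  exact sub_eq_zero.1 (pow_eq_zero_iff two_ne_zero |>.1 h5)

/-- The weak residual of mass conservation in the Brinkman region. -/
noncomputable def residual (F : FlowData M k) (u : Fin M.N → Fin 2 → Poly) (q : Fin M.N → Poly) :
    ℝ :=
  M.intCells M.cellsB (fun τ x => ev (q τ) x * dv (u τ) x)
    - M.intPr M.cellsB (fun τ x => ev (q τ) x * (evV (u τ) x ⬝ᵥ M.nPr τ))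
    - M.formI q u + M.intPr M.edgesΓB (fun τ x => F.g x * ev (q τ) x)

/-- Integration by parts identifies the residual with the defect of the third flow equation, which
vanishes for mean-zero `q`. -/
lemma residual_eq {u : Fin M.N → Fin 2 → Poly} (hu : u ∈ M.HB k) (q : Fin M.N → Poly) :
    F.residual u q = - M.formI q u - M.formb u q
      + M.intPr M.edgesΓB (fun τ x => F.g x * ev (q τ) x) := by
  have h := intCells_mul_dv M.next_mem_cellsB (jumpDl_eq_zero_of_mem_HB hu) q
  unfold residual formb
  linarith

lemma edgesΓB_subset_bdry : M.edgesΓB ⊆ M.bdry := by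
  intro τ hτ
  simp only [edgesΓB, bdry, Finset.mem_filter, Finset.mem_univ, true_and] at hτ ⊢
  exact hτ.1

/-- Only this instance of linearity is needed: it passes from a pressure to the one with its mean
removed. -/
lemma residual_sub_const (u : Fin M.N → Fin 2 → Poly) (q : Fin M.N → Poly) (a : ℝ) :
    F.residual u (fun τ => q τ - MvPolynomial.C a) =
      F.residual u q - a * F.residual u (fun _ => 1) := by
  have hpr (S : Finset (Fin M.N)) (A : Fin M.N → Pt → ℝ)
      (hA : ∀ τ ∈ S, ∀ G : Pt → ℝ, Continuous G →
        EdgeIntegrable (M.fst τ) (M.snd τ) (fun x => A τ x * G x)) :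
      M.intPr S (fun τ x => A τ x * ev (q τ - MvPolynomial.C a) x) =
        M.intPr S (fun τ x => A τ x * ev (q τ) x) - a * M.intPr S (fun τ x => A τ x * ev 1 x) := by
    unfold intPr
    rw [Finset.mul_sum, ← Finset.sum_sub_distrib]
    refine Finset.sum_congr rfl fun τ hτ => ?_
    have hb := hA τ hτ (fun _ => a) continuous_const
    rw [← edgeInt_const_mul, ← edgeInt_sub (hA τ hτ _ (continuous_ev _))
      (by simpa [mul_comm] using hb)]
    refine edgeInt_congr fun x _ => ?_
    simp; ring
  have h1 : M.intCells M.cellsB (fun τ x => ev (q τ - MvPolynomial.C a) x * dv (u τ) x) =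
      M.intCells M.cellsB (fun τ x => ev (q τ) x * dv (u τ) x)
        - a * M.intCells M.cellsB (fun τ x => ev 1 x * dv (u τ) x) := by
    rw [← intCells_const_mul, ← intCells_sub (fun σ _ => M.integrableOn_cell (by fun_prop) σ)
      (fun σ _ => M.integrableOn_cell (by fun_prop) σ)]
    refine intCells_congr fun σ _ x _ => ?_
    simp; ring
  have h2 := hpr M.cellsB (fun τ x => evV (u τ) x ⬝ᵥ M.nPr τ)
    (fun τ _ G hG => edgeIntegrable_of_continuous (by fun_prop) _ _)
  have h3 := hpr M.edgesΓ (fun τ x => evV (u (M.opp τ)) x ⬝ᵥ M.nPr (M.opp τ))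
    (fun τ _ G hG => edgeIntegrable_of_continuous (by fun_prop) _ _)
  have h4 := hpr M.edgesΓB (fun τ x => F.g x)
    (fun τ hτ G hG => edgeIntegrable_g_mul (edgesΓB_subset_bdry hτ) hG)
  unfold residual formI
  simp only [mul_comm _ (_ ⬝ᵥ M.nPr _)]
  rw [h1, h2, h3, h4]
  ring

/-- Global mass balance: the residual vanishes on constants. -/
lemma IsDiscreteFlow.residual_one {L : Fin M.N → Fin 2 → Fin 2 → Poly}
    {u : Fin M.N → Fin 2 → Poly} {pB pD : Fin M.N → Poly} (h : F.IsDiscreteFlow L u pB pD)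
    {w : Pt → Pt} (hw : F.SatisfiesMassBalance w) : F.residual u (fun _ => 1) = 0 := by
  classical
  have huB : u ∈ M.HB k := h.2.1
  have huD : u ∈ M.HD k F.g := h.2.2.2.1
  have hB : M.intCells M.cellsB (fun τ x => dv (u τ) x) =
      M.intPr M.cellsB (fun τ x => evV (u τ) x ⬝ᵥ M.nPr τ) := by
    rw [intCells_dv M.next_mem_cellsB, intDl_congr (jumpDl_eq_zero_of_mem_HB huB), add_eq_left]
    simp [intDl, edgeInt_zero]
  have hD : M.intCells M.cellsD (fun τ x => dv (u τ) x) =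
      M.intPr M.cellsD (fun τ x => evV (u τ) x ⬝ᵥ M.nPr τ) := by
    rw [intCells_dv M.next_mem_cellsD, intDl_congr (jumpDl_eq_zero_of_mem_HD huD), add_eq_left]
    simp [intDl, edgeInt_zero]
  have hf : M.intCells M.cellsD (fun τ x => dv (u τ) x) =
      M.intCells M.cellsD (fun τ x => ev (F.f τ) x) :=
    intCells_congr fun τ hτ x hx => h.dv_eq_darcy hτ hx
  -- Green's formula for the exact velocity with test function `1` is the compatibility condition
  -- between `f` and `g`; nothing else about the exact velocity is used.
  have hm : M.intCells M.cellsD (fun τ x => ev (F.f τ) x) = M.intPr M.bdry (fun _ x => F.g x) := by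
    simpa using hw.2 (fun _ => 1) contDiff_const
  set E : Fin M.N → ℝ := fun τ =>
    edgeInt (M.fst τ) (M.snd τ) (fun x => evV (u τ) x ⬝ᵥ M.nPr τ) with hE
  -- `a` counts the outward flux through all primal edges of Darcy cells, and `b` counts the
  -- interface part again from the Brinkman side. In `a - b` interface fluxes cancel in pairs and
  -- interior Darcy fluxes cancel by conformity, so only `Γ_D` survives.
  set a : Fin M.N → ℝ := fun τ => if M.brinkman τ = false then E τ else 0 with ha
  set b : Fin M.N → ℝ := fun τ =>
    if M.brinkman τ = true ∧ M.brinkman (M.opp τ) = false then E (M.opp τ) else 0 with hb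
  have hsum : ∑ τ, (a τ - b τ) = ∑ τ ∈ M.bdry, (a τ - b τ) := by
    refine sum_eq_sum_bdry fun τ hne => ?_
    simp only [ha, hb, M.opp_opp]
    rcases Bool.eq_false_or_eq_true (M.brinkman τ) with h1 | h1 <;>
      rcases Bool.eq_false_or_eq_true (M.brinkman (M.opp τ)) with h2 | h2 <;> simp [h1, h2]
    simp only [hE]
    rw [M.edgeInt_opp hne, ← edgeInt_add (edgeIntegrable_of_continuous (by fun_prop) _ _)
      (edgeIntegrable_of_continuous (by fun_prop) _ _), edgeInt_congr (G := fun _ => 0),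
      edgeInt_zero]
    exact fun x hx => normal_add_normal_of_mem_HD huD h1 h2 hne hx
  have ha' : ∑ τ, a τ = M.intPr M.cellsD (fun τ x => evV (u τ) x ⬝ᵥ M.nPr τ) := by
    rw [intPr, cellsD, Finset.sum_filter]
  have hb' : ∑ τ, b τ = M.formI (fun _ => 1) u := by
    rw [formI, intPr, edgesΓ, Finset.sum_filter]
    refine Finset.sum_congr rfl fun τ _ => ?_
    simp only [hb]
    refine if_ctx_congr Iff.rfl (fun hc => ?_) (fun _ => rfl)
    have hne : M.opp τ ≠ τ := by
      intro hcon; rw [hcon] at hc; simp [hc.1] at hc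
    simp only [hE, ev_one, mul_one]
    rw [M.edgeInt_opp hne]
  have hbd : ∑ τ ∈ M.bdry, (a τ - b τ) = M.intPr M.edgesΓD (fun _ x => F.g x) := by
    have : M.edgesΓD = M.bdry.filter fun τ => M.brinkman τ = false := by
      rw [bdry, Finset.filter_filter, edgesΓD]
    rw [intPr, this, Finset.sum_filter]
    refine Finset.sum_congr rfl fun τ hτ => ?_
    have ho : M.opp τ = τ := by simpa [bdry] using hτ
    have hb0 : b τ = 0 := by
      simp only [hb, ho]
      rw [if_neg]; rintro ⟨h1, h2⟩; simp [h1] at h2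
    rw [hb0, sub_zero]
    refine if_ctx_congr Iff.rfl (fun hc => ?_) (fun _ => rfl)
    -- Constants are among the test polynomials of the projection, so the discrete flux through the
    -- edge has the same integral as `g`.
    have h1 := huD.2.2.2 τ (by simp [edgesΓD, ho, hc]) 1 (by simp)
    simp only [ev_one, mul_one] at h1
    rw [edgeInt_sub (edgeIntegrable_g hτ) (edgeIntegrable_of_continuous (by fun_prop) _ _)] at h1
    simp only [hE]
    linarith
  have hsplit : M.intPr M.bdry (fun _ x => F.g x) =
      M.intPr M.edgesΓB (fun _ x => F.g x) + M.intPr M.edgesΓD (fun _ x => F.g x) := by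
    have e1 : M.edgesΓB = M.bdry.filter fun τ => M.brinkman τ = true := by
      rw [bdry, Finset.filter_filter, edgesΓB]
    have e2 : M.edgesΓD = M.bdry.filter fun τ => ¬ M.brinkman τ = true := by
      rw [bdry, Finset.filter_filter, edgesΓD]; simp
    rw [intPr, intPr, intPr, e1, e2, Finset.sum_filter_add_sum_filter_not]
  rw [Finset.sum_sub_distrib, ha', hb', hbd] at hsum
  unfold residual
  simp only [ev_one, one_mul, mul_one]
  linarith

/-- The mean-zero constraint is immaterial: subtracting the mean puts `q` into the pressure space,
and constants do not change the residual. -/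
lemma residual_eq_zero {L : Fin M.N → Fin 2 → Fin 2 → Poly}
    {u : Fin M.N → Fin 2 → Poly} {pB pD : Fin M.N → Poly} (h : F.IsDiscreteFlow L u pB pD)
    {w : Pt → Pt} (hw : F.SatisfiesMassBalance w) {q : Fin M.N → Poly} (hq : q ∈ M.QB k) :
    F.residual u q = 0 := by
  set V : ℝ := M.intCells M.cellsB (fun _ _ => 1) with hV
  set m : ℝ := M.intCells M.cellsB (fun τ x => ev (q τ) x) / V with hm
  have h1 := residual_sub_const (F := F) u q m
  rw [h.residual_one hw, mul_zero, sub_zero] at h1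
  rw [← h1, residual_eq h.2.1]
  have hmem : (fun τ => q τ - MvPolynomial.C m) ∈ M.QB0 k := by
    refine ⟨⟨fun τ hτ => ?_, fun τ hτ x hx => ?_⟩, ?_⟩
    · refine (MvPolynomial.totalDegree_sub _ _).trans (max_le (hq.1 τ hτ) ?_)
      rw [MvPolynomial.totalDegree_C]; exact Nat.zero_le _
    · have hne : M.opp τ ≠ τ := by simpa [prB0] using (Finset.mem_filter.1 hτ).2
      have := hq.2 τ hτ x hx
      rw [jumpPr, if_neg hne] at this ⊢
      simpa using this
    · simp only [ev_sub, ev_C]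
      rw [intCells_sub (fun σ _ => M.integrableOn_cell (by fun_prop) σ)
        (fun σ _ => M.integrableOn_cell (by fun_prop) σ)]
      have e : M.intCells M.cellsB (fun _ _ => m) = m * V := by
        rw [hV, ← intCells_const_mul]; simp
      rw [e, hm]
      -- Each cell has positive area, so `V = 0` only when there are no Brinkman cells and the sums
      -- are empty.
      by_cases hV0 : V = 0
      · have hemp : M.cellsB = ∅ := by
          by_contra hne
          obtain ⟨τ, hτ⟩ := Finset.nonempty_iff_ne_empty.2 hne
          rw [hV, intCells, Finset.sum_eq_zero_iff_of_nonneg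
            fun σ _ => integral_nonneg fun _ => zero_le_one] at hV0
          have := eq_zero_of_integral_triangle_eq_zero (M.area2_pos τ) (F := fun _ => 1)
            continuous_const (fun _ _ => zero_le_one) (hV0 τ hτ) (M.apex τ)
            (subset_convexHull ℝ _ (by simp [vertexSet]))
          exact one_ne_zero this
        simp [hemp, intCells]
      · field_simp; ring
  have := h.2.2.2.2.2.2.2 _ hmem
  linarith

/-- The discrete velocity is divergence-free in the Brinkman region. -/
lemma IsDiscreteFlow.dv_eq_zero_brinkman (hk : 1 ≤ k) {L : Fin M.N → Fin 2 → Fin 2 → Poly}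
    {u : Fin M.N → Fin 2 → Poly} {pB pD : Fin M.N → Poly} (h : F.IsDiscreteFlow L u pB pD)
    {w : Pt → Pt} (hw : F.SatisfiesMassBalance w) {τ : Fin M.N} (hτ : τ ∈ M.cellsB) {x : Pt}
    (hx : x ∈ M.cell τ) : dv (u τ) x = 0 := by
  classical
  -- The linear factor vanishes on the primal edge of `τ`. Hence the extension by zero is an
  -- admissible pressure, all edge terms of the residual drop out, and a weighted integral of `(div
  -- u)²` remains. The degree is at most `1 + (k - 1)`, which is `k` because `k ≥ 1`.
  set P : Poly := area2Poly (M.fst τ) (M.snd τ) * dvPoly (u τ) with hP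
  set q : Fin M.N → Poly := fun σ => if σ = τ then P else 0 with hq
  have hseg : ∀ y ∈ M.segPr τ, ev P y = 0 := by
    intro y hy
    rw [hP, ev_mul, ev_area2Poly, area2_eq_zero_of_mem_segment hy, zero_mul]
  have hq0 : ∀ σ, ∀ y ∈ M.segPr σ, ev (q σ) y = 0 := by
    intro σ y hy
    by_cases hs : σ = τ
    · subst hs; simpa [hq] using hseg y hy
    · simp [hq, hs]
  have hQ : q ∈ M.QB k := by
    refine ⟨fun σ _ => ?_, fun σ hσ y hy => ?_⟩
    · by_cases hs : σ = τ
      · simp only [hq, hs, if_true, hP]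
        have h1 := totalDegree_area2Poly_le (M.fst τ) (M.snd τ)
        have h2 := totalDegree_dvPoly_le (h.2.1.1 τ hτ)
        have h3 := MvPolynomial.totalDegree_mul (area2Poly (M.fst τ) (M.snd τ)) (dvPoly (u τ))
        omega
      · simp [hq, hs]
    · have hne : M.opp σ ≠ σ := by simpa [prB0] using (Finset.mem_filter.1 hσ).2
      rw [jumpPr, if_neg hne, hq0 σ y hy, hq0 (M.opp σ) y (by rwa [M.segPr_opp hne]), sub_zero]
  have hr := residual_eq_zero h hw hQ
  have e1 : M.intPr M.cellsB (fun σ x => ev (q σ) x * (evV (u σ) x ⬝ᵥ M.nPr σ)) = 0 := by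
    rw [intPr_congr (G := fun _ _ => 0) fun σ _ y hy => by rw [hq0 σ y hy, zero_mul]]
    simp [intPr, edgeInt_zero]
  have e2 : M.formI q u = 0 := by
    rw [formI, intPr_congr (G := fun _ _ => 0) fun σ _ y hy => by rw [hq0 σ y hy, mul_zero]]
    simp [intPr, edgeInt_zero]
  have e3 : M.intPr M.edgesΓB (fun σ x => F.g x * ev (q σ) x) = 0 := by
    rw [intPr_congr (G := fun _ _ => 0) fun σ _ y hy => by rw [hq0 σ y hy, mul_zero]]
    simp [intPr, edgeInt_zero]
  rw [residual, e1, e2, e3, intCells, Finset.sum_eq_single_of_mem τ hτ] at hr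
  · refine eq_zero_of_integral_area2_mul_sq (M.area2_pos τ) (F := fun x => dv (u τ) x)
      (by fun_prop) ?_ x hx
    simp only [sub_zero, add_zero] at hr
    rw [← hr]
    refine setIntegral_congr_fun (M.measurableSet_cell τ) fun y _ => ?_
    simp only [hq, if_true, hP, ev_mul, ev_area2Poly, ev_dvPoly]
    ring
  · intro σ _ hs; simp [hq, hs]

/-- The normal component of the discrete velocity is continuous across primal edges of the
Brinkman region and across the interface. -/
lemma IsDiscreteFlow.normal_add_normal_brinkman
    {L : Fin M.N → Fin 2 → Fin 2 → Poly}
    {u : Fin M.N → Fin 2 → Poly} {pB pD : Fin M.N → Poly} (h : F.IsDiscreteFlow L u pB pD)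
    (hk : 1 ≤ k) {w : Pt → Pt} (hw : F.SatisfiesMassBalance w) {τ : Fin M.N} (hτ : τ ∈ M.cellsB)
    (hne : M.opp τ ≠ τ) {x : Pt} (hx : x ∈ M.segPr τ) :
    evV (u τ) x ⬝ᵥ M.nPr τ + evV (u (M.opp τ)) x ⬝ᵥ M.nPr (M.opp τ) = 0 := by
  classical
  -- `P` is the normal jump extended from the edge to the plane as a polynomial. Taking the same `P`
  -- on both adjacent cells makes the test function continuous across the edge.
  set P : Poly := ∑ i, MvPolynomial.C (M.nPr τ i) * u τ i
    + ∑ i, MvPolynomial.C (M.nPr (M.opp τ) i) * u (M.opp τ) i with hP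
  have hPev (y : Pt) : ev P y =
      evV (u τ) y ⬝ᵥ M.nPr τ + evV (u (M.opp τ)) y ⬝ᵥ M.nPr (M.opp τ) := by
    simp [hP, dotProduct, Fin.sum_univ_two, evV]; ring
  have hdeg (σ : Fin M.N) (i : Fin 2) : (u σ i).totalDegree ≤ k := by
    rcases Bool.eq_false_or_eq_true (M.brinkman σ) with h1 | h1
    · exact h.2.1.1 σ (M.mem_cellsB.2 h1) i
    · exact h.2.2.2.1.1 σ (M.mem_cellsD.2 h1) i
  have hPdeg : P.totalDegree ≤ k := by
    have hs (σ : Fin M.N) (n : Pt) : (∑ i, MvPolynomial.C (n i) * u σ i).totalDegree ≤ k :=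
      MvPolynomial.totalDegree_finsetSum_le fun i _ =>
        (MvPolynomial.totalDegree_mul _ _).trans (by
          rw [MvPolynomial.totalDegree_C, zero_add]; exact hdeg σ i)
    exact (MvPolynomial.totalDegree_add _ _).trans (max_le (hs _ _) (hs _ _))
  set q : Fin M.N → Poly := fun σ => if σ = τ ∨ σ = M.opp τ then P else 0 with hq
  have hQ : q ∈ M.QB k := by
    refine ⟨fun σ _ => ?_, fun σ hσ y hy => ?_⟩
    · by_cases hs : σ = τ ∨ σ = M.opp τ <;> simp [hq, hs, hPdeg]
    · have hne' : M.opp σ ≠ σ := by simpa [prB0] using (Finset.mem_filter.1 hσ).2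
      have hiff : (M.opp σ = τ ∨ M.opp σ = M.opp τ) ↔ (σ = τ ∨ σ = M.opp τ) := by
        constructor
        · rintro (rfl | h1)
          · right; rw [M.opp_opp]
          · left; rw [← M.opp_opp σ, h1, M.opp_opp]
        · rintro (rfl | rfl)
          · right; rfl
          · left; exact M.opp_opp τ
      rw [jumpPr, if_neg hne']
      simp only [hq, hiff, sub_self]
  have hr := residual_eq_zero h hw hQ
  have hqτ : q τ = P := by simp [hq]
  have hqo : q (M.opp τ) = P := by simp [hq]
  have hqn : ∀ σ, σ ≠ τ → σ ≠ M.opp τ → q σ = 0 := fun σ h1 h2 => by simp [hq, h1, h2]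
  have e1 : M.intCells M.cellsB (fun σ x => ev (q σ) x * dv (u σ) x) = 0 := by
    rw [intCells_congr (G := fun _ _ => 0) fun σ hσ y hy => by
      rw [h.dv_eq_zero_brinkman hk hw hσ hy, mul_zero]]
    simp [intCells]
  have e2 : M.intPr M.edgesΓB (fun σ x => F.g x * ev (q σ) x) = 0 := by
    rw [intPr_congr (G := fun _ _ => 0)]
    · simp [intPr, edgeInt_zero]
    · intro σ hσ y _
      have ho : M.opp σ = σ := by simpa [bdry] using edgesΓB_subset_bdry hσ
      rw [hqn σ (by rintro rfl; exact hne ho) (by rintro rfl; exact M.opp_opp_ne hne ho),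
        ev_zero, mul_zero]
  set E : Fin M.N → ℝ := fun σ =>
    edgeInt (M.fst τ) (M.snd τ) (fun x => ev P x * (evV (u σ) x ⬝ᵥ M.nPr σ)) with hE
  have hτB := M.mem_cellsB.1 hτ
  -- The flux from the far side of the edge comes from the cell sum if that side is Brinkman, and
  -- from the interface form if it is Darcy. The outcome is the same.
  have e3 : M.intPr M.cellsB (fun σ x => ev (q σ) x * (evV (u σ) x ⬝ᵥ M.nPr σ)) + M.formI q u =
      E τ + E (M.opp τ) := by
    rcases Bool.eq_false_or_eq_true (M.brinkman (M.opp τ)) with h2 | h2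
    · have hI : M.formI q u = 0 := by
        rw [formI, intPr_congr (G := fun _ _ => 0)]
        · simp [intPr, edgeInt_zero]
        · intro σ hσ y _
          simp only [edgesΓ, Finset.mem_filter, Finset.mem_univ, true_and] at hσ
          rw [hqn σ, ev_zero, mul_zero]
          · rintro rfl; simp [h2] at hσ
          · rintro rfl; simp [M.opp_opp, hτB] at hσ
      rw [hI, add_zero, intPr, Finset.sum_eq_add_of_mem τ (M.opp τ) hτ (M.mem_cellsB.2 h2) hne.symm]
      · rw [hqτ, hqo, M.edgeInt_opp hne]
      · rintro σ _ ⟨h3, h4⟩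
        simp [hqn σ h3 h4, edgeInt_zero]
    · have hI : M.formI q u = E (M.opp τ) := by
        rw [formI, intPr, Finset.sum_eq_single_of_mem τ (by simp [edgesΓ, hτB, h2])]
        · rw [hqτ]; simp only [hE, mul_comm]
        · intro σ hσ h3
          simp only [edgesΓ, Finset.mem_filter, Finset.mem_univ, true_and] at hσ
          rw [hqn σ h3 (by rintro rfl; simp [h2] at hσ)]
          simp [edgeInt_zero]
      rw [hI, intPr, Finset.sum_eq_single_of_mem τ hτ, hqτ]
      intro σ hσ h3
      rw [hqn σ h3 (by rintro rfl; rw [M.mem_cellsB, h2] at hσ; simp at hσ)]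
      simp [edgeInt_zero]
  have e4 : E τ + E (M.opp τ) = edgeInt (M.fst τ) (M.snd τ) (fun x => ev P x ^ 2) := by
    simp only [hE]
    rw [← edgeInt_add (edgeIntegrable_of_continuous (by fun_prop) _ _)
      (edgeIntegrable_of_continuous (by fun_prop) _ _)]
    refine edgeInt_congr fun y _ => ?_
    rw [hPev]; ring
  have h0 : edgeInt (M.fst τ) (M.snd τ) (fun x => ev P x ^ 2) = 0 := by
    rw [residual, e1, e2] at hr
    linarith
  rw [← hPev]
  exact eq_zero_of_edgeInt_sq_eq_zero (M.fst_ne_snd τ) (continuous_ev P) h0 x hx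

/-- The normal component of the discrete velocity is continuous across all interior primal
edges. -/
lemma IsDiscreteFlow.normal_add_normal
    {L : Fin M.N → Fin 2 → Fin 2 → Poly}
    {u : Fin M.N → Fin 2 → Poly} {pB pD : Fin M.N → Poly} (h : F.IsDiscreteFlow L u pB pD)
    (hk : 1 ≤ k) {w : Pt → Pt} (hw : F.SatisfiesMassBalance w) {τ : Fin M.N}
    (hne : M.opp τ ≠ τ) {x : Pt} (hx : x ∈ M.segPr τ) :
    evV (u τ) x ⬝ᵥ M.nPr τ + evV (u (M.opp τ)) x ⬝ᵥ M.nPr (M.opp τ) = 0 := by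
  rcases Bool.eq_false_or_eq_true (M.brinkman τ) with h1 | h1
  · exact h.normal_add_normal_brinkman hk hw (M.mem_cellsB.2 h1) hne hx
  · rcases Bool.eq_false_or_eq_true (M.brinkman (M.opp τ)) with h2 | h2
    · have := h.normal_add_normal_brinkman hk hw (M.mem_cellsB.2 h2) (M.opp_opp_ne hne)
        (x := x) (by rwa [M.segPr_opp hne])
      rw [M.opp_opp] at this
      rw [add_comm]; exact this
    · exact normal_add_normal_of_mem_HD h.2.2.2.1 h1 h2 hne hx

/-- The divergence of the discrete velocity is `f` everywhere. -/
lemma IsDiscreteFlow.dv_eq (hk : 1 ≤ k)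
    {L : Fin M.N → Fin 2 → Fin 2 → Poly}
    {u : Fin M.N → Fin 2 → Poly} {pB pD : Fin M.N → Poly} (h : F.IsDiscreteFlow L u pB pD)
    {w : Pt → Pt} (hw : F.SatisfiesMassBalance w) {τ : Fin M.N} {x : Pt}
    (hx : x ∈ M.cell τ) : dv (u τ) x = ev (F.f τ) x := by
  rcases Bool.eq_false_or_eq_true (M.brinkman τ) with h1 | h1
  · rw [h.dv_eq_zero_brinkman hk hw (M.mem_cellsB.2 h1) hx, F.f_brinkman τ (M.mem_cellsB.2 h1),
      ev_zero]
  · exact h.dv_eq_darcy (M.mem_cellsD.2 h1) hx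

lemma IsDiscreteFlow.jumpDl_normal
    {L : Fin M.N → Fin 2 → Fin 2 → Poly}
    {u : Fin M.N → Fin 2 → Poly} {pB pD : Fin M.N → Poly} (h : F.IsDiscreteFlow L u pB pD)
    {τ : Fin M.N} {x : Pt} (hx : x ∈ M.segDl τ) :
    jumpDl (fun σ => evV (u σ) x ⬝ᵥ M.nDl τ) τ = 0 := by
  rcases Bool.eq_false_or_eq_true (M.brinkman τ) with h1 | h1
  · exact jumpDl_eq_zero_of_mem_HB h.2.1 τ (M.mem_cellsB.2 h1) x hx
  · exact jumpDl_eq_zero_of_mem_HD h.2.2.2.1 τ (M.mem_cellsD.2 h1) x hx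

end FlowData

/-! ### The energy identity of the semi-discrete scheme -/

namespace StaggeredMesh

variable {M : StaggeredMesh} {k : ℕ}

@[fun_prop]
lemma continuous_evV_dotProduct_grad (v : Fin 2 → Poly) (q : Poly) :
    Continuous fun x => evV v x ⬝ᵥ grad q x := by simp only [dotProduct]; fun_prop

lemma ev_opp_of_mem_U {c : Fin M.N → Poly} (hc : c ∈ M.U k) {τ : Fin M.N} (hne : M.opp τ ≠ τ)
    {x : Pt} (hx : x ∈ M.segPr τ) : ev (c (M.opp τ)) x = ev (c τ) x := by
  by_cases hl : τ ∈ M.lead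
  · have := hc.2 τ (by simp [pr0, hl, hne]) x hx
    rw [jumpPr, if_neg hne] at this
    linarith
  · have hl' : M.opp τ ∈ M.lead := by
      by_contra hcon; exact hl ((M.lead_inner τ hne).2 hcon)
    have := hc.2 (M.opp τ) (by simp [pr0, hl', M.opp_opp_ne hne]) x (by rwa [M.segPr_opp hne])
    rw [jumpPr, if_neg (M.opp_opp_ne hne), M.opp_opp] at this
    linarith

/-- The discrete gradient and the discrete divergence of the transport scheme are adjoint. -/
lemma formT_eq_formTstar {z : Fin M.N → Fin 2 → Poly} (hz : z ∈ M.W k) {c : Fin M.N → Poly}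
    (hc : c ∈ M.U k) : M.formT z c = M.formTstar c z := by
  have h := intCells_mul_dv (S := Finset.univ) (by simp) (fun τ _ => hz.2 τ) c
  -- Since `c` is single-valued on interior primal edges, the two cell fluxes there combine into `c`
  -- times the normal jump of `z`.
  have h2 : M.intPr Finset.univ (fun τ x => ev (c τ) x * (evV (z τ) x ⬝ᵥ M.nPr τ)) =
      M.intPr M.lead
        (fun τ x => ev (c τ) x * (jumpPr (fun σ => evV (z σ) x) τ ⬝ᵥ M.nPr τ)) := by
    rw [intPr, sum_univ_eq_sum_lead, intPr]
    refine Finset.sum_congr rfl fun τ _ => ?_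
    by_cases ho : M.opp τ = τ
    · simp only [ho, if_true, jumpPr]
    · rw [if_neg ho, M.edgeInt_opp ho, ← edgeInt_add
        (edgeIntegrable_of_continuous (by fun_prop) _ _)
        (edgeIntegrable_of_continuous (by fun_prop) _ _)]
      refine edgeInt_congr fun x hx => ?_
      rw [jumpPr, if_neg ho, ev_opp_of_mem_U hc ho hx, M.nPr_opp ho, sub_dotProduct, dotProduct_neg]
      ring
  unfold formT formTstar
  linarith

end StaggeredMesh

lemma EdgeIntegrable.indicator {p q : Pt} {w : Pt → ℝ} (h : EdgeIntegrable p q w) {S : Set Pt}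
    (hS : MeasurableSet S) : EdgeIntegrable p q (S.indicator w) := by
  have hS' : MeasurableSet ((fun r : ℝ => (AffineMap.lineMap p q r : Pt)) ⁻¹' S) :=
    (continuous_lineMap p q).measurable hS
  unfold EdgeIntegrable at h ⊢
  rw [intervalIntegrable_iff] at h ⊢
  exact Integrable.indicator h hS'

lemma EdgeIntegrable.add {p q : Pt} {F G : Pt → ℝ} (hF : EdgeIntegrable p q F)
    (hG : EdgeIntegrable p q G) : EdgeIntegrable p q fun x => F x + G x :=
  IntervalIntegrable.add hF hG

lemma EdgeIntegrable.sub {p q : Pt} {F G : Pt → ℝ} (hF : EdgeIntegrable p q F)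
    (hG : EdgeIntegrable p q G) : EdgeIntegrable p q fun x => F x - G x :=
  IntervalIntegrable.sub hF hG

lemma EdgeIntegrable.const_mul {p q : Pt} {F : Pt → ℝ} (hF : EdgeIntegrable p q F) (a : ℝ) :
    EdgeIntegrable p q fun x => a * F x :=
  IntervalIntegrable.const_mul hF a

lemma EdgeIntegrable.mono {p q : Pt} {F G : Pt → ℝ} (hG : EdgeIntegrable p q G)
    (hF : Measurable F) (h : ∀ x, |F x| ≤ G x) : EdgeIntegrable p q F := by
  unfold EdgeIntegrable at hG ⊢
  rw [intervalIntegrable_iff] at hG ⊢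
  exact Integrable.mono' hG (hF.comp (continuous_lineMap p q).measurable).aestronglyMeasurable
    (Filter.Eventually.of_forall fun r => h _)

namespace FlowData

open StaggeredMesh

variable {M : StaggeredMesh} {k : ℕ} {F : FlowData M k}

lemma measurableSet_inflow : MeasurableSet {y | F.g y < 0} :=
  measurableSet_lt F.g_meas measurable_const

lemma measurableSet_outflow : MeasurableSet {y | 0 ≤ F.g y} :=
  measurableSet_le measurable_const F.g_meas

/-- The convective part of the scheme, tested with the solution itself. -/
lemma IsDiscreteFlow.convection_eq (hk : 1 ≤ k)
    {L : Fin M.N → Fin 2 → Fin 2 → Poly}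
    {u : Fin M.N → Fin 2 → Poly} {pB pD : Fin M.N → Poly} (h : F.IsDiscreteFlow L u pB pD)
    {w : Pt → Pt} (hw : F.SatisfiesMassBalance w) {c : Fin M.N → Poly} (hc : c ∈ M.U k) :
    - M.intCells Finset.univ (fun τ x => ev (c τ) x * (evV (u τ) x ⬝ᵥ grad (c τ) x))
      + M.formS u c c =
      - (1 / 2) * M.intPr M.bdry (fun τ x => ev (c τ) x ^ 2 * (evV (u τ) x ⬝ᵥ M.nPr τ))
      + (1 / 2) * M.intCells Finset.univ (fun τ x => ev (c τ) x ^ 2 * ev (F.f τ) x)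
      + (1 / 2) * M.intDl Finset.univ (fun τ x => jumpDl (fun σ => ev (c σ) x) τ ^ 2 *
          |evV (u τ) x ⬝ᵥ M.nDl τ|) := by
  -- Integration by parts with weight `c²`, because `c u·∇c = ½ u·∇(c²)` and `{c}[c] = ½ [c²]`: the
  -- central part of the upwind form cancels the dual-edge terms and the upwind part stays.
  have h1 := intCells_mul_dv (S := Finset.univ) (by simp)
    (fun τ _ x hx => h.jumpDl_normal (τ := τ) (x := x) hx) (fun τ => c τ ^ 2)
  have e1 : M.intCells Finset.univ (fun τ x => ev (c τ ^ 2) x * dv (u τ) x) =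
      M.intCells Finset.univ (fun τ x => ev (c τ) x ^ 2 * ev (F.f τ) x) :=
    intCells_congr fun τ _ x hx => by rw [h.dv_eq hk hw hx, ev_pow]
  have e2 : M.intCells Finset.univ (fun τ x => evV (u τ) x ⬝ᵥ grad (c τ ^ 2) x) =
      2 * M.intCells Finset.univ (fun τ x => ev (c τ) x * (evV (u τ) x ⬝ᵥ grad (c τ) x)) := by
    rw [← intCells_const_mul]
    exact intCells_congr fun τ _ x _ => grad_sq _ _ _
  -- Both `c` and the normal component of `u` are continuous across interior primal edges, so the
  -- fluxes of `c²` cancel there.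
  have e3 : M.intPr Finset.univ (fun τ x => ev (c τ ^ 2) x * (evV (u τ) x ⬝ᵥ M.nPr τ)) =
      M.intPr M.bdry (fun τ x => ev (c τ) x ^ 2 * (evV (u τ) x ⬝ᵥ M.nPr τ)) := by
    simp only [ev_pow]
    unfold intPr
    refine sum_eq_sum_bdry fun τ hne => ?_
    rw [M.edgeInt_opp hne, ← edgeInt_add (edgeIntegrable_of_continuous (by fun_prop) _ _)
      (edgeIntegrable_of_continuous (by fun_prop) _ _), edgeInt_congr (G := fun _ => 0),
      edgeInt_zero]
    intro x hx
    have := h.normal_add_normal hk hw hne hx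
    beta_reduce
    rw [ev_opp_of_mem_U hc hne hx]
    linear_combination ev (c τ) x ^ 2 * this
  have e4 : M.intDl Finset.univ (fun τ x => (evV (u τ) x ⬝ᵥ M.nDl τ) *
        jumpDl (fun σ => ev (c σ ^ 2) x) τ) =
      2 * M.intDl Finset.univ (fun τ x => avgDl (fun σ => ev (c σ) x) τ *
        jumpDl (fun σ => ev (c σ) x) τ * (evV (u τ) x ⬝ᵥ M.nDl τ)) := by
    unfold intDl
    rw [Finset.mul_sum]
    refine Finset.sum_congr rfl fun τ _ => ?_
    rw [← edgeInt_const_mul]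
    refine edgeInt_congr fun x _ => ?_
    simp only [jumpDl, avgDl, ev_pow]; ring
  have e5 : M.intDl Finset.univ (fun τ x => jumpDl (fun σ => ev (c σ) x) τ ^ 2 *
        |evV (u τ) x ⬝ᵥ M.nDl τ|) = M.intDl Finset.univ (fun τ x => jumpDl (fun σ => ev (c σ) x) τ *
        jumpDl (fun σ => ev (c σ) x) τ * |evV (u τ) x ⬝ᵥ M.nDl τ|) :=
    intDl_congr fun τ _ x _ => by ring
  rw [e1, e2, e3, e4] at h1
  rw [formS, e5]
  linarith

/-- The boundary terms of the scheme, tested with the solution itself. -/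
lemma boundary_terms_eq (u : Fin M.N → Fin 2 → Poly) (c : Fin M.N → Poly) :
    F.intOut (fun τ x => (evV (u τ) x ⬝ᵥ M.nPr τ) * ev (c τ) x * ev (c τ) x)
      + (1 / 2) * F.intOut
          (fun τ x => (F.g x - evV (u τ) x ⬝ᵥ M.nPr τ) * ev (c τ) x * ev (c τ) x)
      - (1 / 2) * F.intIn
          (fun τ x => (F.g x - evV (u τ) x ⬝ᵥ M.nPr τ) * ev (c τ) x * ev (c τ) x)
      - (1 / 2) * M.intPr M.bdry (fun τ x => ev (c τ) x ^ 2 * (evV (u τ) x ⬝ᵥ M.nPr τ)) =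
      (1 / 2) * M.intPr M.bdry (fun τ x => |F.g x| * ev (c τ) x ^ 2) := by
  unfold intOut intIn intPr
  simp only [Finset.mul_sum, ← Finset.sum_add_distrib, ← Finset.sum_sub_distrib]
  refine Finset.sum_congr rfl fun τ hτ => ?_
  simp only [← edgeInt_const_mul]
  have hI : EdgeIntegrable (M.fst τ) (M.snd τ)
      (fun x => (evV (u τ) x ⬝ᵥ M.nPr τ) * ev (c τ) x * ev (c τ) x) :=
    edgeIntegrable_of_continuous (by fun_prop) _ _
  have hJ : EdgeIntegrable (M.fst τ) (M.snd τ)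
      (fun x => (F.g x - evV (u τ) x ⬝ᵥ M.nPr τ) * ev (c τ) x * ev (c τ) x) := by
    have := (edgeIntegrable_g_mul (F := F) hτ
      (G := fun x => ev (c τ) x * ev (c τ) x) (by fun_prop)).sub hI
    convert! this using 2
    ring
  have h1 := hI.indicator (F.measurableSet_outflow)
  have h2 := (hJ.indicator (F.measurableSet_outflow)).const_mul (1 / 2)
  have h3 := (hJ.indicator (F.measurableSet_inflow)).const_mul (1 / 2)
  have h4 : EdgeIntegrable (M.fst τ) (M.snd τ)
      (fun x => 1 / 2 * (ev (c τ) x ^ 2 * (evV (u τ) x ⬝ᵥ M.nPr τ))) :=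
    edgeIntegrable_of_continuous (by fun_prop) _ _
  rw [← edgeInt_add h1 h2, ← edgeInt_sub (h1.add h2) h3, ← edgeInt_sub ((h1.add h2).sub h3) h4]
  refine edgeInt_congr fun x _ => ?_
  -- On inflow the coefficient of `c²` is `-½(g - u·n) - ½ u·n = -½ g`; on outflow it is `u·n + ½(g
  -- - u·n) - ½ u·n = ½ g`. Both equal `½|g|`: the corrections replace the discrete flux by the
  -- exact one.
  by_cases hg : F.g x < 0
  · simp only [indicator, mem_ofPred_eq, hg, if_true, not_le.2 hg, if_false, abs_of_neg hg]
    ring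
  · simp only [indicator, mem_ofPred_eq, hg, if_true, not_lt.1 hg, if_false,
      abs_of_nonneg (not_lt.1 hg)]
    ring

end FlowData

/-! ### Energy identity and Young's inequality at a fixed time -/

namespace TransportData

open StaggeredMesh FlowData

variable {M : StaggeredMesh} {k : ℕ} {F : FlowData M k} {T : ℝ} (D : TransportData F T)

/-- The sum of the nonnegative dissipation terms produced by upwinding, injection, production and
the boundary. -/
noncomputable def dissipation (F : FlowData M k) (u : Fin M.N → Fin 2 → Poly)
    (c : Fin M.N → Poly) : ℝ :=
  (1 / 2) * M.intCells Finset.univ (fun τ x => |ev (F.f τ) x| * ev (c τ) x ^ 2)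
    + (1 / 2) * M.intDl Finset.univ (fun τ x => jumpDl (fun σ => ev (c σ) x) τ ^ 2 *
          |evV (u τ) x ⬝ᵥ M.nDl τ|)
    + (1 / 2) * M.intPr M.bdry (fun τ x => |F.g x| * ev (c τ) x ^ 2)

/-- The energy identity at a fixed time. -/
lemma energy_identity (hk : 1 ≤ k)
    {L : Fin M.N → Fin 2 → Fin 2 → Poly}
    {u : Fin M.N → Fin 2 → Poly} {pB pD : Fin M.N → Poly} (h : F.IsDiscreteFlow L u pB pD)
    {w : Pt → Pt} (hw : F.SatisfiesMassBalance w) {t : ℝ} {z : Fin M.N → Fin 2 → Poly}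
    {c c' : Fin M.N → Poly} (hc : c ∈ M.U k) (hz : z ∈ M.W k) (h1 : D.FluxEquation t z c)
    (h2 : D.BalanceEquation u t z c c') :
    M.intCells Finset.univ (fun τ x => D.φ x * ev (c' τ) x * ev (c τ) x)
      + D.fluxNormSq t z + dissipation F u c =
      M.intCells Finset.univ (fun τ x => D.φ x * D.s t x * ev (c τ) x)
        - F.intIn (fun τ x => D.cin t x * F.g x * ev (c τ) x)
        + M.intCells Finset.univ (fun τ x => D.chat t x * F.fplus τ x * ev (c τ) x) := by
  have e1 := h1 z hz
  have e2 := h2 c hc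
  have e3 := formT_eq_formTstar hz hc
  have e4 := h.convection_eq hk hw hc
  have e5 := boundary_terms_eq (F := F) u c
  -- Pointwise `f⁻ + ½ f = ½ |f|`.
  have e6 : M.intCells Finset.univ (fun τ x => ev (c τ) x * F.fminus τ x * ev (c τ) x)
      + (1 / 2) * M.intCells Finset.univ (fun τ x => ev (c τ) x ^ 2 * ev (F.f τ) x) =
      (1 / 2) * M.intCells Finset.univ (fun τ x => |ev (F.f τ) x| * ev (c τ) x ^ 2) := by
    rw [← intCells_const_mul, ← intCells_const_mul, ← intCells_add
      (fun τ _ => M.integrableOn_cell (by unfold fminus; fun_prop) τ)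
      (fun τ _ => M.integrableOn_cell (by fun_prop) τ)]
    refine intCells_congr fun τ _ x _ => ?_
    unfold fminus
    rcases le_total 0 (ev (F.f τ) x) with hf | hf
    · rw [abs_of_nonneg hf, max_eq_right (by linarith)]; ring
    · rw [abs_of_nonpos hf, max_eq_left (by linarith)]; ring
  unfold fluxNormSq dissipation
  linarith

/-- Young's inequality with weight `|g|`; the `c²` half is exactly the boundary dissipation. The
same majorant gives integrability of the left-hand integrand. -/
lemma neg_intIn_le {t : ℝ} {c : Fin M.N → Poly}
    (hcin : ∀ τ ∈ M.bdry, IntervalIntegrable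
      (fun r : ℝ => ({y | F.g y < 0}.indicator fun y => |F.g y| * D.cin t y ^ 2)
        (AffineMap.lineMap (M.fst τ) (M.snd τ) r)) volume 0 1) :
    - F.intIn (fun τ x => D.cin t x * F.g x * ev (c τ) x) ≤
      (1 / 2) * F.intIn (fun _ x => |F.g x| * D.cin t x ^ 2)
        + (1 / 2) * M.intPr M.bdry (fun τ x => |F.g x| * ev (c τ) x ^ 2) := by
  unfold intIn intPr
  rw [Finset.mul_sum, Finset.mul_sum, ← Finset.sum_add_distrib, ← Finset.sum_neg_distrib]
  refine Finset.sum_le_sum fun τ hτ => ?_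
  have hm : Measurable (D.cin t) := D.cin_meas.comp measurable_prodMk_left
  have h1 : EdgeIntegrable (M.fst τ) (M.snd τ) (fun x => |F.g x| * ev (c τ) x ^ 2) := by
    have := IntervalIntegrable.abs (edgeIntegrable_g_mul (F := F) hτ
      (G := fun x => ev (c τ) x ^ 2) (by fun_prop))
    unfold EdgeIntegrable
    convert! this using 2
    rw [abs_mul, abs_of_nonneg (sq_nonneg (ev (c τ) _))]
  have h2 : EdgeIntegrable (M.fst τ) (M.snd τ) ({y | F.g y < 0}.indicator
      fun y => |F.g y| * D.cin t y ^ 2) := hcin τ hτ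
  have h3 := (h2.const_mul (1 / 2)).add (h1.const_mul (1 / 2))
  have key : ∀ x, |({y | F.g y < 0}.indicator (fun x => D.cin t x * F.g x * ev (c τ) x)) x| ≤
      1 / 2 * ({y | F.g y < 0}.indicator (fun y => |F.g y| * D.cin t y ^ 2)) x
        + 1 / 2 * (|F.g x| * ev (c τ) x ^ 2) := by
    intro x
    by_cases hg : F.g x < 0
    · simp only [indicator, mem_ofPred_eq, hg, if_true]
      rw [abs_mul, abs_mul]
      have := mul_nonneg (abs_nonneg (F.g x)) (sq_nonneg (|D.cin t x| - |ev (c τ) x|))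
      rw [← sq_abs (D.cin t x), ← sq_abs (ev (c τ) x)]
      linarith
    · simp only [indicator, mem_ofPred_eq, hg, if_false]
      simp only [abs_zero]
      positivity
  have hmeas : Measurable ({y | F.g y < 0}.indicator (fun x => D.cin t x * F.g x * ev (c τ) x)) :=
    ((hm.mul F.g_meas).mul (continuous_ev _).measurable).indicator F.measurableSet_inflow
  have h4 := h3.mono hmeas key
  rw [← edgeInt_const_mul, ← edgeInt_const_mul,
    ← edgeInt_add (h2.const_mul _) (h1.const_mul _), ← edgeInt_neg]
  exact edgeInt_mono (IntervalIntegrable.neg h4) h3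
    fun x => (neg_le_abs _).trans (key x)

/-- Young's inequality with weight `f⁺ ≤ |f|`; the `c²` half is absorbed by the volume dissipation.
Brinkman cells carry no source. -/
lemma intCells_chat_le {t : ℝ} {c : Fin M.N → Poly}
    (hchat : ∀ τ ∈ M.cellsD, IntegrableOn (fun x => D.chat t x ^ 2 * F.fplus τ x) (M.cell τ)) :
    M.intCells Finset.univ (fun τ x => D.chat t x * F.fplus τ x * ev (c τ) x) ≤
      (1 / 2) * M.intCells M.cellsD (fun τ x => D.chat t x ^ 2 * F.fplus τ x)
        + (1 / 2) * M.intCells Finset.univ (fun τ x => |ev (F.f τ) x| * ev (c τ) x ^ 2) := by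
  have hm : Measurable (D.chat t) := D.chat_meas.comp measurable_prodMk_left
  unfold intCells
  rw [cellsD, Finset.sum_filter, Finset.mul_sum, Finset.mul_sum, ← Finset.sum_add_distrib]
  refine Finset.sum_le_sum fun τ _ => ?_
  have h1 : IntegrableOn (fun x => |ev (F.f τ) x| * ev (c τ) x ^ 2) (M.cell τ) :=
    M.integrableOn_cell (by fun_prop) τ
  by_cases hb : M.brinkman τ = false
  · rw [if_pos hb]
    have h2 := hchat τ (M.mem_cellsD.2 hb)
    rw [← integral_const_mul, ← integral_const_mul, ← integral_add (h2.const_mul _)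
      (h1.const_mul _)]
    have h3 := (h2.const_mul (1 / 2)).add (h1.const_mul (1 / 2))
    have key : ∀ x, |D.chat t x * F.fplus τ x * ev (c τ) x| ≤
        1 / 2 * (D.chat t x ^ 2 * F.fplus τ x) + 1 / 2 * (|ev (F.f τ) x| * ev (c τ) x ^ 2) := by
      intro x
      have hf0 : 0 ≤ F.fplus τ x := le_max_right _ _
      have hf1 : F.fplus τ x ≤ |ev (F.f τ) x| := max_le (le_abs_self _) (abs_nonneg _)
      rw [abs_mul, abs_mul, abs_of_nonneg hf0]
      have e1 := mul_nonneg hf0 (sq_nonneg (|D.chat t x| - |ev (c τ) x|))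
      have e2 := mul_le_mul_of_nonneg_right hf1 (sq_nonneg (ev (c τ) x))
      rw [← sq_abs (ev (c τ) x)] at e2 ⊢
      rw [← sq_abs (D.chat t x)]
      linarith
    have hmeas : Measurable fun x => D.chat t x * F.fplus τ x * ev (c τ) x :=
      (hm.mul (by unfold fplus; fun_prop : Continuous (F.fplus τ)).measurable).mul
        (continuous_ev _).measurable
    have h4 : IntegrableOn (fun x => D.chat t x * F.fplus τ x * ev (c τ) x) (M.cell τ) :=
      Integrable.mono' h3 hmeas.aestronglyMeasurable (Filter.Eventually.of_forall key)
    exact integral_mono h4 h3 fun x => (le_abs_self _).trans (key x)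
  · have hf : ∀ x, F.fplus τ x = 0 := fun x => by
      rw [fplus, F.f_brinkman τ (M.mem_cellsB.2 (by simpa using hb)), ev_zero, max_self]
    rw [if_neg hb]
    simp only [hf, mul_zero, zero_mul, integral_zero, zero_add]
    have : 0 ≤ ∫ x in M.cell τ, |ev (F.f τ) x| * ev (c τ) x ^ 2 :=
      integral_nonneg fun x => by positivity
    linarith

/-- The energy inequality at a fixed time. -/
lemma energy_inequality (hk : 1 ≤ k)
    {L : Fin M.N → Fin 2 → Fin 2 → Poly}
    {u : Fin M.N → Fin 2 → Poly} {pB pD : Fin M.N → Poly} (h : F.IsDiscreteFlow L u pB pD)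
    {w : Pt → Pt} (hw : F.SatisfiesMassBalance w) {t : ℝ} {z : Fin M.N → Fin 2 → Poly}
    {c c' : Fin M.N → Poly} (hc : c ∈ M.U k) (hz : z ∈ M.W k) (h1 : D.FluxEquation t z c)
    (h2 : D.BalanceEquation u t z c c')
    (hcin : ∀ τ ∈ M.bdry, IntervalIntegrable
      (fun r : ℝ => ({y | F.g y < 0}.indicator fun y => |F.g y| * D.cin t y ^ 2)
        (AffineMap.lineMap (M.fst τ) (M.snd τ) r)) volume 0 1)
    (hchat : ∀ τ ∈ M.cellsD, IntegrableOn (fun x => D.chat t x ^ 2 * F.fplus τ x) (M.cell τ)) :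
    M.intCells Finset.univ (fun τ x => D.φ x * ev (c' τ) x * ev (c τ) x) + D.fluxNormSq t z ≤
      M.intCells Finset.univ (fun τ x => D.φ x * D.s t x * ev (c τ) x)
        + (1 / 2) * (F.intIn (fun _ x => |F.g x| * D.cin t x ^ 2)
          + M.intCells M.cellsD (fun τ x => D.chat t x ^ 2 * F.fplus τ x)) := by
  have e1 := D.energy_identity hk h hw hc hz h1 h2
  have e2 := D.neg_intIn_le (c := c) hcin
  have e3 := D.intCells_chat_le (c := c) hchat
  have e4 : 0 ≤ M.intDl Finset.univ (fun τ x => jumpDl (fun σ => ev (c σ) x) τ ^ 2 *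
          |evV (u τ) x ⬝ᵥ M.nDl τ|) :=
    Finset.sum_nonneg fun τ _ => edgeInt_nonneg fun x => by positivity
  unfold dissipation at e1
  linarith

end TransportData

/-! ### Integrals over the domain and over the cells -/

namespace StaggeredMesh

variable (M : StaggeredMesh)

lemma interior_cell_subset_Ω (τ : Fin M.N) : interior (M.cell τ) ⊆ M.Ω :=
  interior_mono (subset_iUnion M.cell τ)

lemma volume_frontier_cell (τ : Fin M.N) : volume (frontier (M.cell τ)) = 0 :=
  (convex_convexHull ℝ _).addHaar_frontier volume

lemma interior_cell_ae_eq (τ : Fin M.N) : interior (M.cell τ) =ᵐ[volume] M.cell τ :=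
  interior_ae_eq_of_null_frontier (M.volume_frontier_cell τ)

/-- Cell boundaries are null, so the bounds on `φ` and `K`, assumed only on the open set `Ω`, may be
used under cell integrals. -/
lemma ae_mem_Ω (τ : Fin M.N) : ∀ᵐ x ∂(volume.restrict (M.cell τ)), x ∈ M.Ω := by
  rw [← Measure.restrict_congr_set (M.interior_cell_ae_eq τ)]
  filter_upwards [ae_restrict_mem isOpen_interior.measurableSet] with x hx
  exact M.interior_cell_subset_Ω τ hx

lemma measurableSet_Ω : MeasurableSet M.Ω := isOpen_interior.measurableSet

lemma Ω_ae_eq : M.Ω =ᵐ[volume] ⋃ τ, interior (M.cell τ) := by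
  have h1 : (⋃ τ, interior (M.cell τ)) ⊆ M.Ω := iUnion_subset M.interior_cell_subset_Ω
  refine Filter.EventuallyLE.antisymm ?_ h1.eventuallyLE
  rw [ae_le_set]
  refine measure_mono_null (t := ⋃ τ, frontier (M.cell τ)) ?_
    (measure_iUnion_null M.volume_frontier_cell)
  rintro x ⟨hx, hx'⟩
  obtain ⟨τ, hτ⟩ := mem_iUnion.1 (interior_subset hx)
  refine mem_iUnion.2 ⟨τ, subset_closure hτ, fun hcon => hx' (mem_iUnion.2 ⟨τ, hcon⟩)⟩

variable {M}

lemma integrableOn_cell_of_Ω {F : Pt → ℝ} (hF : IntegrableOn F M.Ω) (τ : Fin M.N) :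
    IntegrableOn F (M.cell τ) :=
  (hF.mono_set (M.interior_cell_subset_Ω τ)).congr_set_ae (M.interior_cell_ae_eq τ).symm

lemma intCells_univ_eq {F : Pt → ℝ} (hF : IntegrableOn F M.Ω) :
    M.intCells Finset.univ (fun _ => F) = ∫ x in M.Ω, F x := by
  rw [setIntegral_congr_set M.Ω_ae_eq, integral_iUnion_fintype
    (s := fun τ => interior (M.cell τ)) (fun τ => isOpen_interior.measurableSet)
    (fun τ σ h => M.nonoverlap τ σ h)
    (fun τ => hF.mono_set (M.interior_cell_subset_Ω τ))]
  exact Finset.sum_congr rfl fun τ _ => setIntegral_congr_set (M.interior_cell_ae_eq τ).symm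

lemma intCells_congr_ae {S : Finset (Fin M.N)} {F G : Fin M.N → Pt → ℝ}
    (h : ∀ τ ∈ S, ∀ x ∈ M.Ω, F τ x = G τ x) : M.intCells S F = M.intCells S G :=
  Finset.sum_congr rfl fun τ hτ => integral_congr_ae <| by
    filter_upwards [M.ae_mem_Ω τ] with x hx using h τ hτ x hx

lemma intCells_nonneg {S : Finset (Fin M.N)} {F : Fin M.N → Pt → ℝ}
    (h : ∀ τ ∈ S, ∀ x ∈ M.Ω, 0 ≤ F τ x) : 0 ≤ M.intCells S F :=
  Finset.sum_nonneg fun τ hτ => integral_nonneg_of_ae <| by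
    filter_upwards [M.ae_mem_Ω τ] with x hx using h τ hτ x hx

end StaggeredMesh

/-- Coercivity makes `A` invertible. With `y = A ξ` the form is `ξ·Aξ`, which is nonnegative. -/
lemma inv_mulVec_dotProduct_nonneg {A : Matrix (Fin 2) (Fin 2) ℝ} {m : ℝ} (hm : 0 < m)
    (hA : ∀ ξ : Pt, m * (ξ ⬝ᵥ ξ) ≤ ξ ⬝ᵥ A.mulVec ξ) (y : Pt) : 0 ≤ A⁻¹.mulVec y ⬝ᵥ y := by
  have hpos (ξ : Pt) : 0 ≤ ξ ⬝ᵥ ξ := by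
    simp only [dotProduct]; exact Finset.sum_nonneg fun i _ => mul_self_nonneg _
  have hinj : Function.Injective A.mulVec := by
    rw [← Matrix.coe_mulVecLin, ← LinearMap.ker_eq_bot, LinearMap.ker_eq_bot']
    intro ξ hξ
    have h1 := hA ξ
    rw [← Matrix.mulVecLin_apply, hξ, dotProduct_zero] at h1
    have h2 : ξ ⬝ᵥ ξ = 0 := le_antisymm (by nlinarith) (hpos ξ)
    exact dotProduct_self_eq_zero.1 h2
  have hu : IsUnit A.det := (Matrix.isUnit_iff_isUnit_det A).1 (Matrix.mulVec_injective_iff_isUnit.1 hinj)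
  have hy : A.mulVec (A⁻¹.mulVec y) = y := by
    rw [Matrix.mulVec_mulVec, Matrix.mul_nonsing_inv A hu, Matrix.one_mulVec]
  have := hA (A⁻¹.mulVec y)
  rw [hy] at this
  exact (mul_nonneg hm.le (hpos _)).trans this

/-! ### Porosity-weighted mass: source and initial data -/

namespace TransportData

open StaggeredMesh FlowData

variable {M : StaggeredMesh} {k : ℕ} {F : FlowData M k} {T : ℝ} (D : TransportData F T)

lemma fluxNormSq_nonneg {t : ℝ} (ht : t ∈ Ioo 0 T) (z : Fin M.N → Fin 2 → Poly) :
    0 ≤ D.fluxNormSq t z :=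
  intCells_nonneg fun _ _ x hx => inv_mulVec_dotProduct_nonneg D.Kmin_pos
    (fun ξ => ((D.K_spd t ht x hx).2 ξ).1) _

/-- `‖φ^{1/2} c‖₀²`. -/
noncomputable def mass (c : Fin M.N → Poly) : ℝ :=
  M.intCells Finset.univ (fun τ x => D.φ x * ev (c τ) x ^ 2)

lemma φ_pos {x : Pt} (hx : x ∈ M.Ω) : 0 < D.φ x := D.φlo_pos.trans_le (D.φ_bounds x hx).1

lemma mass_nonneg (c : Fin M.N → Poly) : 0 ≤ D.mass c :=
  intCells_nonneg fun _ _ _ hx => mul_nonneg (D.φ_pos hx).le (sq_nonneg _)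

lemma integrableOn_φ_mul {S : Set Pt} (hS : ∀ᵐ x ∂(volume.restrict S), x ∈ M.Ω) {G : Pt → ℝ}
    (hG : IntegrableOn G S) : IntegrableOn (fun x => D.φ x * G x) S := by
  refine Integrable.bdd_mul (c := D.φhi) hG D.φ_meas.aestronglyMeasurable ?_
  filter_upwards [hS] with x hx
  rw [Real.norm_eq_abs, abs_of_pos (D.φ_pos hx)]
  exact (D.φ_bounds x hx).2

lemma integrableOn_cell_φ_mul {G : Pt → ℝ} (hG : Continuous G) (τ : Fin M.N) :
    IntegrableOn (fun x => D.φ x * G x) (M.cell τ) :=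
  D.integrableOn_φ_mul (M.ae_mem_Ω τ) (M.integrableOn_cell hG τ)

/-- The Cauchy–Schwarz inequality for the source term. -/
lemma source_le {t : ℝ} (hs : IntegrableOn (fun x => D.s t x ^ 2) M.Ω) (c : Fin M.N → Poly) :
    M.intCells Finset.univ (fun τ x => D.φ x * D.s t x * ev (c τ) x) ≤
      (l2norm M.Ω fun x => Real.sqrt (D.φ x) * D.s t x) * Real.sqrt (D.mass c) := by
  have hm : Measurable (D.s t) := D.s_meas.comp measurable_prodMk_left
  have hA : IntegrableOn (fun x => D.φ x * D.s t x ^ 2) M.Ω :=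
    D.integrableOn_φ_mul (ae_restrict_mem M.measurableSet_Ω) hs
  have hAc := fun τ => integrableOn_cell_of_Ω hA τ
  have hC := fun τ => D.integrableOn_cell_φ_mul (G := fun x => ev (c τ) x ^ 2) (by fun_prop) τ
  have hB : ∀ τ, IntegrableOn (fun x => D.φ x * D.s t x * ev (c τ) x) (M.cell τ) := by
    intro τ
    refine Integrable.mono' ((hAc τ).add (hC τ))
      ((D.φ_meas.mul hm).mul (continuous_ev _).measurable).aestronglyMeasurable ?_
    filter_upwards [M.ae_mem_Ω τ] with x hx
    have h0 := D.φ_pos hx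
    rw [Real.norm_eq_abs, abs_mul, abs_mul, abs_of_pos h0]
    simp only [Pi.add_apply]
    rw [← sq_abs (D.s t x), ← sq_abs (ev (c τ) x)]
    nlinarith [mul_nonneg h0.le (sq_nonneg (|D.s t x| - |ev (c τ) x|)),
      mul_nonneg h0.le (sq_nonneg (|D.s t x|)), mul_nonneg h0.le (sq_nonneg (|ev (c τ) x|))]
  set A := M.intCells Finset.univ (fun _ x => D.φ x * D.s t x ^ 2) with hAdef
  set B := M.intCells Finset.univ (fun τ x => D.φ x * D.s t x * ev (c τ) x) with hBdef
  have hnorm : (l2norm M.Ω fun x => Real.sqrt (D.φ x) * D.s t x) = Real.sqrt A := by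
    rw [l2norm, hAdef, intCells_univ_eq hA]
    congr 1
    refine setIntegral_congr_fun M.measurableSet_Ω fun x hx => ?_
    simp only [mul_pow]
    rw [Real.sq_sqrt (D.φ_pos hx).le]
  have hA0 : 0 ≤ A := intCells_nonneg fun _ _ _ hx => mul_nonneg (D.φ_pos hx).le (sq_nonneg _)
  -- Cauchy–Schwarz by the discriminant of `r ↦ ‖φ^{1/2}(r s - c)‖²`.
  have hquad : ∀ r : ℝ, 0 ≤ A * (r * r) + (-2 * B) * r + D.mass c := by
    intro r
    have h1 : M.intCells Finset.univ (fun τ x => D.φ x * (r * D.s t x - ev (c τ) x) ^ 2) =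
        A * (r * r) + (-2 * B) * r + D.mass c := by
      have e : ∀ τ x, D.φ x * (r * D.s t x - ev (c τ) x) ^ 2 =
          (r * r) * (D.φ x * D.s t x ^ 2) + (-2 * r) * (D.φ x * D.s t x * ev (c τ) x)
            + D.φ x * ev (c τ) x ^ 2 := fun τ x => by ring
      have hI : ∀ τ, IntegrableOn (fun x => (r * r) * (D.φ x * D.s t x ^ 2)
          + (-2 * r) * (D.φ x * D.s t x * ev (c τ) x)) (M.cell τ) :=
        fun τ => ((hAc τ).const_mul _).add ((hB τ).const_mul _)
      simp only [e]
      rw [intCells_add (fun τ _ => hI τ) (fun τ _ => hC τ), intCells_add (fun τ _ => (hAc τ).const_mul _)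
        (fun τ _ => (hB τ).const_mul _), intCells_const_mul, intCells_const_mul, mass]
      ring
    rw [← h1]
    exact intCells_nonneg fun _ _ _ hx => mul_nonneg (D.φ_pos hx).le (sq_nonneg _)
  have hd := discrim_le_zero hquad
  unfold discrim at hd
  rw [hnorm, ← Real.sqrt_mul hA0]
  refine (le_abs_self B).trans (Real.abs_le_sqrt ?_)
  nlinarith

/-- Orthogonality tested with `c` gives `‖c‖² = (c⁰, c)`, and expanding `‖c⁰ - c‖² ≥ 0` shows that
the projection is a contraction. -/
lemma mass_initial_le {c : Fin M.N → Poly} (hc : c ∈ M.U k)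
    (h0 : ∀ q ∈ M.U k, M.intCells Finset.univ (fun τ x => (ev (c τ) x - D.c0 x) * ev (q τ) x) = 0) :
    D.mass c ≤ D.φhi * l2norm M.Ω D.c0 ^ 2 := by
  have hsq : IntegrableOn (fun x => D.c0 x ^ 2) M.Ω := D.c0_memLp.integrable_sq
  have hsqc := fun τ => integrableOn_cell_of_Ω hsq τ
  have hcc : ∀ τ, IntegrableOn (fun x => ev (c τ) x ^ 2) (M.cell τ) :=
    fun τ => M.integrableOn_cell (by fun_prop) τ
  have hc0m : ∀ τ, AEStronglyMeasurable D.c0 (volume.restrict (M.cell τ)) := fun τ => by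
    have := D.c0_memLp.aestronglyMeasurable.mono_set (M.interior_cell_subset_Ω τ)
    rwa [Measure.restrict_congr_set (M.interior_cell_ae_eq τ)] at this
  have hx : ∀ τ, IntegrableOn (fun x => D.c0 x * ev (c τ) x) (M.cell τ) := by
    intro τ
    refine Integrable.mono' ((hsqc τ).add (hcc τ))
      ((hc0m τ).mul (continuous_ev _).aestronglyMeasurable) (Filter.Eventually.of_forall fun x => ?_)
    rw [Real.norm_eq_abs, abs_mul]
    simp only [Pi.add_apply]
    rw [← sq_abs (D.c0 x), ← sq_abs (ev (c τ) x)]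
    nlinarith [sq_nonneg (|D.c0 x| - |ev (c τ) x|), sq_nonneg (|D.c0 x|), sq_nonneg (|ev (c τ) x|)]
  set C := M.intCells Finset.univ (fun τ x => ev (c τ) x ^ 2) with hC
  have hl2 : l2norm M.Ω D.c0 ^ 2 = M.intCells Finset.univ (fun _ x => D.c0 x ^ 2) := by
    rw [l2norm, Real.sq_sqrt (integral_nonneg fun _ => sq_nonneg _), intCells_univ_eq hsq]
  have hle : C ≤ l2norm M.Ω D.c0 ^ 2 := by
    have h1 := h0 c hc
    have e : ∀ τ x, (ev (c τ) x - D.c0 x) * ev (c τ) x = ev (c τ) x ^ 2 - D.c0 x * ev (c τ) x :=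
      fun τ x => by ring
    simp only [e] at h1
    rw [intCells_sub (fun τ _ => hcc τ) (fun τ _ => hx τ)] at h1
    have h2 : 0 ≤ M.intCells Finset.univ
        (fun τ x => D.c0 x ^ 2 - 2 * (D.c0 x * ev (c τ) x) + ev (c τ) x ^ 2) :=
      intCells_nonneg fun τ _ x _ => by nlinarith [sq_nonneg (D.c0 x - ev (c τ) x)]
    have hI : ∀ τ, IntegrableOn (fun x => D.c0 x ^ 2 - 2 * (D.c0 x * ev (c τ) x)) (M.cell τ) :=
      fun τ => (hsqc τ).sub ((hx τ).const_mul 2)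
    rw [intCells_add (fun τ _ => hI τ) (fun τ _ => hcc τ),
      intCells_sub (fun τ _ => hsqc τ) (fun τ _ => (hx τ).const_mul 2), intCells_const_mul] at h2
    rw [hl2]
    linarith
  have hφ : D.mass c ≤ D.φhi * C := by
    rw [hC, ← intCells_const_mul]
    unfold mass intCells
    refine Finset.sum_le_sum fun τ _ => integral_mono_ae
      (D.integrableOn_cell_φ_mul (by fun_prop) τ) ((hcc τ).const_mul _) ?_
    filter_upwards [M.ae_mem_Ω τ] with x hx
    exact mul_le_mul_of_nonneg_right (D.φ_bounds x hx).2 (sq_nonneg _)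
  -- The sign of `φhi` is known only through a point of `Ω`; for empty `Ω` both sides are zero.
  rcases M.Ω.eq_empty_or_nonempty with hΩ | ⟨x, hxΩ⟩
  · have h1 : D.mass c = 0 := by
      unfold mass
      rw [intCells_congr_ae (G := fun _ _ => 0) fun τ _ x hx => by simp [hΩ] at hx]
      simp [intCells]
    have h2 : l2norm M.Ω D.c0 = 0 := by simp [l2norm, hΩ]
    simp [h1, h2]
  · have : 0 ≤ D.φhi := ((D.φ_pos hxΩ).trans_le (D.φ_bounds x hxΩ).2).le
    exact hφ.trans (mul_le_mul_of_nonneg_left hle this)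

lemma mass_eq (c : Fin M.N → Poly) :
    M.intCells Finset.univ (fun τ x => (Real.sqrt (D.φ x) * ev (c τ) x) ^ 2) = D.mass c :=
  intCells_congr_ae fun τ _ x hx => by rw [mul_pow, Real.sq_sqrt (D.φ_pos hx).le]

end TransportData

/-! ### Absolutely continuous functions and a Gronwall inequality -/

lemma ae_deriv_const_add_integral {f' : ℝ → ℝ} {a b : ℝ} (hf : IntervalIntegrable f' volume a b)
    (y : ℝ) : ∀ᵐ r : ℝ, r ∈ uIcc a b → deriv (fun x => y + ∫ s in a..x, f' s) r = f' r := by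
  filter_upwards [hf.ae_hasDerivAt_integral] with r hr h
  exact ((hr h a left_mem_uIcc).const_add y).deriv

/-- The product rule for two absolutely continuous functions, in integrated form. -/
lemma mul_sub_mul_eq_integral {T : ℝ} {f g f' g' : ℝ → ℝ}
    (hf' : IntervalIntegrable f' volume 0 T) (hg' : IntervalIntegrable g' volume 0 T)
    (hf : ∀ t ∈ Icc 0 T, f t = f 0 + ∫ r in (0 : ℝ)..t, f' r)
    (hg : ∀ t ∈ Icc 0 T, g t = g 0 + ∫ r in (0 : ℝ)..t, g' r) {t : ℝ} (ht : t ∈ Icc 0 T) :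
    f t * g t - f 0 * g 0 = ∫ r in (0 : ℝ)..t, (f' r * g r + f r * g' r) := by
  have hsub : uIcc 0 t ⊆ uIcc 0 T := by
    rw [uIcc_of_le ht.1, uIcc_of_le (ht.1.trans ht.2)]; exact Icc_subset_Icc_right ht.2
  have hf'' := hf'.mono_set hsub
  have hg'' := hg'.mono_set hsub
  -- The two functions are controlled only on `[0, T]`, so absolute continuity is used for the
  -- primitives that represent them there.
  have ac {h' : ℝ → ℝ} (hh : IntervalIntegrable h' volume 0 t) (y : ℝ) :
      AbsolutelyContinuousOnInterval (fun x => y + ∫ s in (0 : ℝ)..x, h' s) 0 t :=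
    ((LipschitzWith.const y).lipschitzOnWith.absolutelyContinuousOnInterval).fun_add
      (hh.absolutelyContinuousOnInterval_intervalIntegral left_mem_uIcc)
  have key := (ac hf'' (f 0)).integral_deriv_mul_eq_sub (ac hg'' (g 0))
  simp only [intervalIntegral.integral_same, add_zero] at key
  rw [← hf t ht, ← hg t ht] at key
  rw [← key]
  refine intervalIntegral.integral_congr_ae ?_
  filter_upwards [ae_deriv_const_add_integral hf'' (f 0), ae_deriv_const_add_integral hg'' (g 0)]
    with r h1 h2 hr
  have hr' : r ∈ uIcc 0 t := uIoc_subset_uIcc hr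
  have hr'' : r ∈ Icc 0 T := by
    have := hsub hr'; rwa [uIcc_of_le (ht.1.trans ht.2)] at this
  rw [h1 hr', h2 hr', ← hf r hr'', ← hg r hr'']

lemma continuousOn_of_eq_const_add_integral {T : ℝ} (hT : 0 ≤ T) {f f' : ℝ → ℝ}
    (hf' : IntervalIntegrable f' volume 0 T)
    (hf : ∀ t ∈ Icc 0 T, f t = f 0 + ∫ r in (0 : ℝ)..t, f' r) : ContinuousOn f (Icc 0 T) := by
  have h := intervalIntegral.continuousOn_primitive_interval' hf' left_mem_uIcc
  rw [uIcc_of_le hT] at h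
  exact (continuousOn_const.add h).congr hf

/-- A nonlinear Gronwall inequality with integrable coefficient, up to a slack `η`. -/
lemma sqrt_gronwall_slack {T a η : ℝ} (hT : 0 ≤ T) (ha : 0 < a) (hη : 0 < η) {σ N : ℝ → ℝ}
    (hσ : IntervalIntegrable σ volume 0 T) (hσ0 : ∀ t, 0 ≤ σ t) (hN : ContinuousOn N (Icc 0 T))
    (hle : ∀ t ∈ Icc 0 T, N t ≤ a + 2 * ∫ r in (0 : ℝ)..t, σ r * Real.sqrt (N r)) :
    Real.sqrt (a + 2 * ∫ r in (0 : ℝ)..T, σ r * Real.sqrt (N r)) ≤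
      Real.sqrt a + (1 + η) * ∫ r in (0 : ℝ)..T, σ r := by
  have hp : IntervalIntegrable (fun r => σ r * Real.sqrt (N r)) volume 0 T :=
    hσ.mul_continuousOn (by rw [uIcc_of_le hT]; exact hN.sqrt)
  set G : ℝ → ℝ := fun t => a + 2 * ∫ r in (0 : ℝ)..t, σ r * Real.sqrt (N r) with hG
  set S : ℝ → ℝ := fun t => ∫ r in (0 : ℝ)..t, σ r with hS
  have hsub {x y : ℝ} (hx : x ∈ Icc 0 T) (hy : y ∈ Icc 0 T) : uIcc x y ⊆ uIcc 0 T := by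
    rw [uIcc_of_le hT]; exact uIcc_subset_Icc hx hy
  have h0T : (0 : ℝ) ∈ Icc 0 T := left_mem_Icc.2 hT
  have hGc : ContinuousOn G (Icc 0 T) := by
    have h := intervalIntegral.continuousOn_primitive_interval' hp left_mem_uIcc
    rw [uIcc_of_le hT] at h
    exact continuousOn_const.add (continuousOn_const.mul h)
  have hSc : ContinuousOn S (Icc 0 T) := by
    have h := intervalIntegral.continuousOn_primitive_interval' hσ left_mem_uIcc
    rwa [uIcc_of_le hT] at h
  have hGdiff {x y : ℝ} (hx : x ∈ Icc 0 T) (hy : y ∈ Icc 0 T) :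
      G y - G x = 2 * ∫ r in x..y, σ r * Real.sqrt (N r) := by
    rw [← intervalIntegral.integral_interval_sub_left (hp.mono_set (hsub h0T hy))
      (hp.mono_set (hsub h0T hx))]
    simp only [hG]; ring
  have hSdiff {x y : ℝ} (hx : x ∈ Icc 0 T) (hy : y ∈ Icc 0 T) :
      S y - S x = ∫ r in x..y, σ r := by
    rw [← intervalIntegral.integral_interval_sub_left (hσ.mono_set (hsub h0T hy))
      (hσ.mono_set (hsub h0T hx))]
  have hGmono {x y : ℝ} (hx : x ∈ Icc 0 T) (hy : y ∈ Icc 0 T) (hxy : x ≤ y) : G x ≤ G y := by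
    have h1 := hGdiff hx hy
    have h2 : 0 ≤ ∫ r in x..y, σ r * Real.sqrt (N r) :=
      intervalIntegral.integral_nonneg hxy fun r _ => mul_nonneg (hσ0 r) (Real.sqrt_nonneg _)
    linarith
  have hG0 : G 0 = a := by simp [hG]
  have hGpos {x : ℝ} (hx : x ∈ Icc 0 T) : 0 < G x :=
    (hG0 ▸ ha).trans_le (hGmono h0T hx hx.1)
  have hclosed : IsClosed ({t | Real.sqrt (G t) ≤ Real.sqrt a + (1 + η) * S t} ∩ Icc 0 T) := by
    rw [inter_comm]
    exact isClosed_Icc.isClosed_le hGc.sqrt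
      (continuousOn_const.add (continuousOn_const.mul hSc))
  -- Continuous induction: the set where the bound holds is closed and contains `0`, and it remains
  -- to extend it a little to the right of each of its points. This avoids differentiating `√G`.
  refine hclosed.Icc_subset_of_forall_exists_gt (by simp [hG0, hS]) ?_ (right_mem_Icc.2 hT)
  rintro x ⟨hxs, hx0, hxT⟩ y hy
  have hx : x ∈ Icc 0 T := ⟨hx0, hxT.le⟩
  have hQ : 0 < Real.sqrt (G x) := Real.sqrt_pos.2 (hGpos hx)
  -- The slack enters here: by continuity `√G` grows by less than the factor `1 + η` just after `x`.
  -- This needs `√G(x) > 0`, hence `a > 0`.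
  have hev : ∀ᶠ z in nhdsWithin x (Ioi x), Real.sqrt (G z) < (1 + η) * Real.sqrt (G x) := by
    have h1 : ContinuousWithinAt (fun z => Real.sqrt (G z)) (Ioc x T) x :=
      (hGc.sqrt x hx).mono fun z hz => ⟨hx0.trans hz.1.le, hz.2⟩
    have h2 := h1.eventually 
      (gt_mem_nhds (show Real.sqrt (G x) < (1 + η) * Real.sqrt (G x) by nlinarith))
    rwa [nhdsWithin_Ioc_eq_nhdsGT hxT] at h2
  obtain ⟨z, ⟨hz, hz1⟩⟩ := (hev.and (Ioc_mem_nhdsGT (lt_min hy hxT))).exists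
  have hzT : z ∈ Icc 0 T := ⟨hx0.trans hz1.1.le, hz1.2.trans (min_le_right _ _)⟩
  refine ⟨z, ?_, hz1.1, hz1.2.trans (min_le_left _ _)⟩
  have hI : 0 ≤ ∫ r in x..z, σ r := intervalIntegral.integral_nonneg hz1.1.le fun r _ => hσ0 r
  -- On `[x, z]` the hypothesis and monotonicity give `N ≤ G ≤ G z`.
  have hle2 : G z - G x ≤ 2 * (Real.sqrt (G z) * ∫ r in x..z, σ r) := by
    rw [hGdiff hx hzT, ← intervalIntegral.integral_const_mul (Real.sqrt (G z))]
    refine mul_le_mul_of_nonneg_left (intervalIntegral.integral_mono_on hz1.1.le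
      (hp.mono_set (hsub hx hzT)) ((hσ.mono_set (hsub hx hzT)).const_mul _) fun r hr => ?_) two_pos.le
    have hr' : r ∈ Icc 0 T := ⟨hx0.trans hr.1, hr.2.trans hzT.2⟩
    rw [mul_comm]
    exact mul_le_mul_of_nonneg_right
      (Real.sqrt_le_sqrt ((hle r hr').trans (hGmono hr' hzT hr.2))) (hσ0 r)
  have hP2 := Real.sq_sqrt (hGpos hzT).le
  have hQ2 := Real.sq_sqrt (hGpos hx).le
  have hP : 0 ≤ Real.sqrt (G z) := Real.sqrt_nonneg _
  have hS' := hSdiff hx hzT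
  change Real.sqrt (G z) ≤ Real.sqrt a + (1 + η) * S z
  have hxs' : Real.sqrt (G x) ≤ Real.sqrt a + (1 + η) * S x := hxs
  set P := Real.sqrt (G z)
  set Q := Real.sqrt (G x)
  set I := ∫ r in x..z, σ r
  -- From `P < (1 + η) Q`. Since `(P + Q)(P - Q) = G z - G x ≤ 2 P I`, division by `P + Q` leaves
  -- the increment bound `(1 + η) I`.
  have h3 : 2 * P ≤ (1 + η) * (P + Q) := by nlinarith
  have h4 : (P + Q) * (P - Q) ≤ (P + Q) * ((1 + η) * I) := by
    have := mul_le_mul_of_nonneg_right h3 hI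
    nlinarith
  have h5 : P - Q ≤ (1 + η) * I := le_of_mul_le_mul_left h4 (by positivity)
  have h6 : S z = S x + I := by linarith
  rw [h6]
  linarith

/-- A nonlinear Gronwall inequality with integrable coefficient. -/
lemma sqrt_gronwall {T a : ℝ} (hT : 0 ≤ T) (ha : 0 ≤ a) {σ N : ℝ → ℝ}
    (hσ : IntervalIntegrable σ volume 0 T) (hσ0 : ∀ t, 0 ≤ σ t) (hN : ContinuousOn N (Icc 0 T))
    (hle : ∀ t ∈ Icc 0 T, N t ≤ a + 2 * ∫ r in (0 : ℝ)..t, σ r * Real.sqrt (N r)) :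
    Real.sqrt (a + 2 * ∫ r in (0 : ℝ)..T, σ r * Real.sqrt (N r)) ≤
      Real.sqrt a + ∫ r in (0 : ℝ)..T, σ r := by
  refine le_of_forall_pos_le_add fun ε hε => ?_
  have hS : 0 ≤ ∫ r in (0 : ℝ)..T, σ r := intervalIntegral.integral_nonneg hT fun r _ => hσ0 r
  set S := ∫ r in (0 : ℝ)..T, σ r
  -- Perturbing `a` to `a + η²` costs `η` under the root and the slack costs `η S`, in total `ε`.
  set η := ε / (1 + S) with hη
  have hη0 : 0 < η := by positivity
  have hηε : η * (1 + S) = ε := by rw [hη]; field_simp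
  have h1 := sqrt_gronwall_slack (a := a + η ^ 2) hT (by positivity) hη0 hσ hσ0 hN
    (fun t ht => (hle t ht).trans (by linarith [sq_nonneg η]))
  have h2 : Real.sqrt (a + η ^ 2) ≤ Real.sqrt a + η := by
    rw [Real.sqrt_le_left (by positivity)]
    nlinarith [Real.sq_sqrt ha, Real.sqrt_nonneg a]
  have h3 : Real.sqrt (a + 2 * ∫ r in (0 : ℝ)..T, σ r * Real.sqrt (N r)) ≤
      Real.sqrt (a + η ^ 2 + 2 * ∫ r in (0 : ℝ)..T, σ r * Real.sqrt (N r)) :=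
    Real.sqrt_le_sqrt (by linarith [sq_nonneg η])
  linarith


/-! ### Time dependence through the coefficients -/

/-- The exponents of the monomials that may occur in a polynomial of degree at most `k`. -/
noncomputable def exponents (k : ℕ) : Finset (Fin 2 →₀ ℕ) :=
  Finset.Iic (Finsupp.equivFunOnFinite.symm fun _ => k)

/-- Value of a monomial. -/
def mono (m : Fin 2 →₀ ℕ) (x : Pt) : ℝ := ∏ i, x i ^ m i

@[fun_prop]
lemma continuous_mono (m : Fin 2 →₀ ℕ) : Continuous (mono m) := by unfold mono; fun_prop

lemma ev_eq_sum {P : Poly} {k : ℕ} (hP : P.totalDegree ≤ k) (x : Pt) :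
    ev P x = ∑ m ∈ exponents k, P.coeff m * mono m x := by
  rw [ev, MvPolynomial.eval_eq']
  refine Finset.sum_subset (fun m hm => ?_) fun m _ hm => ?_
  · rw [exponents, Finset.mem_Iic]
    intro i
    exact ((MvPolynomial.monomial_le_degreeOf i hm).trans
      (MvPolynomial.degreeOf_le_totalDegree _ _)).trans hP
  · rw [MvPolynomial.notMem_support_iff.1 hm, zero_mul]

namespace StaggeredMesh

variable {M : StaggeredMesh}

lemma measurable_intCells (S : Finset (Fin M.N)) {w : ℝ → Fin M.N → Pt → ℝ}
    (hw : ∀ τ ∈ S, Measurable fun y : ℝ × Pt => w y.1 τ y.2) :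
    Measurable fun t => M.intCells S (w t) := by
  unfold intCells
  exact Finset.measurable_fun_sum _ fun τ hτ =>
    ((hw τ hτ).stronglyMeasurable.integral_prod_right' (ν := volume.restrict (M.cell τ))).measurable

end StaggeredMesh

lemma measurable_edgeInt (p q : Pt) {w : ℝ → Pt → ℝ}
    (hw : Measurable fun y : ℝ × Pt => w y.1 y.2) : Measurable fun t => edgeInt p q (w t) := by
  unfold edgeInt
  simp only [intervalIntegral.integral_of_le zero_le_one]
  have h : Measurable fun y : ℝ × ℝ => w y.1 (AffineMap.lineMap p q y.2) :=
    hw.comp (measurable_fst.prodMk ((continuous_lineMap p q).measurable.comp measurable_snd))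
  exact (h.stronglyMeasurable.integral_prod_right'
    (ν := volume.restrict (Ioc (0 : ℝ) 1))).measurable.const_mul _

namespace StaggeredMesh

variable {M : StaggeredMesh}

lemma measurable_intPr (S : Finset (Fin M.N)) {w : ℝ → Fin M.N → Pt → ℝ}
    (hw : ∀ τ ∈ S, Measurable fun y : ℝ × Pt => w y.1 τ y.2) :
    Measurable fun t => M.intPr S (w t) :=
  Finset.measurable_fun_sum _ fun τ hτ => measurable_edgeInt _ _ (hw τ hτ)

lemma measurable_intDl (S : Finset (Fin M.N)) {w : ℝ → Fin M.N → Pt → ℝ}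
    (hw : ∀ τ ∈ S, Measurable fun y : ℝ × Pt => w y.1 τ y.2) :
    Measurable fun t => M.intDl S (w t) :=
  Finset.measurable_fun_sum _ fun τ hτ => measurable_edgeInt _ _ (hw τ hτ)

end StaggeredMesh

/-! ### Time evolution of the mass through polynomial coefficients -/

namespace TransportData

open StaggeredMesh FlowData

variable {M : StaggeredMesh} {k : ℕ} {F : FlowData M k} {T : ℝ} (D : TransportData F T)

/-- Moments of the porosity. -/
noncomputable def moment (τ : Fin M.N) (m n : Fin 2 →₀ ℕ) : ℝ :=
  ∫ x in M.cell τ, D.φ x * (mono m x * mono n x)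

lemma moment_symm (τ : Fin M.N) (m n : Fin 2 →₀ ℕ) : D.moment τ m n = D.moment τ n m := by
  unfold moment; simp only [mul_comm (mono m _)]

/-- The inner product weighted by the porosity, in terms of coefficients. -/
noncomputable def pairing (k : ℕ) (b c : Fin M.N → Poly) : ℝ :=
  ∑ τ, ∑ m ∈ exponents k, ∑ n ∈ exponents k,
    (b τ).coeff m * (c τ).coeff n * D.moment τ m n

/-- Expansion in monomials separates time, carried by the coefficients, from space, carried by
constant moments. Differentiating the mass becomes the scalar product rule. -/
lemma pairing_eq {b c : Fin M.N → Poly} (hb : ∀ τ, (b τ).totalDegree ≤ k)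
    (hc : ∀ τ, (c τ).totalDegree ≤ k) :
    M.intCells Finset.univ (fun τ x => D.φ x * ev (b τ) x * ev (c τ) x) = D.pairing k b c := by
  refine Finset.sum_congr rfl fun τ _ => ?_
  have hi (m n : Fin 2 →₀ ℕ) : IntegrableOn (fun x => (b τ).coeff m * (c τ).coeff n *
      (D.φ x * (mono m x * mono n x))) (M.cell τ) :=
    (D.integrableOn_cell_φ_mul (by fun_prop) τ).const_mul _
  have h1 : ∀ x, D.φ x * ev (b τ) x * ev (c τ) x = ∑ m ∈ exponents k, ∑ n ∈ exponents k,
      (b τ).coeff m * (c τ).coeff n * (D.φ x * (mono m x * mono n x)) := by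
    intro x
    rw [ev_eq_sum (hb τ), ev_eq_sum (hc τ), mul_assoc, Finset.sum_mul_sum, Finset.mul_sum]
    refine Finset.sum_congr rfl fun m _ => ?_
    rw [Finset.mul_sum]
    exact Finset.sum_congr rfl fun n _ => by ring
  simp only [h1]
  rw [integral_finsetSum _ fun m _ => integrable_finsetSum _ fun n _ => hi m n]
  refine Finset.sum_congr rfl fun m _ => ?_
  rw [integral_finsetSum _ fun n _ => hi m n]
  exact Finset.sum_congr rfl fun n _ => integral_const_mul _ _

lemma mass_eq_pairing {c : Fin M.N → Poly} (hc : ∀ τ, (c τ).totalDegree ≤ k) :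
    D.mass c = D.pairing k c c := by
  rw [← D.pairing_eq hc hc, mass]
  exact intCells_congr fun τ _ x _ => by ring

lemma pairing_symm (b c : Fin M.N → Poly) : D.pairing k b c = D.pairing k c b := by
  refine Finset.sum_congr rfl fun τ _ => ?_
  rw [Finset.sum_comm]
  refine Finset.sum_congr rfl fun m _ => Finset.sum_congr rfl fun n _ => ?_
  rw [D.moment_symm]; ring

/-- `c` is absolutely continuous on `[0, T]`, coefficient by coefficient, with derivative `c'`. -/
def HasCoeffDeriv (T : ℝ) (c c' : ℝ → Fin M.N → Poly) : Prop :=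
  ∀ τ m, IntervalIntegrable (fun t => (c' t τ).coeff m) volume 0 T ∧
    ∀ t ∈ Icc 0 T, (c t τ).coeff m = (c 0 τ).coeff m + ∫ r in (0 : ℝ)..t, (c' r τ).coeff m

lemma HasCoeffDeriv.continuousOn {c c' : ℝ → Fin M.N → Poly} (h : HasCoeffDeriv T c c')
    (hT : 0 ≤ T) (τ : Fin M.N) (m : Fin 2 →₀ ℕ) :
    ContinuousOn (fun t => (c t τ).coeff m) (Icc 0 T) :=
  continuousOn_of_eq_const_add_integral hT (h τ m).1 (h τ m).2

lemma HasCoeffDeriv.continuousOn_pairing {c c' : ℝ → Fin M.N → Poly} (h : HasCoeffDeriv T c c')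
    (hT : 0 ≤ T) : ContinuousOn (fun t => D.pairing k (c t) (c t)) (Icc 0 T) :=
  continuousOn_finsetSum _ fun τ _ => continuousOn_finsetSum _ fun m _ =>
    continuousOn_finsetSum _ fun n _ =>
      ((h.continuousOn hT τ m).mul (h.continuousOn hT τ n)).mul continuousOn_const

lemma HasCoeffDeriv.intervalIntegrable_mul {c c' : ℝ → Fin M.N → Poly}
    (h : HasCoeffDeriv T c c') (hT : 0 ≤ T) (τ : Fin M.N) (m n : Fin 2 →₀ ℕ) :
    IntervalIntegrable (fun t => (c' t τ).coeff m * (c t τ).coeff n) volume 0 T :=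
  (h τ m).1.mul_continuousOn (by rw [uIcc_of_le hT]; exact h.continuousOn hT τ n)

lemma HasCoeffDeriv.intervalIntegrable_pairing {c c' : ℝ → Fin M.N → Poly}
    (h : HasCoeffDeriv T c c') (hT : 0 ≤ T) :
    IntervalIntegrable (fun t => D.pairing k (c' t) (c t)) volume 0 T := by
  unfold pairing
  rw [intervalIntegrable_iff]
  exact integrable_finsetSum _ fun τ _ => integrable_finsetSum _ fun m _ =>
    integrable_finsetSum _ fun n _ =>
      (intervalIntegrable_iff.1 (h.intervalIntegrable_mul hT τ m n)).mul_const _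

/-- The evolution of `⟨φ c, c⟩` in time. -/
lemma HasCoeffDeriv.pairing_sub_pairing {c c' : ℝ → Fin M.N → Poly}
    (h : HasCoeffDeriv T c c') {t : ℝ} (ht : t ∈ Icc 0 T) :
    D.pairing k (c t) (c t) - D.pairing k (c 0) (c 0) =
      2 * ∫ r in (0 : ℝ)..t, D.pairing k (c' r) (c r) := by
  have hT : 0 ≤ T := ht.1.trans ht.2
  have hsub : uIcc 0 t ⊆ uIcc 0 T := by
    rw [uIcc_of_le ht.1, uIcc_of_le hT]; exact Icc_subset_Icc_right ht.2
  have hi (τ : Fin M.N) (m n : Fin 2 →₀ ℕ) : IntervalIntegrable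
      (fun r => ((c' r τ).coeff m * (c r τ).coeff n + (c r τ).coeff m * (c' r τ).coeff n) *
        D.moment τ m n) volume 0 t := by
    have h1 := (h.intervalIntegrable_mul hT τ m n).mono_set hsub
    have h2 := (h.intervalIntegrable_mul hT τ n m).mono_set hsub
    simp only [mul_comm ((c' _ τ).coeff n)] at h2
    exact (h1.add h2).mul_const _
  -- Adding the transposed pairing makes every summand the full derivative of a product of two
  -- coefficients.
  have e : ∀ r, D.pairing k (c' r) (c r) + D.pairing k (c r) (c' r) =
      ∑ τ, ∑ m ∈ exponents k, ∑ n ∈ exponents k,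
        ((c' r τ).coeff m * (c r τ).coeff n + (c r τ).coeff m * (c' r τ).coeff n) *
          D.moment τ m n := by
    intro r
    simp only [pairing, ← Finset.sum_add_distrib, add_mul]
  have e2 : 2 * ∫ r in (0 : ℝ)..t, D.pairing k (c' r) (c r) =
      ∫ r in (0 : ℝ)..t, (D.pairing k (c' r) (c r) + D.pairing k (c r) (c' r)) := by
    rw [← intervalIntegral.integral_const_mul]
    congr 1
    funext r
    rw [D.pairing_symm (c r)]; ring
  rw [e2]
  simp only [e]
  have hi2 (τ : Fin M.N) (m : Fin 2 →₀ ℕ) := IntervalIntegrable.sum (exponents k)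
    (f := fun n r => ((c' r τ).coeff m * (c r τ).coeff n + (c r τ).coeff m * (c' r τ).coeff n) *
        D.moment τ m n) fun n _ => hi τ m n
  have hi3 (τ : Fin M.N) := IntervalIntegrable.sum (exponents k)
    (f := fun m r => ∑ n ∈ exponents k, ((c' r τ).coeff m * (c r τ).coeff n +
      (c r τ).coeff m * (c' r τ).coeff n) * D.moment τ m n) fun m _ => by
        simpa only [Finset.sum_fn] using hi2 τ m
  rw [intervalIntegral.integral_finsetSum fun τ _ => by simpa only [Finset.sum_fn] using hi3 τ]
  simp only [pairing, ← Finset.sum_sub_distrib]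
  refine Finset.sum_congr rfl fun τ _ => ?_
  rw [intervalIntegral.integral_finsetSum fun m _ => by simpa only [Finset.sum_fn] using hi2 τ m]
  refine Finset.sum_congr rfl fun m _ => ?_
  rw [intervalIntegral.integral_finsetSum fun n _ => hi τ m n]
  refine Finset.sum_congr rfl fun n _ => ?_
  rw [intervalIntegral.integral_mul_const, ← mul_sub_mul_eq_integral (h τ m).1 (h τ n).1
    (h τ m).2 (h τ n).2 ht]
  ring

/-- Time is clamped to `[0, T]`, the only interval where `c` is controlled; this gives joint
continuity on the whole product space. -/
lemma HasCoeffDeriv.continuous_ev {c c' : ℝ → Fin M.N → Poly}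
    (h : HasCoeffDeriv T c c') (hT : 0 ≤ T) (hc : ∀ t ∈ Icc 0 T, c t ∈ M.U k) (τ : Fin M.N) :
    Continuous fun y : ℝ × Pt => ev (c (projIcc 0 T hT y.1) τ) y.2 := by
  have e : ∀ y : ℝ × Pt, ev (c (projIcc 0 T hT y.1) τ) y.2 =
      ∑ m ∈ exponents k, (c (projIcc 0 T hT y.1) τ).coeff m * mono m y.2 :=
    fun y => ev_eq_sum ((hc _ (projIcc 0 T hT y.1).2).1 τ) _
  simp only [e]
  refine continuous_finsetSum _ fun m _ => Continuous.mul ?_ (by fun_prop)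
  exact (h.continuousOn hT τ m).domRestrict.comp (continuous_projIcc.comp continuous_fst)

/-- The terms of the energy identity that do not contain the time derivative depend measurably
on time. -/
lemma HasCoeffDeriv.aestronglyMeasurable {c c' : ℝ → Fin M.N → Poly}
    (h : HasCoeffDeriv T c c') (hT : 0 ≤ T) (hc : ∀ t ∈ Icc 0 T, c t ∈ M.U k)
    (u : Fin M.N → Fin 2 → Poly) :
    AEStronglyMeasurable (fun t =>
      M.intCells Finset.univ (fun τ x => D.φ x * D.s t x * ev (c t τ) x)
        - F.intIn (fun τ x => D.cin t x * F.g x * ev (c t τ) x)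
        + M.intCells Finset.univ (fun τ x => D.chat t x * F.fplus τ x * ev (c t τ) x)
        - dissipation F u (c t)) (volume.restrict (Ioc 0 T)) := by
  set d : ℝ → Fin M.N → Poly := fun t => c (projIcc 0 T hT t) with hd
  have hdm : ∀ τ, Measurable fun y : ℝ × Pt => ev (d y.1 τ) y.2 :=
    fun τ => (h.continuous_ev hT hc τ).measurable
  have hφ : Measurable fun y : ℝ × Pt => D.φ y.2 := D.φ_meas.comp measurable_snd
  have hg : Measurable fun y : ℝ × Pt => F.g y.2 := F.g_meas.comp measurable_snd
  have hf : ∀ τ, Measurable fun y : ℝ × Pt => ev (F.f τ) y.2 :=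
    fun τ => (BDT.continuous_ev _).measurable.comp measurable_snd
  have hu : ∀ τ, Measurable fun y : ℝ × Pt => |evV (u τ) y.2 ⬝ᵥ M.nDl τ| := fun τ =>
    ((continuous_evV_dotProduct (u τ) (M.nDl τ)).abs.measurable).comp measurable_snd
  have hS : MeasurableSet {y : ℝ × Pt | F.g y.2 < 0} := measurableSet_lt hg measurable_const
  have hmeas : Measurable fun t =>
      M.intCells Finset.univ (fun τ x => D.φ x * D.s t x * ev (d t τ) x)
        - F.intIn (fun τ x => D.cin t x * F.g x * ev (d t τ) x)
        + M.intCells Finset.univ (fun τ x => D.chat t x * F.fplus τ x * ev (d t τ) x)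
        - dissipation F u (d t) := by
    have m1 := measurable_intCells (M := M) Finset.univ
      (w := fun t τ x => D.φ x * D.s t x * ev (d t τ) x)
      fun τ _ => (hφ.mul D.s_meas).mul (hdm τ)
    have m2 := measurable_intPr (M := M) M.bdry
      (w := fun t τ => {y | F.g y < 0}.indicator fun x => D.cin t x * F.g x * ev (d t τ) x)
      fun τ _ => by
        have : Measurable ({y : ℝ × Pt | F.g y.2 < 0}.indicator
            fun y : ℝ × Pt => D.cin y.1 y.2 * F.g y.2 * ev (d y.1 τ) y.2) :=
          ((D.cin_meas.mul hg).mul (hdm τ)).indicator hS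
        convert! this using 1
    have m3 := measurable_intCells (M := M) Finset.univ
      (w := fun t τ x => D.chat t x * F.fplus τ x * ev (d t τ) x)
      fun τ _ => (D.chat_meas.mul ((hf τ).max measurable_const)).mul (hdm τ)
    have m4 := measurable_intCells (M := M) Finset.univ
      (w := fun t τ x => |ev (F.f τ) x| * ev (d t τ) x ^ 2)
      fun τ _ => (measurable_abs.comp (hf τ)).mul ((hdm τ).pow_const 2)
    have m5 := measurable_intDl (M := M) Finset.univ
      (w := fun t τ x => jumpDl (fun σ => ev (d t σ) x) τ ^ 2 * |evV (u τ) x ⬝ᵥ M.nDl τ|)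
      fun τ _ => (((hdm τ).sub (hdm (M.next τ))).pow_const 2).mul (hu τ)
    have m6 := measurable_intPr (M := M) M.bdry
      (w := fun t τ x => |F.g x| * ev (d t τ) x ^ 2)
      fun τ _ => (measurable_abs.comp hg).mul ((hdm τ).pow_const 2)
    exact ((m1.sub m2).add m3).sub (((m4.const_mul _).add (m5.const_mul _)).add (m6.const_mul _))
  refine hmeas.aestronglyMeasurable.congr ?_
  filter_upwards [ae_restrict_mem measurableSet_Ioc] with t ht
  have : d t = c t := by simp only [hd, projIcc_of_mem hT (Ioc_subset_Icc_self ht)]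
  simp only [this]

end TransportData
end BDT

/-! ### Integration in time and the stability estimate -/

theorem mainTheorem4 (M : BDT.StaggeredMesh) (k : ℕ) (hk : 1 ≤ k) (T : ℝ) (hT : 0 < T)
    (F : BDT.FlowData M k)
    (u : BDT.Pt → BDT.Pt) (hu : F.SatisfiesMassBalance u)
    (Lh : Fin M.N → Fin 2 → Fin 2 → BDT.Poly) (uh : Fin M.N → Fin 2 → BDT.Poly)
    (pBh pDh : Fin M.N → BDT.Poly) (hflow : F.IsDiscreteFlow Lh uh pBh pDh)
    (D : BDT.TransportData F T)
    (zh : ℝ → Fin M.N → Fin 2 → BDT.Poly) (ch : ℝ → Fin M.N → BDT.Poly)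
    (hsol : D.IsDiscreteTransport uh zh ch) :
    IntervalIntegrable (fun t => D.fluxNormSq t (zh t)) volume 0 T ∧
    D.normC ch zh ≤
      Real.sqrt (D.φhi * BDT.l2norm M.Ω D.c0 ^ 2
        + ∫ t in (0 : ℝ)..T,
            (F.intIn (fun _ x => |F.g x| * D.cin t x ^ 2)
              + M.intCells M.cellsD (fun τ x => D.chat t x ^ 2 * F.fplus τ x)))
      + ∫ t in (0 : ℝ)..T, BDT.l2norm M.Ω (fun x => Real.sqrt (D.φ x) * D.s t x) := by
  classical
  obtain ⟨hcU, hc0, c', hcoef, hae⟩ := hsol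
  have hT0 : 0 ≤ T := hT.le
  have h : BDT.TransportData.HasCoeffDeriv T ch c' := hcoef
  set σ : ℝ → ℝ := fun t => BDT.l2norm M.Ω fun x => Real.sqrt (D.φ x) * D.s t x with hσ
  set N : ℝ → ℝ := fun t => D.pairing k (ch t) (ch t) with hN
  set A : ℝ → ℝ := fun t => F.intIn (fun _ x => |F.g x| * D.cin t x ^ 2)
    + M.intCells M.cellsD (fun τ x => D.chat t x ^ 2 * F.fplus τ x) with hA
  set P : ℝ → ℝ := fun t => D.pairing k (c' t) (ch t) with hP
  set Φ : ℝ → ℝ := fun t => D.fluxNormSq t (zh t) with hΦ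
  have hσ0 : ∀ t, 0 ≤ σ t := fun t => Real.sqrt_nonneg _
  have hσi : IntervalIntegrable σ volume 0 T := D.s_int
  have hA0 : ∀ t, 0 ≤ A t := by
    intro t
    refine add_nonneg ?_ (Finset.sum_nonneg fun τ _ => integral_nonneg fun x =>
      mul_nonneg (sq_nonneg _) (le_max_right _ _))
    unfold BDT.FlowData.intIn BDT.StaggeredMesh.intPr
    exact Finset.sum_nonneg fun τ _ => BDT.edgeInt_nonneg fun x =>
      indicator_nonneg (fun x _ => by positivity) x
  have hAi : IntervalIntegrable A volume 0 T := D.cin_int.add D.chat_int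
  have hNc : ContinuousOn N (Icc 0 T) := h.continuousOn_pairing D hT0
  have hNm : ∀ t ∈ Icc 0 T, N t = D.mass (ch t) := fun t ht =>
    (D.mass_eq_pairing (hcU t ht).1).symm
  have hPi : IntervalIntegrable P volume 0 T := h.intervalIntegrable_pairing D hT0
  have hσN : IntervalIntegrable (fun t => σ t * Real.sqrt (N t)) volume 0 T :=
    hσi.mul_continuousOn (by rw [uIcc_of_le hT0]; exact hNc.sqrt)
  -- The ellipticity of `K` is assumed only on the open time interval.
  have hIoo : ∀ᵐ t ∂(volume.restrict (Ioc 0 T)), t ∈ Ioo 0 T := by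
    rw [← Measure.restrict_congr_set (Ioo_ae_eq_Ioc (μ := volume))]
    exact ae_restrict_mem measurableSet_Ioo
  -- The identity, not the inequality, is recorded: it expresses `Φ` by functions measurable in
  -- time, although nothing is assumed about the time dependence of `zh`.
  have hident : ∀ᵐ t ∂(volume.restrict (Ioc 0 T)),
      M.intCells Finset.univ (fun τ x => D.φ x * D.s t x * BDT.ev (ch t τ) x)
        - F.intIn (fun τ x => D.cin t x * F.g x * BDT.ev (ch t τ) x)
        + M.intCells Finset.univ (fun τ x => D.chat t x * F.fplus τ x * BDT.ev (ch t τ) x)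
        - BDT.TransportData.dissipation F uh (ch t) - P t = Φ t := by
    filter_upwards [hae, hIoo] with t ⟨h1, h2, h3, h4⟩ ht
    have hcu := hcU t (Ioo_subset_Icc_self ht)
    have e := D.energy_identity hk hflow hu hcu h2 h3 h4
    rw [D.pairing_eq h1.1 hcu.1] at e
    simp only [hP, hΦ]
    linarith
  have hΦ0 : ∀ᵐ t ∂(volume.restrict (Ioc 0 T)), 0 ≤ Φ t := by
    filter_upwards [hIoo] with t ht using D.fluxNormSq_nonneg ht _
  have hΦle : ∀ᵐ t ∂(volume.restrict (Ioc 0 T)),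
      Φ t ≤ σ t * Real.sqrt (N t) + 1 / 2 * A t - P t := by
    filter_upwards [hae, hIoo, D.s_sq, D.cin_sq, D.chat_sq] with t ⟨h1, h2, h3, h4⟩ ht h5 h6 h7
    have hcu := hcU t (Ioo_subset_Icc_self ht)
    have e := D.energy_inequality hk hflow hu hcu h2 h3 h4 h6 h7
    have e2 := D.source_le h5 (ch t)
    rw [D.pairing_eq h1.1 hcu.1] at e
    rw [← hNm t (Ioo_subset_Icc_self ht)] at e2
    simp only [hP, hΦ, hA, hσ]
    linarith
  have hbi : IntervalIntegrable (fun t => σ t * Real.sqrt (N t) + 1 / 2 * A t - P t) volume 0 T :=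
    (hσN.add (hAi.const_mul _)).sub hPi
  have hΦi : IntervalIntegrable Φ volume 0 T := by
    rw [intervalIntegrable_iff_integrableOn_Ioc_of_le hT0] at hbi hPi ⊢
    refine Integrable.mono' hbi (((h.aestronglyMeasurable D hT0 hcU uh).sub
      hPi.aestronglyMeasurable).congr hident) ?_
    filter_upwards [hΦ0, hΦle] with t h1 h2
    rwa [Real.norm_eq_abs, abs_of_nonneg h1]
  refine ⟨hΦi, ?_⟩
  have hinit : N 0 ≤ D.φhi * BDT.l2norm M.Ω D.c0 ^ 2 := by
    have h0 : (0 : ℝ) ∈ Icc 0 T := left_mem_Icc.2 hT0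
    rw [hNm 0 h0]
    exact D.mass_initial_le (hcU 0 h0) hc0
  set a : ℝ := D.φhi * BDT.l2norm M.Ω D.c0 ^ 2 + ∫ t in (0 : ℝ)..T, A t with ha
  -- Twice the time-integrated energy inequality; the data `A` are integrated up to `T` so that `a`
  -- does not depend on `t`.
  have henergy : ∀ t ∈ Icc 0 T, N t + 2 * ∫ r in (0 : ℝ)..t, Φ r ≤
      a + 2 * ∫ r in (0 : ℝ)..t, σ r * Real.sqrt (N r) := by
    intro t ht
    have hsub : uIcc 0 t ⊆ uIcc 0 T := by
      rw [uIcc_of_le ht.1, uIcc_of_le hT0]; exact Icc_subset_Icc_right ht.2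
    have e1 := h.pairing_sub_pairing D (k := k) ht
    have e2 : ∫ r in (0 : ℝ)..t, Φ r ≤
        ∫ r in (0 : ℝ)..t, (σ r * Real.sqrt (N r) + 1 / 2 * A r - P r) := by
      refine intervalIntegral.integral_mono_ae_restrict ht.1 (hΦi.mono_set hsub)
        (hbi.mono_set hsub) ?_
      rw [← restrict_Ioc_eq_restrict_Icc]
      exact ae_restrict_of_ae_restrict_of_subset (Ioc_subset_Ioc_right ht.2) hΦle
    rw [intervalIntegral.integral_sub ((hσN.mono_set hsub).add ((hAi.mono_set hsub).const_mul _))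
      (hPi.mono_set hsub), intervalIntegral.integral_add (hσN.mono_set hsub)
      ((hAi.mono_set hsub).const_mul _), intervalIntegral.integral_const_mul] at e2
    have e3 : ∫ r in (0 : ℝ)..t, A r ≤ ∫ r in (0 : ℝ)..T, A r :=
      intervalIntegral.integral_mono_interval le_rfl ht.1 ht.2
        (Filter.Eventually.of_forall hA0) hAi
    simp only [hN, hP] at e1 e2 hinit ⊢
    linarith
  have hΦint : ∀ t ∈ Icc 0 T, 0 ≤ ∫ r in (0 : ℝ)..t, Φ r := by
    intro t ht
    rw [intervalIntegral.integral_of_le ht.1]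
    exact integral_nonneg_of_ae
      (ae_restrict_of_ae_restrict_of_subset (Ioc_subset_Ioc_right ht.2) hΦ0)
  have ha0 : 0 ≤ a := by
    have h1 : 0 ≤ N 0 := by
      rw [hNm 0 (left_mem_Icc.2 hT0)]; exact D.mass_nonneg _
    have h2 : 0 ≤ ∫ t in (0 : ℝ)..T, A t :=
      intervalIntegral.integral_nonneg hT0 fun t _ => hA0 t
    linarith
  -- The diffusion term is dropped to feed the Gronwall lemma, which bounds the whole right-hand
  -- side of `henergy` at time `T`; the diffusion term is thereby recovered in the last step.
  have hgron := BDT.sqrt_gronwall hT0 ha0 hσi hσ0 hNc fun t ht => by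
    linarith [henergy t ht, hΦint t ht]
  refine le_trans ?_ hgron
  have hTT : T ∈ Icc 0 T := right_mem_Icc.2 hT0
  rw [BDT.TransportData.normC, D.mass_eq, ← hNm T hTT]
  exact Real.sqrt_le_sqrt (henergy T hTT)
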